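/- Setting. Let $d\ge 1$ and let $f:\mathbb R^d\to[0,\infty)$ be continuous, with $f(x)=0$ iff $x=0$, and $f(\lambda x)=\lambda f(x)$ for all $\lambda\ge 0$, $x\in\mathbb R^d$. Put $x\vee_f y:=x$ if $f(x)\ge f(y)$ and $x\vee_f y:=y$ if $f(x)<f(y)$; write $\bigvee_{f,\,j=1}^{k}x_j:=(\cdots(x_1\vee_f x_2)\vee_f\cdots)\vee_f x_k$. Put $x\le_f y$ iff $f(x)<f(y)$ or $x=y$. Let $\alpha>0$, let $\kappa$ be a Borel probability measure on $S:=\{f=1\}$, and write $Y\sim\Phi^f_{\alpha,\kappa}(\sigma)$, $\sigma\ge0$, if $Y\overset{d}{=}\sigma Z\Theta$ with $Z,\Theta$ independent, $\Theta\sim\kappa$ and $\mathbb P(Z\le x)=\exp(-x^{-\alpha})$ for $x>0$, $\mathbb P(Z\le x)=0$ for $x\le0$. Let $(E,\mathcal E,m)$ be a $\sigma$-finite measure space, $\mathcal E_0:=\{A\in\mathcal E:m(A)<\infty\}$, and let $M$ be an $f$-implicit $\alpha$-Fréchet sup-measure on it, i.e. a map assigning to each $A\in\mathcal E_0$ an $\mathbb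 R^d$-valued random vector $M(A)$ on a probability space $(\Omega,\mathcal A,\mathbb P)$ such that: $M(A_1),\dots,M(A_k)$ are independent for finitely many disjoint $A_1,\dots,A_k\in\mathcal E_0$; for disjoint $A_1,A_2,\dots\in\mathcal E_0$ with $\bigcup_jA_j\in\mathcal E_0$, almost surely $M(\bigcup_jA_j)=\lim_{k\to\infty}\bigvee_{f,\,j=1}^{k}M(A_j)=M(A_{j_0})$ for some random index $j_0$; and $M(A)\sim\Phi^f_{\alpha,\kappa}(m(A)^{1/\alpha})$ for every $A\in\mathcal E_0$. For a simple function $g=\sum_{j=1}^k\alpha_j\mathbf 1_{A_j}$ with $\alpha_j\ge0$ and disjoint $A_j\in\mathcal E_0$ put $I(g):=\bigvee_{f,\,j=1}^{k}\alpha_jM(A_j)$. Let $L^\alpha_+(m)$ be the set of measurable $g:E\to[0,\infty)$ with $\|g\|_\alpha:=(\int_E g^\alpha\,dm)^{1/\alpha}<\infty$. For $g\in L^\alpha_+(m)$ the $f$-implicit extremal integral $I(g)$ is the limit in probability of $I(g_n)$, where $(g_n)$ is a sequence of simple functions increasing pointwise to $g$. Proposition. Let $g_1,g_2\in L^\alpha_+(m)$.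 The integral $I(g_1)$ is well defined: there are simple functions increasing pointwise to $g_1$, and for every such sequence the integrals converge in probability to one and the same random vector (up to a.s. equality), whichever representations of the simple functions are used. Moreover: (i) $I(g_1)\sim\Phi^f_{\alpha,\kappa}(\|g_1\|_\alpha)$. (ii) For all $a,b\ge0$, $I(ag_1\vee bg_2)=aI(g_1)\vee_f bI(g_2)$ a.s.; in particular $I(g_1)\vee_f I(g_2)=I(g_2)\vee_f I(g_1)$ a.s. (iii) $I(g_1)$ and $I(g_2)$ are independent if and only if $g_1g_2=0$ $m$-a.e. (iv) $g_1\le g_2$ $m$-a.e. if and only if $I(g_1)\le_f I(g_2)$ a.s.; and $g_1=g_2$ $m$-a.e. if and only if $I(g_1)=I(g_2)$ a.s. -/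

import Mathlib

open MeasureTheory ProbabilityTheory Filter Topology

noncomputable section

/-- A loss function on `ℝ^d`: nonnegative, continuous, `1`-homogeneous, vanishing exactly at `0`. -/
structure IsLossFunction {d : ℕ} (f : EuclideanSpace ℝ (Fin d) → ℝ) : Prop where
  nonneg : ∀ x, 0 ≤ f x
  continuous : Continuous f
  eq_zero_iff : ∀ x, f x = 0 ↔ x = 0
  homogeneous : ∀ c : ℝ, 0 ≤ c → ∀ x, f (c • x) = c * f x

/-- `x ∨_f y` is `x` if `f x ≥ f y` and `y` if `f x < f y`. -/
def fVee {d : ℕ} (f : EuclideanSpace ℝ (Fin d) → ℝ) (x y : EuclideanSpace ℝ (Fin d)) :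
    EuclideanSpace ℝ (Fin d) :=
  if f x < f y then y else x

/-- `x 0 ∨_f x 1 ∨_f ⋯ ∨_f x n`, bracketed from the left. -/
def fVeeUpTo {d : ℕ} (f : EuclideanSpace ℝ (Fin d) → ℝ) (x : ℕ → EuclideanSpace ℝ (Fin d)) :
    ℕ → EuclideanSpace ℝ (Fin d)
  | 0 => x 0
  | n + 1 => fVee f (fVeeUpTo f x n) (x (n + 1))

/-- The relation `x ≤_f y`. -/
def fLe {d : ℕ} (f : EuclideanSpace ℝ (Fin d) → ℝ) (x y : EuclideanSpace ℝ (Fin d)) : Prop :=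
  f x < f y ∨ x = y

/-- The set `S = {f = 1}`. -/
def levelOne {d : ℕ} (f : EuclideanSpace ℝ (Fin d) → ℝ) : Set (EuclideanSpace ℝ (Fin d)) :=
  {x | f x = 1}

/-- `ν` is the standard `α`-Fréchet distribution: its distribution function is
`exp (-x ^ (-α))` for `x > 0` and `0` for `x ≤ 0`. -/
def IsStdFrechet (α : ℝ) (ν : Measure ℝ) : Prop :=
  IsProbabilityMeasure ν ∧
    ∀ x : ℝ, ν (Set.Iic x) = ENNReal.ofReal (if 0 < x then Real.exp (-x ^ (-α)) else 0)

/-- `Y` has the `f`-implicit `α`-Fréchet distribution with scale `σ` and angular part `κ`: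
its law is that of `σ Z Θ`, with `Z` standard `α`-Fréchet, `Θ` of law `κ`, and `Z`, `Θ`
independent, i.e. with `(Z, Θ)` distributed according to the product measure. -/
def IsImplicitFrechet {Ω : Type*} [MeasurableSpace Ω] (P : Measure Ω) {d : ℕ}
    (f : EuclideanSpace ℝ (Fin d) → ℝ) (α : ℝ) (κ : Measure (levelOne f)) (σ : ℝ)
    (Y : Ω → EuclideanSpace ℝ (Fin d)) : Prop :=
  ∃ ν : Measure ℝ, IsStdFrechet α ν ∧
    HasLaw Y ((ν.prod κ).map
      (fun p : ℝ × levelOne f => (σ * p.1) • (p.2 : EuclideanSpace ℝ (Fin d)))) P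

/-- `M` is an `f`-implicit sup-measure on the measurable sets of finite `m`-measure
(the values of `M` on all other sets are irrelevant). -/
structure IsImplicitSupMeasure {Ω E : Type*} [MeasurableSpace Ω] [MeasurableSpace E]
    (P : Measure Ω) (m : Measure E) {d : ℕ} (f : EuclideanSpace ℝ (Fin d) → ℝ)
    (M : Set E → Ω → EuclideanSpace ℝ (Fin d)) : Prop where
  measurable : ∀ A, MeasurableSet A → m A < ⊤ → Measurable (M A)
  /-- Independence over finitely many disjoint sets. -/
  indep : ∀ (k : ℕ) (A : Fin k → Set E), (∀ j, MeasurableSet (A j)) → (∀ j, m (A j) < ⊤) →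
    Pairwise (fun i j => Disjoint (A i) (A j)) → iIndepFun (fun j => M (A j)) P
  /-- Almost surely the finite `∨_f`-maxima of `M (A 0), M (A 1), …` converge to `M (⋃ j, A j)`,
  and this limit is one of the `M (A j)`. -/
  iUnion : ∀ A : ℕ → Set E, (∀ j, MeasurableSet (A j)) → (∀ j, m (A j) < ⊤) →
    Pairwise (fun i j => Disjoint (A i) (A j)) → m (⋃ j, A j) < ⊤ →
    ∀ᵐ ω ∂P,
      Tendsto (fun n => fVeeUpTo f (fun j => M (A j) ω) n) atTop (𝓝 (M (⋃ j, A j) ω)) ∧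
      ∃ j₀, M (⋃ j, A j) ω = M (A j₀) ω

/-- `M` is an `f`-implicit `α`-Fréchet sup-measure with angular part `κ` and control measure `m`. -/
structure IsFrechetSupMeasure {Ω E : Type*} [MeasurableSpace Ω] [MeasurableSpace E]
    (P : Measure Ω) (m : Measure E) {d : ℕ} (f : EuclideanSpace ℝ (Fin d) → ℝ)
    (α : ℝ) (κ : Measure (levelOne f)) (M : Set E → Ω → EuclideanSpace ℝ (Fin d)) : Prop
    extends IsImplicitSupMeasure P m f M where
  law : ∀ A, MeasurableSet A → m A < ⊤ →
    IsImplicitFrechet P f α κ ((m A).toReal ^ (1 / α)) (M A)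

/-- A representation `∑ j ≤ k, coef j * 1_{sets j}` of a nonnegative simple function, with disjoint
measurable sets of finite measure. Only the indices `j ≤ k` matter. -/
structure SimpleRep {E : Type*} [MeasurableSpace E] (m : Measure E) where
  k : ℕ
  coef : ℕ → ℝ
  sets : ℕ → Set E
  coef_nonneg : ∀ j ≤ k, 0 ≤ coef j
  sets_measurable : ∀ j ≤ k, MeasurableSet (sets j)
  sets_finite : ∀ j ≤ k, m (sets j) < ⊤
  sets_disjoint : ∀ i ≤ k, ∀ j ≤ k, i ≠ j → Disjoint (sets i) (sets j)

/-- The simple function that is represented. -/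
def SimpleRep.toFun {E : Type*} [MeasurableSpace E] {m : Measure E} (r : SimpleRep m) (s : E) : ℝ :=
  ∑ j ∈ Finset.range (r.k + 1), r.coef j * (r.sets j).indicator (fun _ => (1 : ℝ)) s

/-- The integral of a simple function, computed from a representation. -/
def SimpleRep.integral {Ω E : Type*} [MeasurableSpace E] {m : Measure E} {d : ℕ}
    (r : SimpleRep m) (f : EuclideanSpace ℝ (Fin d) → ℝ)
    (M : Set E → Ω → EuclideanSpace ℝ (Fin d)) (ω : Ω) : EuclideanSpace ℝ (Fin d) :=
  fVeeUpTo f (fun j => r.coef j • M (r.sets j) ω) r.k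

/-- `r n ↑ g`: the simple functions increase pointwise to `g`. -/
def IncreasesTo {E : Type*} [MeasurableSpace E] {m : Measure E} (r : ℕ → SimpleRep m)
    (g : E → ℝ) : Prop :=
  (∀ n s, (r n).toFun s ≤ (r (n + 1)).toFun s) ∧
    ∀ s, Tendsto (fun n => (r n).toFun s) atTop (𝓝 (g s))

/-- The random vector `X` is a version of the extremal integral of `g`: a limit in probability of
integrals of simple functions increasing to `g`. -/
def IsExtremalIntegral {Ω E : Type*} [MeasurableSpace Ω] [MeasurableSpace E]
    (P : Measure Ω) (m : Measure E) {d : ℕ} (f : EuclideanSpace ℝ (Fin d) → ℝ)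
    (M : Set E → Ω → EuclideanSpace ℝ (Fin d)) (g : E → ℝ)
    (X : Ω → EuclideanSpace ℝ (Fin d)) : Prop :=
  Measurable X ∧ ∃ r : ℕ → SimpleRep m, IncreasesTo r g ∧
    TendstoInMeasure P (fun n => (r n).integral f M) atTop X

open Classical in
/-- The `f`-implicit extremal integral `I(g)` (a fixed version of it; the value `0` is a default
for functions that are not integrable). -/
def extremalIntegral {Ω E : Type*} [MeasurableSpace Ω] [MeasurableSpace E]
    (P : Measure Ω) (m : Measure E) {d : ℕ} (f : EuclideanSpace ℝ (Fin d) → ℝ)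
    (M : Set E → Ω → EuclideanSpace ℝ (Fin d)) (g : E → ℝ) : Ω → EuclideanSpace ℝ (Fin d) :=
  if h : ∃ X, IsExtremalIntegral P m f M g X then h.choose else 0

/-- `g ∈ L^α_+(m)`. -/
structure MemLPlus {E : Type*} [MeasurableSpace E] (α : ℝ) (m : Measure E) (g : E → ℝ) : Prop where
  measurable : Measurable g
  nonneg : ∀ s, 0 ≤ g s
  memLp : MemLp g (ENNReal.ofReal α) m

/-- `‖g‖_α = (∫ |g|^α dm)^{1/α}`. -/
def alphaNorm {E : Type*} [MeasurableSpace E] (α : ℝ) (m : Measure E) (g : E → ℝ) : ℝ :=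
  (∫ s, |g s| ^ α ∂m) ^ (1 / α)

end

/-! ### Deterministic facts about `∨_f` -/

/-! Over disjoint sets the radii `f (M A)` are independent Fréchet variables, so two of them almost
surely tie only at `0`, where the vectors themselves vanish. A finite `∨_f`-maximum of such vectors
is then the unique maximiser of `f`, whatever the order and bracketing (`IsFMax.eq`, `ae_no_ties`).
This yields the splitting of the integral over a set and its complement
(`integral_eq_fVee_restrict`). The law of the maximum is again implicit Fréchet: the radii are
max-stable, and the winning vector brings an angle of law `κ` whichever vector wins
(`IsImplicitFrechet.fVee`).

The central estimate is continuity in probability of the integral of simple functions with respect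
to `L^α` (`exists_measure_dist_integral_le`). On a common refinement of two simple functions with
values `a p`, `b p`, put `γ = max a b`. With probability near `1`, one term `γ p • M (C p)` beats
all others by a factor `1 / c` and sits on a cell where `a p`, `b p` both exceed `c * γ p`. Then
both integrals are attained on that cell and nearly coincide. The probability that one Fréchet
variable beats independent ones with such a gap is explicit (`measure_dominates`), so everything is
controlled by `∫ |a^α - b^α|`. Hence increasing approximations are Cauchy in probability, with a
limit that depends neither on the sequence nor on the representations; laws, independence and the
splitting over a set pass to the limit.

The relation `≤_f` is not closed, so limits only give monotonicity of `f (I g)`. If `g = h` or `g ≤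
c * h` with `c < 1` at each point, the gap restores strictness. In general the set where `c * h < g
< h` shrinks to nothing as `c → 1`, and the probability that it carries the maximum of `I(h)` is its
share of `∫ h^α` (`fLe_extremalIntegral_of_le`). Max-linearity follows by splitting along `{h ≤ g}`
(`extremalIntegral_max`). The converses compare scales: max-linearity expresses the joint behaviour
of `f (I g)`, `f (I h)` through `∫ (g ∨ h)^α`, and equality of integrals of ordered functions forces
equality almost everywhere. -/

namespace IsLossFunction

variable {d : ℕ} {f : EuclideanSpace ℝ (Fin d) → ℝ}

theorem map_zero (hf : IsLossFunction f) : f 0 = 0 := (hf.eq_zero_iff 0).2 rfl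

theorem eq_zero_of_nonpos (hf : IsLossFunction f) {x : EuclideanSpace ℝ (Fin d)} (hx : f x ≤ 0) :
    x = 0 := (hf.eq_zero_iff x).1 (le_antisymm hx (hf.nonneg x))

theorem measurable (hf : IsLossFunction f) : Measurable f := hf.continuous.measurable

end IsLossFunction

section Deterministic

variable {d : ℕ} {f : EuclideanSpace ℝ (Fin d) → ℝ}

theorem map_fVee (x y : EuclideanSpace ℝ (Fin d)) : f (fVee f x y) = max (f x) (f y) := by
  unfold fVee
  split_ifs with h
  · rw [max_eq_right h.le]
  · rw [max_eq_left (not_lt.1 h)]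

theorem fVee_of_lt {x y : EuclideanSpace ℝ (Fin d)} (h : f x < f y) : fVee f x y = y :=
  if_pos h

theorem fVee_of_le {x y : EuclideanSpace ℝ (Fin d)} (h : f y ≤ f x) : fVee f x y = x :=
  if_neg (not_lt.2 h)

theorem fVee_eq_or (x y : EuclideanSpace ℝ (Fin d)) : fVee f x y = x ∨ fVee f x y = y := by
  unfold fVee
  split_ifs
  · exact Or.inr rfl
  · exact Or.inl rfl

theorem fVeeUpTo_mem (x : ℕ → EuclideanSpace ℝ (Fin d)) (n : ℕ) :
    ∃ j ≤ n, fVeeUpTo f x n = x j := by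
  induction n with
  | zero => exact ⟨0, le_rfl, rfl⟩
  | succ n ih =>
    obtain ⟨j, hj, h⟩ := ih
    rcases fVee_eq_or (f := f) (fVeeUpTo f x n) (x (n + 1)) with h' | h'
    · exact ⟨j, hj.trans n.le_succ, h'.trans h⟩
    · exact ⟨n + 1, le_rfl, h'⟩

theorem le_map_fVeeUpTo (x : ℕ → EuclideanSpace ℝ (Fin d)) {n j : ℕ} (hj : j ≤ n) :
    f (x j) ≤ f (fVeeUpTo f x n) := by
  induction n with
  | zero => rw [Nat.le_zero.1 hj]; rfl
  | succ n ih =>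
    change f (x j) ≤ f (fVee f (fVeeUpTo f x n) (x (n + 1)))
    rw [map_fVee (f := f)]
    rcases Nat.le_succ_iff.1 hj with h | h
    · exact (ih h).trans (le_max_left _ _)
    · rw [h]; exact le_max_right _ _

theorem fVeeUpTo_congr {x y : ℕ → EuclideanSpace ℝ (Fin d)} {n : ℕ} (h : ∀ j ≤ n, x j = y j) :
    fVeeUpTo f x n = fVeeUpTo f y n := by
  induction n with
  | zero => exact h 0 le_rfl
  | succ n ih =>
    change fVee f _ _ = fVee f _ _
    rw [ih fun j hj => h j (hj.trans n.le_succ), h (n + 1) le_rfl]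

theorem IsLossFunction.fVee_smul (hf : IsLossFunction f) {c : ℝ} (hc : 0 ≤ c)
    (x y : EuclideanSpace ℝ (Fin d)) : fVee f (c • x) (c • y) = c • fVee f x y := by
  unfold fVee
  rw [hf.homogeneous c hc, hf.homogeneous c hc]
  rcases hc.eq_or_lt with rfl | hc
  · simp
  · simp only [mul_lt_mul_iff_right₀ hc]
    split_ifs <;> rfl

theorem IsLossFunction.fVeeUpTo_smul (hf : IsLossFunction f) {c : ℝ} (hc : 0 ≤ c)
    (x : ℕ → EuclideanSpace ℝ (Fin d)) (n : ℕ) :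
    fVeeUpTo f (fun j => c • x j) n = c • fVeeUpTo f x n := by
  induction n with
  | zero => rfl
  | succ n ih =>
    change fVee f _ _ = c • fVee f _ _
    rw [ih, hf.fVee_smul hc]

theorem measurable_fVee (hf : IsLossFunction f) :
    Measurable fun p : EuclideanSpace ℝ (Fin d) × EuclideanSpace ℝ (Fin d) => fVee f p.1 p.2 := by
  unfold fVee
  exact Measurable.ite (measurableSet_lt (hf.measurable.comp measurable_fst)
    (hf.measurable.comp measurable_snd)) measurable_snd measurable_fst

theorem measurable_fVeeUpTo {Ω : Type*} [MeasurableSpace Ω] (hf : IsLossFunction f)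
    {x : ℕ → Ω → EuclideanSpace ℝ (Fin d)} {n : ℕ} (hx : ∀ j ≤ n, Measurable (x j)) :
    Measurable fun ω => fVeeUpTo f (fun j => x j ω) n := by
  induction n with
  | zero => exact hx 0 le_rfl
  | succ n ih =>
    exact (measurable_fVee hf).comp
      ((ih fun j hj => hx j (hj.trans n.le_succ)).prodMk (hx (n + 1) le_rfl))

/-- `∨_f` is continuous away from ties, and at the origin. -/
theorem tendsto_fVee (hf : IsLossFunction f) {x y : ℕ → EuclideanSpace ℝ (Fin d)}
    {a b : EuclideanSpace ℝ (Fin d)} (hx : Tendsto x atTop (𝓝 a)) (hy : Tendsto y atTop (𝓝 b))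
    (hab : f a = f b → a = b) :
    Tendsto (fun n => fVee f (x n) (y n)) atTop (𝓝 (fVee f a b)) := by
  have hfx := (hf.continuous.tendsto a).comp hx
  have hfy := (hf.continuous.tendsto b).comp hy
  rcases lt_trichotomy (f a) (f b) with h | h | h
  · rw [fVee_of_lt h]
    refine hy.congr' ?_
    filter_upwards [hfx.eventually_lt hfy h] with n hn
    exact (fVee_of_lt hn).symm
  · rw [fVee_of_le h.ge]
    have hab' := hab h
    subst hab'
    rw [tendsto_iff_norm_sub_tendsto_zero] at hx hy ⊢
    have hmax : Tendsto (fun n => max ‖x n - a‖ ‖y n - a‖) atTop (𝓝 0) := by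
      simpa using hx.max hy
    refine squeeze_zero (fun n => norm_nonneg _) (fun n => ?_) hmax
    rcases fVee_eq_or (f := f) (x n) (y n) with h' | h' <;> rw [h']
    · exact le_max_left _ _
    · exact le_max_right _ _
  · rw [fVee_of_le h.le]
    refine hx.congr' ?_
    filter_upwards [hfy.eventually_lt hfx h] with n hn
    exact (fVee_of_le (le_of_lt hn)).symm

theorem fLe.map_le {x y : EuclideanSpace ℝ (Fin d)} (h : fLe f x y) : f x ≤ f y := by
  rcases h with h | h
  · exact h.le
  · rw [h]

theorem fLe.antisymm {x y : EuclideanSpace ℝ (Fin d)} (h : fLe f x y) (h' : fLe f y x) :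
    x = y := by
  rcases h with h | h
  · exact absurd h'.map_le (not_le.2 h)
  · exact h

/-- `x` is an element of the family `v` at which `f` is maximal. -/
def IsFMax {ι : Type*} (f : EuclideanSpace ℝ (Fin d) → ℝ) (v : ι → EuclideanSpace ℝ (Fin d))
    (x : EuclideanSpace ℝ (Fin d)) : Prop :=
  (∃ i, x = v i) ∧ ∀ i, f (v i) ≤ f x

/-- Two maximisers with different indices tie, hence both are the zero vector. Identities between
differently bracketed maxima reduce to checking that both sides maximise the same family. -/
theorem IsFMax.eq {ι : Type*} (hf : IsLossFunction f) {v : ι → EuclideanSpace ℝ (Fin d)}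
    {x y : EuclideanSpace ℝ (Fin d)} (hx : IsFMax f v x) (hy : IsFMax f v y)
    (hv : ∀ i j, i ≠ j → f (v i) = f (v j) → f (v i) = 0) : x = y := by
  obtain ⟨⟨i, rfl⟩, hi⟩ := hx
  obtain ⟨⟨j, rfl⟩, hj⟩ := hy
  by_cases hij : i = j
  · rw [hij]
  · have h := le_antisymm (hj i) (hi j)
    have h0 := hv i j hij h
    rw [(hf.eq_zero_iff (v i)).1 h0, (hf.eq_zero_iff (v j)).1 (h.symm.trans h0)]

theorem isFMax_fVeeUpTo (x : ℕ → EuclideanSpace ℝ (Fin d)) (n : ℕ) :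
    IsFMax f (fun j : Fin (n + 1) => x j) (fVeeUpTo f x n) := by
  obtain ⟨j, hj, h⟩ := fVeeUpTo_mem (f := f) x n
  exact ⟨⟨⟨j, Nat.lt_succ_of_le hj⟩, h⟩, fun i => le_map_fVeeUpTo x (Nat.le_of_lt_succ i.2)⟩

end Deterministic

/-! ### Fréchet distributed real random variables -/

/-- The distribution function of `X` on `(0, ∞)` is `x ↦ exp (-a x ^ (-α))`. -/
def HasFrechetTail {Ω : Type*} [MeasurableSpace Ω] (P : Measure Ω) (α a : ℝ) (X : Ω → ℝ) : Prop :=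
  ∀ x : ℝ, 0 < x → P {ω | X ω ≤ x} = ENNReal.ofReal (Real.exp (-(a * x ^ (-α))))

theorem tendsto_exp_neg_rpow_nhdsGT {α a : ℝ} (hα : 0 < α) (ha : 0 < a) :
    Tendsto (fun x : ℝ => Real.exp (-(a * x ^ (-α)))) (𝓝[>] 0) (𝓝 0) :=
  Real.tendsto_exp_neg_atTop_nhds_zero.comp
    ((tendsto_rpow_neg_nhdsGT_zero (neg_lt_zero.2 hα)).const_mul_atTop ha)

theorem HasFrechetTail.ae_pos {Ω : Type*} [MeasurableSpace Ω] {P : Measure Ω} {α a : ℝ}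
    {X : Ω → ℝ} (h : HasFrechetTail P α a X) (hα : 0 < α) (ha : 0 < a) : ∀ᵐ ω ∂P, 0 < X ω := by
  rw [ae_iff]
  have hlim : Tendsto (fun x : ℝ => ENNReal.ofReal (Real.exp (-(a * x ^ (-α))))) (𝓝[>] 0)
      (𝓝 0) := by
    simpa using ENNReal.tendsto_ofReal (tendsto_exp_neg_rpow_nhdsGT hα ha)
  refine le_antisymm (ge_of_tendsto hlim ?_) bot_le
  filter_upwards [self_mem_nhdsWithin] with x hx
  rw [← h x hx]
  exact measure_mono fun ω hω => (not_lt.1 hω).trans (le_of_lt hx)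

/-- The degenerate scale `a = 0` is kept in the definition because null sets and zero coefficients
produce it; all the mass then lies in `(-∞, 0]`. -/
theorem HasFrechetTail.ae_nonpos {Ω : Type*} [MeasurableSpace Ω] {P : Measure Ω}
    [IsProbabilityMeasure P] {α : ℝ} {X : Ω → ℝ} (h : HasFrechetTail P α 0 X) (hX : Measurable X) :
    ∀ᵐ ω ∂P, X ω ≤ 0 := by
  have key : ∀ n : ℕ, ∀ᵐ ω ∂P, X ω ≤ 1 / ((n : ℝ) + 1) := fun n => by
    have h1 := h (1 / ((n : ℝ) + 1)) (by positivity)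
    rw [zero_mul, neg_zero, Real.exp_zero, ENNReal.ofReal_one] at h1
    exact (prob_compl_eq_zero_iff (measurableSet_le hX measurable_const)).2 h1
  filter_upwards [ae_all_iff.2 key] with ω hω
  exact ge_of_tendsto' tendsto_one_div_add_atTop_nhds_zero_nat hω

/-- The distribution function of a Fréchet variable, applied to that variable, is uniform. -/
theorem HasFrechetTail.map_cdf {μ : Measure ℝ} [IsProbabilityMeasure μ] {α a : ℝ} (hα : 0 < α)
    (ha : 0 < a) (h : HasFrechetTail μ α a id) :
    μ.map (fun x => Real.exp (-(a * x ^ (-α)))) = volume.restrict (Set.Ioc 0 1) := by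
  have hmeas : Measurable fun x : ℝ => Real.exp (-(a * x ^ (-α))) := by fun_prop
  have hpos : ∀ᵐ x ∂μ, (0 : ℝ) < x := h.ae_pos hα ha
  have : IsProbabilityMeasure (μ.map fun x : ℝ => Real.exp (-(a * x ^ (-α)))) :=
    Measure.isProbabilityMeasure_map hmeas.aemeasurable
  refine Measure.ext_of_Iic _ _ fun u => ?_
  rw [Measure.map_apply hmeas measurableSet_Iic, Measure.restrict_apply measurableSet_Iic]
  rcases le_or_gt u 0 with hu | hu
  · have h1 : (fun x : ℝ => Real.exp (-(a * x ^ (-α)))) ⁻¹' Set.Iic u = ∅ := by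
      ext x
      simp only [Set.mem_preimage, Set.mem_Iic, Set.mem_empty_iff_false, iff_false, not_le]
      exact hu.trans_lt (Real.exp_pos _)
    have h2 : Set.Iic u ∩ Set.Ioc 0 1 = ∅ := by
      ext x
      simp only [Set.mem_inter_iff, Set.mem_Iic, Set.mem_Ioc, Set.mem_empty_iff_false, iff_false]
      rintro ⟨h1, h2, -⟩
      linarith
    rw [h1, h2, measure_empty, measure_empty]
  rcases le_or_gt 1 u with hu1 | hu1
  · have h1 : μ ((fun x : ℝ => Real.exp (-(a * x ^ (-α)))) ⁻¹' Set.Iic u) = 1 := by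
      refine (prob_compl_eq_zero_iff (hmeas measurableSet_Iic)).1 ?_
      change ∀ᵐ x ∂μ, x ∈ (fun x : ℝ => Real.exp (-(a * x ^ (-α)))) ⁻¹' Set.Iic u
      filter_upwards [hpos] with x hx
      refine le_trans ?_ hu1
      rw [← Real.exp_zero]
      have := Real.rpow_nonneg hx.le (-α)
      exact Real.exp_le_exp.2 (by nlinarith)
    have h2 : Set.Iic u ∩ Set.Ioc 0 1 = Set.Ioc 0 1 :=
      Set.inter_eq_right.2 fun x hx => hx.2.trans hu1
    rw [h1, h2]
    simp
  · have hlog : 0 < -Real.log u / a := div_pos (neg_pos.2 (Real.log_neg hu hu1)) ha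
    -- `y` solves `exp (-(a * y ^ (-α))) = u`.
    set y : ℝ := (-Real.log u / a) ^ (-α⁻¹) with hy
    have hy0 : 0 < y := Real.rpow_pos_of_pos hlog _
    have hyα : y ^ (-α) = -Real.log u / a := by
      rw [hy, ← Real.rpow_mul hlog.le, neg_mul_neg, inv_mul_cancel₀ hα.ne', Real.rpow_one]
    have h1 : (fun x : ℝ => Real.exp (-(a * x ^ (-α)))) ⁻¹' Set.Iic u =ᵐ[μ] Set.Iic y := by
      filter_upwards [hpos] with x hx
      refine propext ?_
      change Real.exp (-(a * x ^ (-α))) ≤ u ↔ x ≤ y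
      rw [← Real.rpow_le_rpow_iff_of_neg hy0 hx (neg_lt_zero.2 hα), hyα,
        ← Real.le_log_iff_exp_le hu, div_le_iff₀ ha]
      constructor <;> intro h <;> linarith
    have h2 : Set.Iic u ∩ Set.Ioc 0 1 = Set.Ioc 0 u := by
      ext x
      simp only [Set.mem_inter_iff, Set.mem_Iic, Set.mem_Ioc]
      constructor
      · rintro ⟨h1, h2, -⟩
        exact ⟨h2, h1⟩
      · rintro ⟨h1, h2⟩
        exact ⟨h2, h1, h2.trans hu1.le⟩
    rw [measure_congr h1, h2, Real.volume_Ioc, sub_zero]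
    have := h y hy0
    change μ (Set.Iic y) = _ at this
    rw [this, hyα, mul_div_cancel₀ _ ha.ne', neg_neg, Real.exp_log hu]

/-- The probability that a Fréchet variable, scaled by `c`, dominates an independent one. -/
theorem HasFrechetTail.measure_dominates {Ω β : Type*} [MeasurableSpace Ω] [MeasurableSpace β]
    {P : Measure Ω} [IsProbabilityMeasure P] {α : ℝ} (hα : 0 < α) {X : Ω → ℝ} {Z : Ω → β}
    (hX : Measurable X) (hZ : Measurable Z) (hXZ : IndepFun X Z P) {a b c : ℝ} (ha : 0 < a)
    (hb : 0 ≤ b) (hc : 0 < c) (hXa : HasFrechetTail P α a X) {D : Set (ℝ × β)}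
    (hD : MeasurableSet D)
    (hZb : ∀ x : ℝ, 0 < x →
      P {ω | (x, Z ω) ∈ D} = ENNReal.ofReal (Real.exp (-(b * x ^ (-α))))) :
    P {ω | (c * X ω, Z ω) ∈ D} = ENNReal.ofReal (c ^ α * a / (c ^ α * a + b)) := by
  have : IsProbabilityMeasure (P.map X) := Measure.isProbabilityMeasure_map hX.aemeasurable
  have : IsProbabilityMeasure (P.map Z) := Measure.isProbabilityMeasure_map hZ.aemeasurable
  have hμ : HasFrechetTail (P.map X) α a id := fun x hx => by
    rw [Measure.map_apply hX (measurableSet_le measurable_id measurable_const)]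
    exact hXa x hx
  have hmul : Measurable fun p : ℝ × β => (c * p.1, p.2) := by fun_prop
  have hcα : 0 < c ^ α := Real.rpow_pos_of_pos hc _
  have hD' : MeasurableSet ((fun p : ℝ × β => (c * p.1, p.2)) ⁻¹' D) := hmul hD
  have hF : Measurable fun x : ℝ => Real.exp (-(a * x ^ (-α))) := by fun_prop
  -- This exponent turns `exp (-b (c x)^(-α))` into the `r`-th power of the distribution function of
  -- `X` at `x`. That function of `X` is uniform on `(0, 1]`, so the probability is `∫ u^r = 1 / (1
  -- + r)`.
  set r : ℝ := b / (c ^ α * a) with hr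
  have hr0 : 0 ≤ r := by positivity
  calc P {ω | (c * X ω, Z ω) ∈ D}
      = (P.map fun ω => (X ω, Z ω)) ((fun p : ℝ × β => (c * p.1, p.2)) ⁻¹' D) := by
        rw [Measure.map_apply (hX.prodMk hZ) hD']
        rfl
    _ = ∫⁻ x, (P.map Z) (Prod.mk x ⁻¹' ((fun p : ℝ × β => (c * p.1, p.2)) ⁻¹' D)) ∂(P.map X) := by
        rw [hXZ.map_prod_eq_prod_map_map hX.aemeasurable hZ.aemeasurable, Measure.prod_apply hD']
    _ = ∫⁻ x, ENNReal.ofReal (Real.exp (-(a * x ^ (-α))) ^ r) ∂(P.map X) := by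
        refine lintegral_congr_ae ?_
        filter_upwards [hμ.ae_pos hα ha] with x hx
        rw [Measure.map_apply hZ (measurable_prodMk_left hD')]
        refine (hZb (c * x) (mul_pos hc hx)).trans ?_
        replace hx : 0 < x := hx
        rw [← Real.exp_mul, Real.mul_rpow hc.le hx.le, Real.rpow_neg hc.le, hr]
        congr 2
        field_simp
    _ = ∫⁻ u, ENNReal.ofReal (u ^ r) ∂((P.map X).map fun x => Real.exp (-(a * x ^ (-α)))) := by
        rw [lintegral_map (by fun_prop) hF]
    _ = ENNReal.ofReal (∫ u in Set.Ioc (0 : ℝ) 1, u ^ r) := by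
        rw [hμ.map_cdf hα ha, ofReal_integral_eq_lintegral_ofReal]
        · have := intervalIntegral.intervalIntegrable_rpow' (a := 0) (b := 1) (r := r) (by linarith)
          rwa [intervalIntegrable_iff_integrableOn_Ioc_of_le zero_le_one] at this
        · filter_upwards [ae_restrict_mem measurableSet_Ioc] with u hu
          exact Real.rpow_nonneg hu.1.le _
    _ = ENNReal.ofReal (c ^ α * a / (c ^ α * a + b)) := by
        rw [← intervalIntegral.integral_of_le zero_le_one, integral_rpow (Or.inl (by linarith)),
          Real.one_rpow, Real.zero_rpow (by linarith), hr]
        congr 1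
        field_simp
        ring

theorem HasFrechetTail.measure_le {Ω : Type*} [MeasurableSpace Ω] {P : Measure Ω}
    [IsProbabilityMeasure P] {α : ℝ} (hα : 0 < α) {X Y : Ω → ℝ} (hX : Measurable X)
    (hY : Measurable Y) (hXY : IndepFun X Y P) {a b : ℝ} (ha : 0 < a) (hb : 0 ≤ b)
    (hXa : HasFrechetTail P α a X) (hYb : HasFrechetTail P α b Y) :
    P {ω | Y ω ≤ X ω} = ENNReal.ofReal (a / (a + b)) := by
  have := HasFrechetTail.measure_dominates hα hX hY hXY ha hb one_pos hXa
    (D := {p : ℝ × ℝ | p.2 ≤ p.1}) (measurableSet_le measurable_snd measurable_fst) hYb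
  simpa using this

/-- Independent nonnegative Fréchet variables almost surely coincide only at zero. -/
theorem HasFrechetTail.ae_eq_imp_eq_zero {Ω : Type*} [MeasurableSpace Ω] {P : Measure Ω}
    [IsProbabilityMeasure P] {α : ℝ} (hα : 0 < α) {X Y : Ω → ℝ} (hX : Measurable X)
    (hY : Measurable Y) (hXY : IndepFun X Y P) {a b : ℝ} (ha : 0 ≤ a) (hb : 0 ≤ b)
    (hXa : HasFrechetTail P α a X) (hYb : HasFrechetTail P α b Y) (hX0 : ∀ ω, 0 ≤ X ω)
    (hY0 : ∀ ω, 0 ≤ Y ω) : ∀ᵐ ω ∂P, X ω = Y ω → X ω = 0 := by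
  rcases ha.eq_or_lt with rfl | ha
  · filter_upwards [hXa.ae_nonpos hX] with ω hω _
    exact le_antisymm hω (hX0 ω)
  rcases hb.eq_or_lt with rfl | hb
  · filter_upwards [hYb.ae_nonpos hY] with ω hω h
    rw [h]
    exact le_antisymm hω (hY0 ω)
  have h1 := HasFrechetTail.measure_le hα hX hY hXY ha hb.le hXa hYb
  have h2 := HasFrechetTail.measure_le hα hY hX hXY.symm hb ha.le hYb hXa
  -- The two events cover the space and their probabilities `a / (a + b)` and `b / (a + b)` already
  -- add up to `1`, so their intersection, the tie, is null.
  have hu : {ω | Y ω ≤ X ω} ∪ {ω | X ω ≤ Y ω} = Set.univ := by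
    ext ω
    simpa using le_total (Y ω) (X ω)
  have h3 := measure_union_add_inter (μ := P) {ω | Y ω ≤ X ω} (measurableSet_le hX hY)
  rw [hu, measure_univ, h1, h2, ← ENNReal.ofReal_add (by positivity) (by positivity)] at h3
  have h4 : a / (a + b) + b / (b + a) = 1 := by field_simp; ring
  rw [h4, ENNReal.ofReal_one] at h3
  have h5 : P ({ω | Y ω ≤ X ω} ∩ {ω | X ω ≤ Y ω}) = 0 := by
    have := ENNReal.add_right_inj ENNReal.one_ne_top (b := P ({ω | Y ω ≤ X ω} ∩ {ω | X ω ≤ Y ω}))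
      (c := 0)
    exact this.1 (by rw [h3, add_zero])
  have h6 : ∀ᵐ ω ∂P, ω ∉ {ω | Y ω ≤ X ω} ∩ {ω | X ω ≤ Y ω} := measure_eq_zero_iff_ae_notMem.1 h5
  filter_upwards [h6] with ω hω h
  exact absurd ⟨h.ge, h.le⟩ hω

/-! ### The `f`-implicit Fréchet laws -/

namespace IsStdFrechet

theorem measure_mul_le {α : ℝ} {ν : Measure ℝ} (hν : IsStdFrechet α ν) (hα : 0 < α) {σ x : ℝ}
    (hσ : 0 ≤ σ) (hx : 0 < x) :
    ν {z | σ * z ≤ x} = ENNReal.ofReal (Real.exp (-(σ ^ α * x ^ (-α)))) := by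
  have := hν.1
  rcases hσ.eq_or_lt with rfl | hσ
  · have : {z : ℝ | 0 * z ≤ x} = Set.univ := by
      ext z
      simpa using hx.le
    rw [this, measure_univ, Real.zero_rpow hα.ne']
    simp
  · have h : {z : ℝ | σ * z ≤ x} = Set.Iic (x / σ) := by
      ext z
      simp only [Set.mem_ofPred_eq, Set.mem_Iic]
      rw [le_div_iff₀ hσ, mul_comm]
    rw [h, hν.2, if_pos (div_pos hx hσ), Real.div_rpow hx.le hσ.le, Real.rpow_neg hσ.le,
      div_inv_eq_mul, mul_comm]

theorem ae_pos {α : ℝ} {ν : Measure ℝ} (hν : IsStdFrechet α ν) : ∀ᵐ z ∂ν, 0 < z := by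
  have h := hν.2 0
  rw [if_neg (lt_irrefl _), ENNReal.ofReal_zero] at h
  rw [ae_iff]
  convert h using 2
  ext z
  simp

theorem unique {α : ℝ} {ν ν' : Measure ℝ} (hν : IsStdFrechet α ν) (hν' : IsStdFrechet α ν') :
    ν = ν' := by
  have := hν.1
  exact Measure.ext_of_Iic _ _ fun x => by rw [hν.2, hν'.2]

end IsStdFrechet

/-- Probability measures on `[0, ∞)` are determined by their distribution function on `(0, ∞)`. -/
theorem measure_ext_of_Iic_pos {μ ν : Measure ℝ} [IsProbabilityMeasure μ] [IsProbabilityMeasure ν]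
    (hμ : ∀ᵐ x ∂μ, 0 ≤ x) (hν : ∀ᵐ x ∂ν, 0 ≤ x)
    (h : ∀ x : ℝ, 0 < x → μ (Set.Iic x) = ν (Set.Iic x)) : μ = ν := by
  have hcdf : ∀ x : ℝ, 0 < x → cdf μ x = cdf ν x := fun x hx => by
    rw [cdf_eq_real, cdf_eq_real, Measure.real, Measure.real, h x hx]
  refine Measure.ext_of_Iic _ _ fun x => ?_
  rcases lt_trichotomy x 0 with hx | rfl | hx
  · have key : ∀ ρ : Measure ℝ, (∀ᵐ x ∂ρ, (0 : ℝ) ≤ x) → ρ (Set.Iic x) = 0 := fun ρ hρ => by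
      refine measure_eq_zero_iff_ae_notMem.2 ?_
      filter_upwards [hρ] with y hy hy'
      exact absurd (hy.trans hy') (not_le.2 hx)
    rw [key μ hμ, key ν hν]
  -- A possible atom at `0` is recovered from right continuity.
  · have h1 : Tendsto (cdf μ) (𝓝[>] 0) (𝓝 (cdf μ 0)) :=
      ((cdf μ).right_continuous 0).mono_left (nhdsWithin_mono _ Set.Ioi_subset_Ici_self)
    have h2 : Tendsto (cdf ν) (𝓝[>] 0) (𝓝 (cdf ν 0)) :=
      ((cdf ν).right_continuous 0).mono_left (nhdsWithin_mono _ Set.Ioi_subset_Ici_self)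
    have h3 : Tendsto (cdf μ) (𝓝[>] 0) (𝓝 (cdf ν 0)) := by
      refine h2.congr' ?_
      filter_upwards [self_mem_nhdsWithin] with x hx
      exact (hcdf x hx).symm
    rw [← ofReal_cdf, ← ofReal_cdf, tendsto_nhds_unique h1 h3]
  · exact h x hx

section Laws

variable {Ω : Type*} [MeasurableSpace Ω] {P : Measure Ω} {d : ℕ}
  {f : EuclideanSpace ℝ (Fin d) → ℝ} {α : ℝ} {κ : Measure (levelOne f)}

theorem measurable_polar (f : EuclideanSpace ℝ (Fin d) → ℝ) (σ : ℝ) :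
    Measurable fun p : ℝ × levelOne f => (σ * p.1) • (p.2 : EuclideanSpace ℝ (Fin d)) :=
  (measurable_const.mul measurable_fst).smul (measurable_subtype_coe.comp measurable_snd)

theorem IsLossFunction.map_polar (hf : IsLossFunction f) {r : ℝ} (hr : 0 ≤ r) (θ : levelOne f) :
    f (r • (θ : EuclideanSpace ℝ (Fin d))) = r := by
  rw [hf.homogeneous r hr, show f θ = 1 from θ.2, mul_one]

theorem IsImplicitFrechet.hasLaw {σ : ℝ} {Y : Ω → EuclideanSpace ℝ (Fin d)}
    (hY : IsImplicitFrechet P f α κ σ Y) {ν : Measure ℝ} (hν : IsStdFrechet α ν) :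
    HasLaw Y ((ν.prod κ).map
      (fun p : ℝ × levelOne f => (σ * p.1) • (p.2 : EuclideanSpace ℝ (Fin d)))) P := by
  obtain ⟨ν', hν', h⟩ := hY
  rwa [hν.unique hν']

theorem ae_prod_fst_pos {ν : Measure ℝ} (hν : IsStdFrechet α ν) [IsProbabilityMeasure κ] :
    ∀ᵐ p ∂(ν.prod κ), 0 < p.1 :=
  Measure.quasiMeasurePreserving_fst.ae hν.ae_pos

theorem IsImplicitFrechet.hasFrechetTail [IsProbabilityMeasure κ] (hf : IsLossFunction f)
    (hα : 0 < α) {σ : ℝ} (hσ : 0 ≤ σ) {Y : Ω → EuclideanSpace ℝ (Fin d)}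
    (hY : IsImplicitFrechet P f α κ σ Y) : HasFrechetTail P α (σ ^ α) (fun ω => f (Y ω)) := by
  intro x hx
  obtain ⟨ν, hν, hlaw⟩ := hY
  have := hν.1
  have hm : MeasurableSet {y | f y ≤ x} := measurableSet_le hf.measurable measurable_const
  rw [hlaw.measure_eq hm, Measure.map_apply (measurable_polar f σ) hm]
  have h1 : (fun p : ℝ × levelOne f => (σ * p.1) • (p.2 : EuclideanSpace ℝ (Fin d))) ⁻¹'
      {y | f y ≤ x} =ᵐ[ν.prod κ] ({z | σ * z ≤ x} ×ˢ Set.univ : Set (ℝ × levelOne f)) := by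
    filter_upwards [ae_prod_fst_pos hν] with p hp
    refine propext ?_
    change f ((σ * p.1) • (p.2 : EuclideanSpace ℝ (Fin d))) ≤ x ↔ σ * p.1 ≤ x ∧ True
    rw [hf.map_polar (mul_nonneg hσ hp.le), and_true]
  rw [measure_congr h1, Measure.prod_prod, measure_univ, mul_one, hν.measure_mul_le hα hσ hx]

/-- The probability that `|Z| ‖Θ‖` is at least `R`. -/
noncomputable def polarTail (ν : Measure ℝ) (κ : Measure (levelOne f)) (R : ℝ) : ENNReal :=
  (ν.prod κ) {p | R ≤ |p.1| * ‖(p.2 : EuclideanSpace ℝ (Fin d))‖}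

theorem tendsto_polarTail (ν : Measure ℝ) (κ : Measure (levelOne f)) [IsProbabilityMeasure ν]
    [IsProbabilityMeasure κ] : Tendsto (polarTail ν κ) atTop (𝓝 0) := by
  have hm : Measurable fun p : ℝ × levelOne f => |p.1| * ‖(p.2 : EuclideanSpace ℝ (Fin d))‖ := by
    fun_prop
  have h := tendsto_measure_iInter_atTop (μ := ν.prod κ)
    (s := fun R : ℝ => {p : ℝ × levelOne f | R ≤ |p.1| * ‖(p.2 : EuclideanSpace ℝ (Fin d))‖})
    (fun R => (measurableSet_le measurable_const hm).nullMeasurableSet)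
    (fun R R' hR p hp => le_trans hR hp) ⟨0, measure_ne_top _ _⟩
  have h0 : (⋂ R : ℝ, {p : ℝ × levelOne f | R ≤ |p.1| * ‖(p.2 : EuclideanSpace ℝ (Fin d))‖})
      = ∅ := by
    ext p
    simp only [Set.mem_iInter, Set.mem_ofPred_eq, Set.mem_empty_iff_false, iff_false, not_forall,
      not_le]
    exact exists_gt _
  rwa [h0, measure_empty] at h

/-- The bound sees `Y` only through an upper bound `s` for its scale, which makes tightness uniform
over all integrands of bounded `α`-norm. -/
theorem IsImplicitFrechet.measure_le_norm {σ s ε : ℝ} (hσ : 0 ≤ σ) (hσs : σ ≤ s) (hs : 0 < s)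
    {Y : Ω → EuclideanSpace ℝ (Fin d)} (hY : IsImplicitFrechet P f α κ σ Y) {ν : Measure ℝ}
    (hν : IsStdFrechet α ν) : P {ω | ε ≤ ‖Y ω‖} ≤ polarTail ν κ (ε / s) := by
  have hm : MeasurableSet {y : EuclideanSpace ℝ (Fin d) | ε ≤ ‖y‖} :=
    measurableSet_le measurable_const measurable_norm
  rw [(hY.hasLaw hν).measure_eq hm, Measure.map_apply (measurable_polar f σ) hm]
  refine measure_mono fun p hp => ?_
  change ε ≤ ‖(σ * p.1) • (p.2 : EuclideanSpace ℝ (Fin d))‖ at hp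
  rw [norm_smul, Real.norm_eq_abs, abs_mul, abs_of_nonneg hσ, mul_assoc] at hp
  change ε / s ≤ _
  rw [div_le_iff₀ hs, mul_comm]
  exact hp.trans (mul_le_mul_of_nonneg_right hσs (by positivity))

theorem IsImplicitFrechet.ae_eq_zero [IsProbabilityMeasure P] [IsProbabilityMeasure κ]
    (hf : IsLossFunction f) (hα : 0 < α) {Y : Ω → EuclideanSpace ℝ (Fin d)} (hYm : Measurable Y)
    (hY : IsImplicitFrechet P f α κ 0 Y) : ∀ᵐ ω ∂P, Y ω = 0 := by
  have h := hY.hasFrechetTail hf hα le_rfl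
  rw [Real.zero_rpow hα.ne'] at h
  filter_upwards [h.ae_nonpos (hf.measurable.comp hYm)] with ω hω
  exact hf.eq_zero_of_nonpos hω

theorem IsImplicitFrechet.smul {σ : ℝ} {Y : Ω → EuclideanSpace ℝ (Fin d)}
    (hY : IsImplicitFrechet P f α κ σ Y) (c : ℝ) :
    IsImplicitFrechet P f α κ (c * σ) (fun ω => c • Y ω) := by
  obtain ⟨ν, hν, hlaw⟩ := hY
  refine ⟨ν, hν, ?_⟩
  have hm : Measurable fun y : EuclideanSpace ℝ (Fin d) => c • y := measurable_const_smul c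
  refine HasLaw.fun_comp (μ := (ν.prod κ).map
      (fun p : ℝ × levelOne f => (σ * p.1) • (p.2 : EuclideanSpace ℝ (Fin d))))
    ⟨hm.aemeasurable, ?_⟩ hlaw
  rw [Measure.map_map hm (measurable_polar f σ)]
  congr 1
  ext1 p
  change c • (σ * p.1) • (p.2 : EuclideanSpace ℝ (Fin d)) = _
  rw [smul_smul, mul_assoc]

/-- Max-stability of the radial part: distribution functions of independent variables multiply under
`max`, so the exponents `s ^ α` and `t ^ α` add. -/
theorem map_max_mul_frechet {ν : Measure ℝ} (hν : IsStdFrechet α ν) (hα : 0 < α) {s t : ℝ}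
    (hs : 0 ≤ s) (ht : 0 ≤ t) :
    (ν.prod ν).map (fun z => max (s * z.1) (t * z.2)) =
      ν.map (fun z => (s ^ α + t ^ α) ^ (1 / α) * z) := by
  have := hν.1
  have hsα := Real.rpow_nonneg hs α
  have htα := Real.rpow_nonneg ht α
  have hσ : 0 ≤ (s ^ α + t ^ α) ^ (1 / α) := by positivity
  have hm : Measurable fun z : ℝ × ℝ => max (s * z.1) (t * z.2) := by fun_prop
  have hm' : Measurable fun z : ℝ => (s ^ α + t ^ α) ^ (1 / α) * z := by fun_prop
  have := Measure.isProbabilityMeasure_map (μ := ν.prod ν) hm.aemeasurable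
  have := Measure.isProbabilityMeasure_map (μ := ν) hm'.aemeasurable
  refine measure_ext_of_Iic_pos ?_ ?_ fun x hx => ?_
  · refine (ae_map_iff hm.aemeasurable measurableSet_Ici).2 ?_
    filter_upwards [Measure.quasiMeasurePreserving_fst.ae hν.ae_pos] with z hz
    exact le_max_of_le_left (mul_nonneg hs hz.le)
  · refine (ae_map_iff hm'.aemeasurable measurableSet_Ici).2 ?_
    filter_upwards [hν.ae_pos] with z hz
    exact mul_nonneg hσ hz.le
  · rw [Measure.map_apply hm measurableSet_Iic, Measure.map_apply hm' measurableSet_Iic]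
    have h1 : (fun z : ℝ × ℝ => max (s * z.1) (t * z.2)) ⁻¹' Set.Iic x =
        {z | s * z ≤ x} ×ˢ {z | t * z ≤ x} := by
      ext z
      simp
    have h2 : (fun z : ℝ => (s ^ α + t ^ α) ^ (1 / α) * z) ⁻¹' Set.Iic x =
        {z | (s ^ α + t ^ α) ^ (1 / α) * z ≤ x} := rfl
    rw [h1, h2, Measure.prod_prod, hν.measure_mul_le hα hs hx, hν.measure_mul_le hα ht hx,
      hν.measure_mul_le hα hσ hx, ← ENNReal.ofReal_mul (Real.exp_pos _).le, ← Real.exp_add,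
      ← Real.rpow_mul (by positivity), one_div, inv_mul_cancel₀ hα.ne', Real.rpow_one]
    congr 2
    ring

/-- Two independent polar variables, realised with the radial parts first. -/
theorem prod_map_polar {ν : Measure ℝ} [IsProbabilityMeasure ν] [IsProbabilityMeasure κ]
    (s t : ℝ) :
    ((ν.prod κ).map fun p : ℝ × levelOne f => (s * p.1) • (p.2 : EuclideanSpace ℝ (Fin d))).prod
      ((ν.prod κ).map fun p : ℝ × levelOne f => (t * p.1) • (p.2 : EuclideanSpace ℝ (Fin d))) =
    ((ν.prod ν).prod (κ.prod κ)).map fun q : (ℝ × ℝ) × (levelOne f × levelOne f) =>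
      ((s * q.1.1) • (q.2.1 : EuclideanSpace ℝ (Fin d)),
        (t * q.1.2) • (q.2.2 : EuclideanSpace ℝ (Fin d))) := by
  have := Measure.isProbabilityMeasure_map (μ := ν.prod κ) (measurable_polar f s).aemeasurable
  have := Measure.isProbabilityMeasure_map (μ := ν.prod κ) (measurable_polar f t).aemeasurable
  have hm : Measurable fun q : (ℝ × ℝ) × (levelOne f × levelOne f) =>
      ((s * q.1.1) • (q.2.1 : EuclideanSpace ℝ (Fin d)),
        (t * q.1.2) • (q.2.2 : EuclideanSpace ℝ (Fin d))) := by
    fun_prop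
  refine Measure.prod_eq fun S T hS hT => ?_
  rw [Measure.map_apply hm (hS.prod hT), Measure.map_apply (measurable_polar f s) hS,
    Measure.map_apply (measurable_polar f t) hT, Measure.prod_apply (hm (hS.prod hT)),
    Measure.prod_apply (measurable_polar f s hS), Measure.prod_apply (measurable_polar f t hT),
    ← lintegral_prod_mul (measurable_measure_prodMk_left (measurable_polar f s hS)).aemeasurable
      (measurable_measure_prodMk_left (measurable_polar f t hT)).aemeasurable]
  refine lintegral_congr fun z => ?_
  rw [← Measure.prod_prod]
  rfl

/-- The `∨_f`-maximum of independent `f`-implicit Fréchet vectors. -/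
theorem IsImplicitFrechet.fVee [IsProbabilityMeasure P] [IsProbabilityMeasure κ]
    (hf : IsLossFunction f) (hα : 0 < α) {s t : ℝ} (hs : 0 ≤ s) (ht : 0 ≤ t)
    {X Y : Ω → EuclideanSpace ℝ (Fin d)} (hXm : Measurable X) (hYm : Measurable Y)
    (hX : IsImplicitFrechet P f α κ s X) (hY : IsImplicitFrechet P f α κ t Y)
    (hXY : IndepFun X Y P) :
    IsImplicitFrechet P f α κ ((s ^ α + t ^ α) ^ (1 / α)) (fun ω => fVee f (X ω) (Y ω)) := by
  obtain ⟨ν, hν, -⟩ := id hX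
  have := hν.1
  have hvm : Measurable fun ω => _root_.fVee f (X ω) (Y ω) :=
    (measurable_fVee hf).comp (hXm.prodMk hYm)
  refine ⟨ν, hν, hvm.aemeasurable, Measure.ext fun B hB => ?_⟩
  have hm : Measurable fun q : (ℝ × ℝ) × (levelOne f × levelOne f) =>
      ((s * q.1.1) • (q.2.1 : EuclideanSpace ℝ (Fin d)),
        (t * q.1.2) • (q.2.2 : EuclideanSpace ℝ (Fin d))) := by
    fun_prop
  have hm1 : Measurable fun p : ℝ × levelOne f => p.1 • (p.2 : EuclideanSpace ℝ (Fin d)) := by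
    fun_prop
  have hH : Measurable fun r : ℝ => κ {θ | r • (θ : EuclideanSpace ℝ (Fin d)) ∈ B} :=
    measurable_measure_prodMk_left (hm1 hB)
  have hmap : P.map (fun ω => _root_.fVee f (X ω) (Y ω)) =
      ((ν.prod ν).prod (κ.prod κ)).map
        ((fun p : EuclideanSpace ℝ (Fin d) × EuclideanSpace ℝ (Fin d) => _root_.fVee f p.1 p.2) ∘
        fun q : (ℝ × ℝ) × (levelOne f × levelOne f) =>
        ((s * q.1.1) • (q.2.1 : EuclideanSpace ℝ (Fin d)),
        (t * q.1.2) • (q.2.2 : EuclideanSpace ℝ (Fin d)))) := by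
    rw [← Measure.map_map (measurable_fVee hf) hm, ← prod_map_polar, ← (hX.hasLaw hν).map_eq,
      ← (hY.hasLaw hν).map_eq, ← hXY.map_prod_eq_prod_map_map hXm.aemeasurable hYm.aemeasurable,
      Measure.map_map (measurable_fVee hf) (hXm.prodMk hYm)]
    rfl
  have hms := ((measurable_fVee hf).comp hm) hB
  rw [hmap, Measure.map_apply ((measurable_fVee hf).comp hm) hB, Measure.prod_apply hms,
    Measure.map_apply (measurable_polar f _) hB, Measure.prod_apply (measurable_polar f _ hB)]
  -- For fixed radii, the winner is decided without looking at the angles. Its angle has law `κ` in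
  -- both cases and the other angle integrates out.
  calc _ = ∫⁻ z : ℝ × ℝ, κ {θ | max (s * z.1) (t * z.2) • (θ : EuclideanSpace ℝ (Fin d)) ∈ B}
        ∂(ν.prod ν) := by
        refine lintegral_congr_ae ?_
        filter_upwards [Measure.quasiMeasurePreserving_fst.ae hν.ae_pos,
          Measure.quasiMeasurePreserving_snd.ae hν.ae_pos] with z hz1 hz2
        have e1 := fun θ => hf.map_polar (mul_nonneg hs hz1.le) θ
        have e2 := fun θ => hf.map_polar (mul_nonneg ht hz2.le) θ
        rcases lt_or_ge (s * z.1) (t * z.2) with h | h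
        · have : Prod.mk z ⁻¹' (((fun p : EuclideanSpace ℝ (Fin d) × EuclideanSpace ℝ (Fin d) =>
              _root_.fVee f p.1 p.2) ∘ fun q : (ℝ × ℝ) × (levelOne f × levelOne f) =>
              ((s * q.1.1) • (q.2.1 : EuclideanSpace ℝ (Fin d)),
              (t * q.1.2) • (q.2.2 : EuclideanSpace ℝ (Fin d)))) ⁻¹' B) =
              Set.univ ×ˢ {θ : levelOne f |
                max (s * z.1) (t * z.2) • (θ : EuclideanSpace ℝ (Fin d)) ∈ B} := by
            ext θ
            simp only [Set.mem_preimage, Function.comp_apply, Set.mem_prod, Set.mem_univ, true_and,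
              Set.mem_ofPred_eq]
            rw [max_eq_right h.le, fVee_of_lt (by rwa [e1, e2])]
          rw [this, Measure.prod_prod, measure_univ, one_mul]
        · have : Prod.mk z ⁻¹' (((fun p : EuclideanSpace ℝ (Fin d) × EuclideanSpace ℝ (Fin d) =>
              _root_.fVee f p.1 p.2) ∘ fun q : (ℝ × ℝ) × (levelOne f × levelOne f) =>
              ((s * q.1.1) • (q.2.1 : EuclideanSpace ℝ (Fin d)),
              (t * q.1.2) • (q.2.2 : EuclideanSpace ℝ (Fin d)))) ⁻¹' B) =
              {θ : levelOne f |
                max (s * z.1) (t * z.2) • (θ : EuclideanSpace ℝ (Fin d)) ∈ B} ×ˢ Set.univ := by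
            ext θ
            simp only [Set.mem_preimage, Function.comp_apply, Set.mem_prod, Set.mem_univ, and_true,
              Set.mem_ofPred_eq]
            rw [max_eq_left h, fVee_of_le (by rwa [e1, e2])]
          rw [this, Measure.prod_prod, measure_univ, mul_one]
    _ = ∫⁻ r : ℝ, κ {θ | r • (θ : EuclideanSpace ℝ (Fin d)) ∈ B}
          ∂((ν.prod ν).map fun z => max (s * z.1) (t * z.2)) := by
        rw [lintegral_map hH (by fun_prop)]
    _ = _ := by
        rw [map_max_mul_frechet hν hα hs ht, lintegral_map hH (by fun_prop)]
        rfl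

/-- `f`-implicit Fréchet laws are stable under limits in probability with converging scales. -/
theorem IsImplicitFrechet.of_tendstoInMeasure [IsProbabilityMeasure P] [IsProbabilityMeasure κ]
    {σ : ℕ → ℝ} {τ : ℝ} (hσ : Tendsto σ atTop (𝓝 τ))
    {X : ℕ → Ω → EuclideanSpace ℝ (Fin d)} {Y : Ω → EuclideanSpace ℝ (Fin d)}
    (hXm : ∀ n, Measurable (X n)) (hYm : Measurable Y)
    (hX : ∀ n, IsImplicitFrechet P f α κ (σ n) (X n)) (hXY : TendstoInMeasure P X atTop Y) :
    IsImplicitFrechet P f α κ τ Y := by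
  obtain ⟨ν, hν, -⟩ := id (hX 0)
  have := hν.1
  refine ⟨ν, hν, hYm.aemeasurable, ?_⟩
  have h1 := hXY.tendstoInDistribution fun n => (hXm n).aemeasurable
  -- The polar models of the laws of `X n` live on one space and converge there pointwise;
  -- uniqueness of weak limits identifies the law of `Y`.
  have h2 : TendstoInDistribution
      (fun n (p : ℝ × levelOne f) => (σ n * p.1) • (p.2 : EuclideanSpace ℝ (Fin d))) atTop
      (fun p : ℝ × levelOne f => (τ * p.1) • (p.2 : EuclideanSpace ℝ (Fin d)))
      (fun _ => ν.prod κ) (ν.prod κ) :=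
    tendstoInDistribution_of_ae_tendsto (fun n => (measurable_polar f _).aemeasurable)
      (measurable_polar f _).aemeasurable
      (ae_of_all _ fun p => (hσ.mul_const p.1).smul_const _)
  have h3 := tendsto_nhds_unique h1.tendsto
    (h2.tendsto.congr fun n => Subtype.ext ((hX n).hasLaw hν).map_eq.symm)
  exact congrArg (fun μ : ProbabilityMeasure (EuclideanSpace ℝ (Fin d)) => 
    (μ : Measure (EuclideanSpace ℝ (Fin d)))) h3

end Laws

/-- Independence is tested on products of bounded continuous functions, and these expectations pass
to the limit by dominated convergence along a common almost surely convergent subsequence. -/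
theorem indepFun_of_tendstoInMeasure {Ω : Type*} [MeasurableSpace Ω] {P : Measure Ω}
    [IsProbabilityMeasure P] {V : Type*} [NormedAddCommGroup V] [MeasurableSpace V] [BorelSpace V]
    [SecondCountableTopology V]
    {X Y : ℕ → Ω → V} {X' Y' : Ω → V} (hXm : ∀ n, Measurable (X n)) (hYm : ∀ n, Measurable (Y n))
    (hXm' : Measurable X') (hYm' : Measurable Y') (hXY : ∀ n, IndepFun (X n) (Y n) P)
    (hX : TendstoInMeasure P X atTop X') (hY : TendstoInMeasure P Y atTop Y') :
    IndepFun X' Y' P := by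
  obtain ⟨ns, hns, hX⟩ := hX.exists_seq_tendsto_ae
  obtain ⟨ms, hms, hY⟩ := (hY.comp hns.tendsto_atTop).exists_seq_tendsto_ae
  refine indepFun_of_bcf hXm'.aemeasurable hYm'.aemeasurable fun φ ψ => ?_
  have lim : ∀ {g : ℕ → Ω → ℝ} {g' : Ω → ℝ} (C : ℝ), (∀ n, Measurable (g n)) →
      (∀ n ω, ‖g n ω‖ ≤ C) → (∀ᵐ ω ∂P, Tendsto (fun n => g n ω) atTop (𝓝 (g' ω))) →
      Tendsto (fun n => ∫ ω, g n ω ∂P) atTop (𝓝 (∫ ω, g' ω ∂P)) := fun C hm hC hlim =>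
    tendsto_integral_of_dominated_convergence (fun _ => C)
      (fun n => (hm n).aestronglyMeasurable) (integrable_const C)
      (fun n => ae_of_all _ (hC n)) hlim
  have hX' : ∀ᵐ ω ∂P, Tendsto (fun n => φ (X (ns (ms n)) ω)) atTop (𝓝 (φ (X' ω))) := by
    filter_upwards [hX] with ω hω
    exact (φ.continuous.tendsto _).comp (hω.comp hms.tendsto_atTop)
  have hY' : ∀ᵐ ω ∂P, Tendsto (fun n => ψ (Y (ns (ms n)) ω)) atTop (𝓝 (ψ (Y' ω))) := by
    filter_upwards [hY] with ω hω
    exact (ψ.continuous.tendsto _).comp hω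
  have hφm : ∀ n, Measurable fun ω => φ (X (ns (ms n)) ω) := fun n =>
    φ.continuous.measurable.comp (hXm _)
  have hψm : ∀ n, Measurable fun ω => ψ (Y (ns (ms n)) ω) := fun n =>
    ψ.continuous.measurable.comp (hYm _)
  have t1 := lim ‖φ‖ hφm (fun n ω => φ.norm_coe_le_norm _) hX'
  have t2 := lim ‖ψ‖ hψm (fun n ω => ψ.norm_coe_le_norm _) hY'
  have t3 := lim (‖φ‖ * ‖ψ‖) (fun n => (hφm n).mul (hψm n)) (fun n ω => by
    rw [Pi.mul_apply, norm_mul]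
    exact mul_le_mul (φ.norm_coe_le_norm _) (ψ.norm_coe_le_norm _) (norm_nonneg _)
      (norm_nonneg _)) (g' := fun ω => φ (X' ω) * ψ (Y' ω)) (by
    filter_upwards [hX', hY'] with ω h1 h2
    exact h1.mul h2)
  refine tendsto_nhds_unique t3 ((t1.mul t2).congr fun n => ?_)
  have hind := (hXY (ns (ms n))).comp φ.continuous.measurable ψ.continuous.measurable
  exact (hind.integral_fun_mul_eq_mul_integral (hφm n).aestronglyMeasurable
    (hψm n).aestronglyMeasurable).symm

/-! ### Sup-measures on finite families of disjoint sets -/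

namespace IsFrechetSupMeasure

variable {Ω E : Type*} [MeasurableSpace Ω] [MeasurableSpace E] {P : Measure Ω} {m : Measure E}
  {d : ℕ} {f : EuclideanSpace ℝ (Fin d) → ℝ} {α : ℝ} {κ : Measure (levelOne f)}
  {M : Set E → Ω → EuclideanSpace ℝ (Fin d)}

theorem law_smul (hM : IsFrechetSupMeasure P m f α κ M) {A : Set E} (hA : MeasurableSet A)
    (hA' : m A < ⊤) (c : ℝ) :
    IsImplicitFrechet P f α κ (c * m.real A ^ (1 / α)) (fun ω => c • M A ω) :=
  (hM.law A hA hA').smul c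

theorem hasFrechetTail_smul [IsProbabilityMeasure κ] (hM : IsFrechetSupMeasure P m f α κ M)
    (hf : IsLossFunction f) (hα : 0 < α) {A : Set E} (hA : MeasurableSet A) (hA' : m A < ⊤)
    {c : ℝ} (hc : 0 ≤ c) :
    HasFrechetTail P α (c ^ α * m.real A) (fun ω => f (c • M A ω)) := by
  have h := (hM.law_smul hA hA' c).hasFrechetTail hf hα (by positivity)
  rwa [Real.mul_rpow hc (by positivity), ← Real.rpow_mul (by positivity), one_div,
    inv_mul_cancel₀ hα.ne', Real.rpow_one] at h

theorem ae_empty [IsProbabilityMeasure P] [IsProbabilityMeasure κ]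
    (hM : IsFrechetSupMeasure P m f α κ M) (hf : IsLossFunction f) (hα : 0 < α) :
    ∀ᵐ ω ∂P, M ∅ ω = 0 := by
  have h := hM.law ∅ MeasurableSet.empty (by simp)
  rw [measure_empty, ENNReal.toReal_zero, Real.zero_rpow (by positivity)] at h
  exact h.ae_eq_zero hf hα (hM.measurable ∅ MeasurableSet.empty (by simp))

theorem iIndepFun {ι : Type*} [Fintype ι] (hM : IsFrechetSupMeasure P m f α κ M)
    {A : ι → Set E} (hA : ∀ i, MeasurableSet (A i)) (hA' : ∀ i, m (A i) < ⊤)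
    (hd : Pairwise fun i j => Disjoint (A i) (A j)) :
    ProbabilityTheory.iIndepFun (fun i => M (A i)) P := by
  let e := Fintype.equivFin ι
  have h := hM.indep (Fintype.card ι) (fun j => A (e.symm j)) (fun j => hA _) (fun j => hA' _)
    fun i j hij => hd fun h => hij (e.symm.injective h)
  simpa using h.precomp e.injective

/-- The finite form of the sup-measure axiom, in which no order of the sets is visible: the limit in
the axiom dominates each term in `f` and is one of the terms. -/
theorem isFMax_iUnion {ι : Type*} [Fintype ι] [Nonempty ι] [IsProbabilityMeasure P]
    [IsProbabilityMeasure κ] (hM : IsFrechetSupMeasure P m f α κ M) (hf : IsLossFunction f)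
    (hα : 0 < α) {A : ι → Set E} (hA : ∀ i, MeasurableSet (A i)) (hA' : ∀ i, m (A i) < ⊤)
    (hd : Pairwise fun i j => Disjoint (A i) (A j)) :
    ∀ᵐ ω ∂P, IsFMax f (fun i => M (A i) ω) (M (⋃ i, A i) ω) := by
  classical
  let e := Fintype.equivFin ι
  -- The axiom is about sequences, so the family is padded with empty sets, on which `M` vanishes
  -- almost surely.
  let B : ℕ → Set E := fun j => if h : j < Fintype.card ι then A (e.symm ⟨j, h⟩) else ∅
  have hBA : ∀ i, B (e i) = A i := fun i => by
    have : ((e i : Fin _) : ℕ) < Fintype.card ι := (e i).2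
    simp [B]
  have hB : ∀ j, (∃ i, B j = A i) ∨ B j = ∅ := fun j => by
    by_cases h : j < Fintype.card ι
    · exact Or.inl ⟨e.symm ⟨j, h⟩, dif_pos h⟩
    · exact Or.inr (dif_neg h)
  have hU : ⋃ j, B j = ⋃ i, A i := by
    refine Set.Subset.antisymm (Set.iUnion_subset fun j => ?_)
      (Set.iUnion_subset fun i => hBA i ▸ Set.subset_iUnion B (e i))
    rcases hB j with ⟨i, h⟩ | h
    · rw [h]; exact Set.subset_iUnion A i
    · rw [h]; exact Set.empty_subset _
  have hBd : Pairwise fun i j => Disjoint (B i) (B j) := fun i j hij => by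
    by_cases hi : i < Fintype.card ι
    · by_cases hj : j < Fintype.card ι
      · simp only [B, dif_pos hi, dif_pos hj]
        exact hd fun h => hij (by simpa using e.symm.injective h)
      · simp [B, dif_neg hj]
    · simp [B, dif_neg hi]
  have hUfin : m (⋃ j, B j) < ⊤ := by
    rw [hU]
    refine (measure_iUnion_le A).trans_lt ?_
    rw [tsum_fintype]
    exact ENNReal.sum_lt_top.2 fun i _ => hA' i
  have hlim := hM.iUnion B (fun j => by
      rcases hB j with ⟨i, h⟩ | h <;> rw [h]
      · exact hA i
      · exact MeasurableSet.empty) (fun j => by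
      rcases hB j with ⟨i, h⟩ | h <;> rw [h]
      · exact hA' i
      · simp) hBd hUfin
  filter_upwards [hlim, hM.ae_empty hf hα] with ω ⟨h1, j₀, h2⟩ h0
  rw [hU] at h1 h2
  have hle : ∀ j, f (M (B j) ω) ≤ f (M (⋃ i, A i) ω) := fun j => by
    refine ge_of_tendsto ((hf.continuous.tendsto _).comp h1) ?_
    filter_upwards [eventually_ge_atTop j] with n hn
    exact le_map_fVeeUpTo (fun j => M (B j) ω) hn
  have hle' : ∀ i, f (M (A i) ω) ≤ f (M (⋃ i, A i) ω) := fun i => hBA i ▸ hle (e i)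
  refine ⟨?_, hle'⟩
  rcases hB j₀ with ⟨i, h⟩ | h
  · exact ⟨i, by rw [h2, h]⟩
  -- If the limit is attained at a padding index, it is `0`; then every `M (A i)` is `0` and any
  -- index will do.
  · have hz : M (⋃ i, A i) ω = 0 := by rw [h2, h, h0]
    obtain ⟨i⟩ := ‹Nonempty ι›
    refine ⟨i, ?_⟩
    have := hle' i
    rw [hz, hf.map_zero] at this
    rw [hz]
    exact (hf.eq_zero_of_nonpos this).symm

/-- Supplies the hypothesis of `IsFMax.eq`. The exception at value `0` cannot be removed: null sets
and zero coefficients do tie there. -/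
theorem ae_no_ties {ι : Type*} [Fintype ι] [IsProbabilityMeasure P]
    [IsProbabilityMeasure κ] (hM : IsFrechetSupMeasure P m f α κ M) (hf : IsLossFunction f)
    (hα : 0 < α) {A : ι → Set E} (hA : ∀ i, MeasurableSet (A i)) (hA' : ∀ i, m (A i) < ⊤)
    (hd : Pairwise fun i j => Disjoint (A i) (A j)) {c : ι → ℝ} (hc : ∀ i, 0 ≤ c i) :
    ∀ᵐ ω ∂P, ∀ i j, i ≠ j → f (c i • M (A i) ω) = f (c j • M (A j) ω) →
      f (c i • M (A i) ω) = 0 := by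
  rw [ae_all_iff]; intro i
  rw [ae_all_iff]; intro j
  by_cases hij : i = j
  · exact ae_of_all _ fun ω h => absurd hij h
  have hm : ∀ i, Measurable fun x => f (c i • x) := fun i =>
    hf.measurable.comp (measurable_const_smul (c i))
  have h := HasFrechetTail.ae_eq_imp_eq_zero hα ((hm i).comp (hM.measurable _ (hA i) (hA' i)))
    ((hm j).comp (hM.measurable _ (hA j) (hA' j)))
    (((hM.iIndepFun hA hA' hd).indepFun hij).comp (hm i) (hm j))
    (mul_nonneg (Real.rpow_nonneg (hc i) α) measureReal_nonneg)
    (mul_nonneg (Real.rpow_nonneg (hc j) α) measureReal_nonneg)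
    (hM.hasFrechetTail_smul hf hα (hA i) (hA' i) (hc i))
    (hM.hasFrechetTail_smul hf hα (hA j) (hA' j) (hc j)) (fun ω => hf.nonneg _)
    (fun ω => hf.nonneg _)
  filter_upwards [h] with ω hω _
  exact hω

end IsFrechetSupMeasure

/-! ### Integrals of simple functions -/

namespace SimpleRep

variable {Ω E : Type*} [MeasurableSpace Ω] [MeasurableSpace E] {P : Measure Ω} {m : Measure E}
  {d : ℕ} {f : EuclideanSpace ℝ (Fin d) → ℝ} {α : ℝ} {κ : Measure (levelOne f)}
  {M : Set E → Ω → EuclideanSpace ℝ (Fin d)}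

theorem toFun_of_mem (r : SimpleRep m) {j : ℕ} (hj : j ≤ r.k) {s : E} (hs : s ∈ r.sets j) :
    r.toFun s = r.coef j := by
  unfold toFun
  rw [Finset.sum_eq_single j]
  · rw [Set.indicator_of_mem hs, mul_one]
  · intro i hi hij
    rw [Set.indicator_of_notMem, mul_zero]
    exact fun h => Set.disjoint_left.1
      (r.sets_disjoint i (Nat.lt_succ_iff.1 (Finset.mem_range.1 hi)) j hj hij) h hs
  · intro h
    exact absurd (Finset.mem_range.2 (Nat.lt_succ_of_le hj)) h

theorem toFun_of_notMem (r : SimpleRep m) {s : E} (hs : ∀ j ≤ r.k, s ∉ r.sets j) :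
    r.toFun s = 0 :=
  Finset.sum_eq_zero fun j hj => by
    rw [Set.indicator_of_notMem (hs j (Nat.lt_succ_iff.1 (Finset.mem_range.1 hj))), mul_zero]

theorem toFun_nonneg (r : SimpleRep m) (s : E) : 0 ≤ r.toFun s := by
  by_cases h : ∃ j ≤ r.k, s ∈ r.sets j
  · obtain ⟨j, hj, hs⟩ := h
    rw [r.toFun_of_mem hj hs]
    exact r.coef_nonneg j hj
  · push Not at h
    rw [r.toFun_of_notMem h]

theorem measurable_integral (r : SimpleRep m) (hM : IsFrechetSupMeasure P m f α κ M)
    (hf : IsLossFunction f) : Measurable (r.integral f M) :=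
  measurable_fVeeUpTo (x := fun j ω => r.coef j • M (r.sets j) ω) hf fun j hj =>
    (hM.measurable _ (r.sets_measurable j hj) (r.sets_finite j hj)).const_smul (r.coef j)

/-- Simple functions with disjoint supports have independent integrals. -/
theorem indepFun_integral (r r' : SimpleRep m) (hM : IsFrechetSupMeasure P m f α κ M)
    (hf : IsLossFunction f)
    (hd : ∀ i ≤ r.k, ∀ j ≤ r'.k, Disjoint (r.sets i) (r'.sets j)) :
    IndepFun (r.integral f M) (r'.integral f M) P := by
  classical
  let A : Fin (r.k + 1) ⊕ Fin (r'.k + 1) → Set E :=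
    Sum.elim (fun i => r.sets i) (fun j => r'.sets j)
  have hA : ∀ i, MeasurableSet (A i) := by
    rintro (i | i)
    · exact r.sets_measurable _ (Nat.lt_succ_iff.1 i.2)
    · exact r'.sets_measurable _ (Nat.lt_succ_iff.1 i.2)
  have hA' : ∀ i, m (A i) < ⊤ := by
    rintro (i | i)
    · exact r.sets_finite _ (Nat.lt_succ_iff.1 i.2)
    · exact r'.sets_finite _ (Nat.lt_succ_iff.1 i.2)
  have hAd : Pairwise fun i j => Disjoint (A i) (A j) := by
    rintro (i | i) (j | j) hij
    · exact r.sets_disjoint _ (Nat.lt_succ_iff.1 i.2) _ (Nat.lt_succ_iff.1 j.2)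
        fun h => hij (congrArg Sum.inl (Fin.ext h))
    · exact hd _ (Nat.lt_succ_iff.1 i.2) _ (Nat.lt_succ_iff.1 j.2)
    · exact (hd _ (Nat.lt_succ_iff.1 j.2) _ (Nat.lt_succ_iff.1 i.2)).symm
    · exact r'.sets_disjoint _ (Nat.lt_succ_iff.1 i.2) _ (Nat.lt_succ_iff.1 j.2)
        fun h => hij (congrArg Sum.inr (Fin.ext h))
  let S : Finset (Fin (r.k + 1) ⊕ Fin (r'.k + 1)) := Finset.univ.image Sum.inl
  let T : Finset (Fin (r.k + 1) ⊕ Fin (r'.k + 1)) := Finset.univ.image Sum.inr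
  have hS : ∀ i, Sum.inl i ∈ S := fun i => Finset.mem_image_of_mem _ (Finset.mem_univ i)
  have hT : ∀ i, Sum.inr i ∈ T := fun i => Finset.mem_image_of_mem _ (Finset.mem_univ i)
  have hST : Disjoint S T := by
    rw [Finset.disjoint_left]
    intro p hp hq
    obtain ⟨i, -, rfl⟩ := Finset.mem_image.1 hp
    obtain ⟨j, -, h⟩ := Finset.mem_image.1 hq
    cases h
  have hind := (hM.iIndepFun hA hA' hAd).indepFun_finset S T hST
    fun i => hM.measurable _ (hA i) (hA' i)
  let φ : (S → EuclideanSpace ℝ (Fin d)) → EuclideanSpace ℝ (Fin d) := fun v =>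
    fVeeUpTo f (fun j => if h : j < r.k + 1 then r.coef j • v ⟨Sum.inl ⟨j, h⟩, hS _⟩ else 0) r.k
  let ψ : (T → EuclideanSpace ℝ (Fin d)) → EuclideanSpace ℝ (Fin d) := fun v =>
    fVeeUpTo f (fun j => if h : j < r'.k + 1 then r'.coef j • v ⟨Sum.inr ⟨j, h⟩, hT _⟩ else 0) r'.k
  have hφ : Measurable φ := by
    refine measurable_fVeeUpTo (x := fun j (v : S → EuclideanSpace ℝ (Fin d)) =>
      if h : j < r.k + 1 then r.coef j • v ⟨Sum.inl ⟨j, h⟩, hS _⟩ else 0) hf fun j hj => ?_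
    have h : j < r.k + 1 := Nat.lt_succ_of_le hj
    simp only [dif_pos h]
    exact (measurable_pi_apply _).const_smul (r.coef j)
  have hψ : Measurable ψ := by
    refine measurable_fVeeUpTo (x := fun j (v : T → EuclideanSpace ℝ (Fin d)) =>
      if h : j < r'.k + 1 then r'.coef j • v ⟨Sum.inr ⟨j, h⟩, hT _⟩ else 0) hf fun j hj => ?_
    have h : j < r'.k + 1 := Nat.lt_succ_of_le hj
    simp only [dif_pos h]
    exact (measurable_pi_apply _).const_smul (r'.coef j)
  convert hind.comp hφ hψ using 1
  · ext1 ω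
    exact fVeeUpTo_congr fun j hj => by simp [Nat.lt_succ_of_le hj, A]
  · ext1 ω
    exact fVeeUpTo_congr fun j hj => by simp [Nat.lt_succ_of_le hj, A]

/-- The last term is independent of the maximum of the earlier ones, so by `IsImplicitFrechet.fVee`
each induction step adds its contribution to the `α`-th power of the scale. -/
theorem isImplicitFrechet_integral_sum [IsProbabilityMeasure P] [IsProbabilityMeasure κ]
    (hM : IsFrechetSupMeasure P m f α κ M) (hf : IsLossFunction f) (hα : 0 < α) :
    ∀ (k : ℕ) (r : SimpleRep m), r.k = k → IsImplicitFrechet P f α κ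
      ((∑ j ∈ Finset.range (k + 1), r.coef j ^ α * m.real (r.sets j)) ^ (1 / α))
      (r.integral f M) := by
  have hpow : ∀ {c a : ℝ}, 0 ≤ c → 0 ≤ a → (c * a ^ (1 / α)) ^ α = c ^ α * a := by
    intro c a hc ha
    rw [Real.mul_rpow hc (by positivity), ← Real.rpow_mul ha, one_div, inv_mul_cancel₀ hα.ne',
      Real.rpow_one]
  intro k
  induction k with
  | zero =>
    intro r hr
    have h0 : (0 : ℕ) ≤ r.k := Nat.zero_le _
    have hc := r.coef_nonneg 0 h0
    have h := hM.law_smul (r.sets_measurable 0 h0) (r.sets_finite 0 h0) (r.coef 0)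
    rw [zero_add, Finset.sum_range_one, ← hpow hc measureReal_nonneg, ← Real.rpow_mul
      (by positivity), mul_one_div, div_self hα.ne', Real.rpow_one]
    convert h using 1
    ext1 ω
    unfold integral
    rw [hr]
    rfl
  | succ k ih =>
    intro r hr
    have hk : k ≤ r.k := hr ▸ k.le_succ
    have hk1 : k + 1 ≤ r.k := hr.ge
    let r₁ : SimpleRep m :=
      { k := k, coef := r.coef, sets := r.sets
        coef_nonneg := fun j hj => r.coef_nonneg j (hj.trans hk)
        sets_measurable := fun j hj => r.sets_measurable j (hj.trans hk)
        sets_finite := fun j hj => r.sets_finite j (hj.trans hk)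
        sets_disjoint := fun i hi j hj => r.sets_disjoint i (hi.trans hk) j (hj.trans hk) }
    let r₂ : SimpleRep m :=
      { k := 0, coef := fun _ => r.coef (k + 1), sets := fun _ => r.sets (k + 1)
        coef_nonneg := fun j hj => r.coef_nonneg _ hk1
        sets_measurable := fun j hj => r.sets_measurable _ hk1
        sets_finite := fun j hj => r.sets_finite _ hk1
        sets_disjoint := fun i hi j hj hij =>
          absurd ((Nat.le_zero.1 hi).trans (Nat.le_zero.1 hj).symm) hij }
    have hind : IndepFun (r₁.integral f M) (r₂.integral f M) P :=
      indepFun_integral r₁ r₂ hM hf fun i hi j hj =>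
        r.sets_disjoint i (le_trans hi hk) _ hk1 (Nat.lt_succ_of_le hi).ne
    have hc := r.coef_nonneg _ hk1
    have hsum : 0 ≤ ∑ j ∈ Finset.range (k + 1), r.coef j ^ α * m.real (r.sets j) :=
      Finset.sum_nonneg fun j hj => mul_nonneg (Real.rpow_nonneg (r.coef_nonneg j
        ((Nat.lt_succ_iff.1 (Finset.mem_range.1 hj)).trans hk)) _) measureReal_nonneg
    have h := IsImplicitFrechet.fVee hf hα (by positivity) (by positivity)
      (r₁.measurable_integral hM hf) (r₂.measurable_integral hM hf) (ih r₁ rfl)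
      (hM.law_smul (r.sets_measurable _ hk1) (r.sets_finite _ hk1) (r.coef (k + 1))) hind
    rw [hpow hc measureReal_nonneg, ← Real.rpow_mul hsum, one_div, inv_mul_cancel₀ hα.ne',
      Real.rpow_one] at h
    rw [Finset.sum_range_succ, one_div]
    convert h using 1
    ext1 ω
    unfold integral
    rw [hr]
    rfl

end SimpleRep

/-- The integral of a function that is constant on finitely many disjoint cells and vanishes
elsewhere. -/
theorem hasIntegral_of_cells {ι E : Type*} [Fintype ι] [MeasurableSpace E] {m : Measure E}
    {C : ι → Set E} (hC : ∀ i, MeasurableSet (C i)) (hC' : ∀ i, m (C i) < ⊤)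
    (hd : Pairwise fun i j => Disjoint (C i) (C j)) {h : E → ℝ} {c : ι → ℝ}
    (hc : ∀ i, ∀ s ∈ C i, h s = c i) (h0 : ∀ s, (∀ i, s ∉ C i) → h s = 0) :
    Integrable h m ∧ ∫ s, h s ∂m = ∑ i, c i * m.real (C i) := by
  classical
  have heq : h = fun s => ∑ i, (C i).indicator (fun _ => c i) s := by
    ext s
    by_cases hs : ∃ i, s ∈ C i
    · obtain ⟨i, hi⟩ := hs
      rw [Finset.sum_eq_single i, Set.indicator_of_mem hi, hc i s hi]
      · intro j _ hj
        exact Set.indicator_of_notMem (fun h => Set.disjoint_left.1 (hd hj) h hi) _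
      · intro hi
        exact absurd (Finset.mem_univ i) hi
    · push Not at hs
      rw [h0 s hs]
      exact (Finset.sum_eq_zero fun i _ => Set.indicator_of_notMem (hs i) _).symm
  have h_int : ∀ i, Integrable ((C i).indicator fun _ => c i) m := fun i =>
    (integrable_indicator_iff (hC i)).2 (integrableOn_const (hC' i).ne)
  rw [heq]
  refine ⟨integrable_finsetSum _ fun i _ => h_int i, ?_⟩
  rw [integral_finsetSum _ fun i _ => h_int i]
  refine Finset.sum_congr rfl fun i _ => ?_
  rw [integral_indicator (hC i), setIntegral_const, smul_eq_mul, mul_comm]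

/-! ### Comparing the integrals of two simple functions -/

namespace SimpleRep

variable {Ω E : Type*} [MeasurableSpace Ω] [MeasurableSpace E] {P : Measure Ω} {m : Measure E}
  {d : ℕ} {f : EuclideanSpace ℝ (Fin d) → ℝ} {α : ℝ} {κ : Measure (levelOne f)}
  {M : Set E → Ω → EuclideanSpace ℝ (Fin d)}

/-- The sets of a representation, together with the complement of their union. -/
def cell (r : SimpleRep m) : Option (Fin (r.k + 1)) → Set E
  | some j => r.sets j
  | none => (⋃ j : Fin (r.k + 1), r.sets j)ᶜ

/-- The value of the represented function on a cell. -/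
def value (r : SimpleRep m) : Option (Fin (r.k + 1)) → ℝ
  | some j => r.coef j
  | none => 0

theorem value_nonneg (r : SimpleRep m) (p : Option (Fin (r.k + 1))) : 0 ≤ r.value p := by
  cases p with
  | none => exact le_rfl
  | some j => exact r.coef_nonneg j (Nat.lt_succ_iff.1 j.2)

theorem measurableSet_cell (r : SimpleRep m) (p : Option (Fin (r.k + 1))) :
    MeasurableSet (r.cell p) := by
  have h : ∀ j : Fin (r.k + 1), MeasurableSet (r.sets j) := fun j =>
    r.sets_measurable j (Nat.lt_succ_iff.1 j.2)
  cases p with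
  | none => exact (MeasurableSet.iUnion h).compl
  | some j => exact h j

theorem pairwise_disjoint_cell (r : SimpleRep m) :
    Pairwise fun p q => Disjoint (r.cell p) (r.cell q) := by
  have h : ∀ j : Fin (r.k + 1), Disjoint (r.sets j) (⋃ j : Fin (r.k + 1), r.sets j)ᶜ := fun j =>
    Set.disjoint_compl_right_iff_subset.2 (Set.subset_iUnion (fun j : Fin (r.k + 1) => r.sets j) j)
  rintro (_ | i) (_ | j) hij
  · exact absurd rfl hij
  · exact (h j).symm
  · exact h i
  · exact r.sets_disjoint _ (Nat.lt_succ_iff.1 i.2) _ (Nat.lt_succ_iff.1 j.2)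
      fun h => hij (congrArg some (Fin.ext h))

theorem exists_mem_cell (r : SimpleRep m) (s : E) : ∃ p, s ∈ r.cell p := by
  by_cases h : s ∈ ⋃ j : Fin (r.k + 1), r.sets j
  · obtain ⟨j, hj⟩ := Set.mem_iUnion.1 h
    exact ⟨some j, hj⟩
  · exact ⟨none, h⟩

theorem toFun_of_mem_cell (r : SimpleRep m) {p : Option (Fin (r.k + 1))} {s : E}
    (hs : s ∈ r.cell p) : r.toFun s = r.value p := by
  cases p with
  | none =>
    refine r.toFun_of_notMem fun j hj hsj => hs ?_
    exact Set.mem_iUnion.2 ⟨⟨j, Nat.lt_succ_of_le hj⟩, hsj⟩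
  | some j => exact r.toFun_of_mem (Nat.lt_succ_iff.1 j.2) hs

/-- The common refinement of the partitions that belong to two representations; the cell on which
both represented functions vanish is replaced by the empty set. -/
def meet (r r' : SimpleRep m) : Option (Fin (r.k + 1)) × Option (Fin (r'.k + 1)) → Set E :=
  fun p => if p = (none, none) then ∅ else r.cell p.1 ∩ r'.cell p.2

theorem meet_subset_left (r r' : SimpleRep m) (p) : meet r r' p ⊆ r.cell p.1 := by
  unfold meet
  split_ifs
  · exact Set.empty_subset _
  · exact Set.inter_subset_left

theorem meet_subset_right (r r' : SimpleRep m) (p) : meet r r' p ⊆ r'.cell p.2 := by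
  unfold meet
  split_ifs
  · exact Set.empty_subset _
  · exact Set.inter_subset_right

theorem meet_swap (r r' : SimpleRep m) (p) : meet r' r p.swap = meet r r' p := by
  unfold meet
  rw [Set.inter_comm]
  by_cases h : p = (none, none)
  · rw [if_pos h, if_pos (by rw [h]; rfl)]
  · rw [if_neg h, if_neg fun h' => h (by rw [← p.swap_swap, h']; rfl)]
    rfl

theorem measurableSet_meet (r r' : SimpleRep m) (p) : MeasurableSet (meet r r' p) := by
  unfold meet
  split_ifs
  · exact MeasurableSet.empty
  · exact (r.measurableSet_cell _).inter (r'.measurableSet_cell _)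

theorem measure_meet_lt_top (r r' : SimpleRep m) (p) : m (meet r r' p) < ⊤ := by
  rcases p with ⟨_ | i, _ | j⟩
  · simp [meet]
  · exact (measure_mono (meet_subset_right r r' _)).trans_lt
      (r'.sets_finite j (Nat.lt_succ_iff.1 j.2))
  · exact (measure_mono (meet_subset_left r r' _)).trans_lt
      (r.sets_finite i (Nat.lt_succ_iff.1 i.2))
  · exact (measure_mono (meet_subset_left r r' _)).trans_lt
      (r.sets_finite i (Nat.lt_succ_iff.1 i.2))

theorem pairwise_disjoint_meet (r r' : SimpleRep m) :
    Pairwise fun p q => Disjoint (meet r r' p) (meet r r' q) := by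
  intro p q hpq
  by_cases h : p.1 = q.1
  · exact (r'.pairwise_disjoint_cell fun h' => hpq (Prod.ext h h')).mono
      (meet_subset_right r r' p) (meet_subset_right r r' q)
  · exact (r.pairwise_disjoint_cell h).mono (meet_subset_left r r' p) (meet_subset_left r r' q)

theorem toFun_of_mem_meet_left (r r' : SimpleRep m) {p} {s : E} (hs : s ∈ meet r r' p) :
    r.toFun s = r.value p.1 :=
  r.toFun_of_mem_cell (meet_subset_left r r' p hs)

theorem toFun_of_mem_meet_right (r r' : SimpleRep m) {p} {s : E} (hs : s ∈ meet r r' p) :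
    r'.toFun s = r'.value p.2 :=
  r'.toFun_of_mem_cell (meet_subset_right r r' p hs)

theorem toFun_of_notMem_meet (r r' : SimpleRep m) {s : E} (hs : ∀ p, s ∉ meet r r' p) :
    r.toFun s = 0 ∧ r'.toFun s = 0 := by
  obtain ⟨p, hp⟩ := r.exists_mem_cell s
  obtain ⟨q, hq⟩ := r'.exists_mem_cell s
  have h := hs (p, q)
  unfold meet at h
  split_ifs at h with hpq
  · obtain ⟨rfl, rfl⟩ := Prod.mk.inj hpq
    exact ⟨r.toFun_of_mem_cell hp, r'.toFun_of_mem_cell hq⟩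
  · exact absurd ⟨hp, hq⟩ h

/-- An integral over the common refinement of a function of the two values. -/
theorem integral_meet (r r' : SimpleRep m) {φ : ℝ → ℝ → ℝ} (hφ : φ 0 0 = 0) :
    Integrable (fun s => φ (r.toFun s) (r'.toFun s)) m ∧
      ∫ s, φ (r.toFun s) (r'.toFun s) ∂m =
        ∑ p, φ (r.value p.1) (r'.value p.2) * m.real (meet r r' p) := by
  refine hasIntegral_of_cells (measurableSet_meet r r') (measure_meet_lt_top r r')
    (pairwise_disjoint_meet r r') (fun p s hs => ?_) fun s hs => ?_
  · rw [toFun_of_mem_meet_left r r' hs, toFun_of_mem_meet_right r r' hs]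
  · rw [(toFun_of_notMem_meet r r' hs).1, (toFun_of_notMem_meet r r' hs).2, hφ]

/-- Refining a representation keeps the integral a maximiser: each `M (r.sets j)` is a maximiser
over the pieces of `r.sets j`, and pieces outside all these sets carry coefficient `0`. Two
integrals thereby become maxima over the same vectors with different weights. -/
theorem isFMax_meet_left [IsProbabilityMeasure P] [IsProbabilityMeasure κ] (r r' : SimpleRep m)
    (hM : IsFrechetSupMeasure P m f α κ M) (hf : IsLossFunction f) (hα : 0 < α) :
    ∀ᵐ ω ∂P, IsFMax f (fun p => r.value p.1 • M (meet r r' p) ω) (r.integral f M ω) := by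
  have hU : ∀ j : Fin (r.k + 1), ⋃ q, meet r r' (some j, q) = r.sets j := fun j => by
    ext s
    refine ⟨fun hs => ?_, fun hs => ?_⟩
    · obtain ⟨q, hq⟩ := Set.mem_iUnion.1 hs
      exact meet_subset_left r r' _ hq
    · obtain ⟨q, hq⟩ := r'.exists_mem_cell s
      refine Set.mem_iUnion.2 ⟨q, ?_⟩
      unfold meet
      rw [if_neg (by simp)]
      exact ⟨hs, hq⟩
  have h : ∀ j : Fin (r.k + 1), ∀ᵐ ω ∂P,
      IsFMax f (fun q => M (meet r r' (some j, q)) ω) (M (r.sets j) ω) := fun j => by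
    have := hM.isFMax_iUnion hf hα (A := fun q => meet r r' (some j, q))
      (fun q => measurableSet_meet r r' _) (fun q => measure_meet_lt_top r r' _)
      fun q q' hq => pairwise_disjoint_meet r r' fun h => hq (Prod.mk.inj h).2
    rwa [hU] at this
  filter_upwards [ae_all_iff.2 h] with ω hω
  obtain ⟨⟨j, hj⟩, hmax⟩ := isFMax_fVeeUpTo (f := f) (fun j => r.coef j • M (r.sets j) ω) r.k
  refine ⟨?_, ?_⟩
  · obtain ⟨q, hq⟩ := (hω j).1
    refine ⟨(some j, q), hj.trans ?_⟩
    change r.coef j • M (r.sets j) ω = r.coef j • M (meet r r' (some j, q)) ω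
    rw [hq]
  · rintro ⟨_ | i, q⟩
    · change f ((0 : ℝ) • M (meet r r' (none, q)) ω) ≤ _
      rw [zero_smul, hf.map_zero]
      exact hf.nonneg _
    · refine le_trans ?_ (hmax i)
      have hc := r.coef_nonneg i (Nat.lt_succ_iff.1 i.2)
      change f (r.coef i • M (meet r r' (some i, q)) ω) ≤ f (r.coef i • M (r.sets i) ω)
      rw [hf.homogeneous _ hc, hf.homogeneous _ hc]
      exact mul_le_mul_of_nonneg_left ((hω i).2 q) hc

theorem isFMax_meet_right [IsProbabilityMeasure P] [IsProbabilityMeasure κ] (r r' : SimpleRep m)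
    (hM : IsFrechetSupMeasure P m f α κ M) (hf : IsLossFunction f) (hα : 0 < α) :
    ∀ᵐ ω ∂P, IsFMax f (fun p => r'.value p.2 • M (meet r r' p) ω) (r'.integral f M ω) := by
  filter_upwards [isFMax_meet_left r' r hM hf hα] with ω hω
  obtain ⟨⟨p, hp⟩, hmax⟩ := hω
  refine ⟨⟨p.swap, ?_⟩, fun q => ?_⟩
  · rw [hp]
    beta_reduce
    rw [← meet_swap r r' p.swap, Prod.swap_swap]
    rfl
  · have := hmax q.swap
    beta_reduce at this
    rwa [meet_swap] at this

/-- On a nonempty common cell the two weights are ordered; on an empty cell they need not be, but `M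
∅` vanishes almost surely. -/
theorem map_integral_mono [IsProbabilityMeasure P] [IsProbabilityMeasure κ] (r r' : SimpleRep m)
    (hM : IsFrechetSupMeasure P m f α κ M) (hf : IsLossFunction f) (hα : 0 < α)
    (hrr' : ∀ s, r.toFun s ≤ r'.toFun s) :
    ∀ᵐ ω ∂P, f (r.integral f M ω) ≤ f (r'.integral f M ω) := by
  filter_upwards [isFMax_meet_left r r' hM hf hα, isFMax_meet_right r r' hM hf hα,
    hM.ae_empty hf hα] with ω h1 h2 h0
  obtain ⟨⟨p, hp⟩, -⟩ := h1
  refine le_trans ?_ (h2.2 p)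
  rw [hp]
  change f (r.value p.1 • M (meet r r' p) ω) ≤ f (r'.value p.2 • M (meet r r' p) ω)
  rw [hf.homogeneous _ (r.value_nonneg _), hf.homogeneous _ (r'.value_nonneg _)]
  rcases (meet r r' p).eq_empty_or_nonempty with h | ⟨s, hs⟩
  · rw [h, h0, hf.map_zero, mul_zero, mul_zero]
  · refine mul_le_mul_of_nonneg_right ?_ (hf.nonneg _)
    rw [← toFun_of_mem_meet_left r r' hs, ← toFun_of_mem_meet_right r r' hs]
    exact hrr' s

theorem isImplicitFrechet_integral [IsProbabilityMeasure P] [IsProbabilityMeasure κ]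
    (r : SimpleRep m) (hM : IsFrechetSupMeasure P m f α κ M) (hf : IsLossFunction f) (hα : 0 < α) :
    IsImplicitFrechet P f α κ ((∫ s, |r.toFun s| ^ α ∂m) ^ (1 / α)) (r.integral f M) := by
  have h := isImplicitFrechet_integral_sum hM hf hα r.k r rfl
  rw [Finset.sum_range fun j => r.coef j ^ α * m.real (r.sets j)] at h
  convert h using 2
  refine (hasIntegral_of_cells (C := fun j : Fin (r.k + 1) => r.sets j)
    (fun j => r.sets_measurable j (Nat.lt_succ_iff.1 j.2))
    (fun j => r.sets_finite j (Nat.lt_succ_iff.1 j.2)) (fun i j hij => r.sets_disjoint _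
      (Nat.lt_succ_iff.1 i.2) _ (Nat.lt_succ_iff.1 j.2) fun h => hij (Fin.ext h))
    (fun j s hs => ?_) fun s hs => ?_).2
  · rw [r.toFun_of_mem (Nat.lt_succ_iff.1 j.2) hs,
      abs_of_nonneg (r.coef_nonneg j (Nat.lt_succ_iff.1 j.2))]
  · rw [r.toFun_of_notMem fun j hj => hs ⟨j, Nat.lt_succ_of_le hj⟩, abs_zero,
      Real.zero_rpow hα.ne']

end SimpleRep

/-! ### Domination by a factor among independent Fréchet vectors -/

section Gap

variable {Ω E : Type*} [MeasurableSpace Ω] [MeasurableSpace E] {P : Measure Ω} {m : Measure E}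
  {d : ℕ} {f : EuclideanSpace ℝ (Fin d) → ℝ} {α : ℝ} {κ : Measure (levelOne f)}
  {M : Set E → Ω → EuclideanSpace ℝ (Fin d)}

/-- A weighted maximum is attained at `p` if the competing terms are far below that of `p`. -/
theorem IsFMax.eq_of_gap {ι : Type*} (hf : IsLossFunction f) {a γ : ι → ℝ}
    {v : ι → EuclideanSpace ℝ (Fin d)} {x : EuclideanSpace ℝ (Fin d)}
    (hx : IsFMax f (fun q => a q • v q) x) (ha : ∀ q, 0 ≤ a q) (haγ : ∀ q, a q ≤ γ q) {c : ℝ}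
    {p : ι} (hp : c * γ p < a p) (hvp : 0 < f (v p))
    (hgap : ∀ q, q ≠ p → γ q * f (v q) ≤ c * (γ p * f (v p))) : x = a p • v p := by
  obtain ⟨⟨q, rfl⟩, hmax⟩ := hx
  by_cases hqp : q = p
  · rw [hqp]
  have h1 := hmax p
  simp only [hf.homogeneous _ (ha _)] at h1
  have h2 := mul_le_mul_of_nonneg_right (haγ q) (hf.nonneg (v q))
  have h3 := mul_lt_mul_of_pos_right hp hvp
  have h4 := hgap q hqp
  rw [mul_assoc] at h3
  linarith

/-- The largest of the vectors `γ p • M (A p)` is attained in `B` and exceeds the other ones by a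
factor `1 / c`, with a probability bounded below. -/
theorem le_measure_gap {ι : Type*} [Fintype ι] [IsProbabilityMeasure P] [IsProbabilityMeasure κ]
    (hM : IsFrechetSupMeasure P m f α κ M) (hf : IsLossFunction f) (hα : 0 < α) {A : ι → Set E}
    (hA : ∀ i, MeasurableSet (A i)) (hA' : ∀ i, m (A i) < ⊤)
    (hd : Pairwise fun i j => Disjoint (A i) (A j)) {γ : ι → ℝ} (hγ : ∀ i, 0 ≤ γ i)
    {c : ℝ} (hc : 0 < c) (hc1 : c < 1) (hT : 0 < ∑ i, γ i ^ α * m.real (A i)) (B : Finset ι) :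
    ENNReal.ofReal (c ^ α * (∑ i ∈ B, γ i ^ α * m.real (A i)) / ∑ i, γ i ^ α * m.real (A i)) ≤
      P {ω | ∃ p ∈ B, 0 < f (γ p • M (A p) ω) ∧
        ∀ q, q ≠ p → f (γ q • M (A q) ω) ≤ c * f (γ p • M (A p) ω)} := by
  classical
  set W : ι → Ω → ℝ := fun i ω => f (γ i • M (A i) ω) with hW
  set t : ι → ℝ := fun i => γ i ^ α * m.real (A i) with ht
  set T : ℝ := ∑ i, t i with hTdef
  have hφ : ∀ i, Measurable fun x => f (γ i • x) := fun i =>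
    hf.measurable.comp (measurable_const_smul (γ i))
  have hWm : ∀ i, Measurable (W i) := fun i => (hφ i).comp (hM.measurable _ (hA i) (hA' i))
  have hWind : iIndepFun W P := (hM.iIndepFun hA hA' hd).comp (fun i x => f (γ i • x)) hφ
  have htail : ∀ i, HasFrechetTail P α (t i) (W i) := fun i =>
    hM.hasFrechetTail_smul hf hα (hA i) (hA' i) (hγ i)
  have ht0 : ∀ i, 0 ≤ t i := fun i => mul_nonneg (Real.rpow_nonneg (hγ i) _) measureReal_nonneg
  have hcα : 0 < c ^ α := Real.rpow_pos_of_pos hc _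
  have hcα1 : c ^ α ≤ 1 := Real.rpow_le_one hc.le hc1.le hα.le
  -- For `c < 1` these events are disjoint, so their probabilities can be added.
  let G : ι → Set Ω := fun p => {ω | 0 < W p ω ∧ ∀ q, q ≠ p → W q ω ≤ c * W p ω}
  have hGm : ∀ p, MeasurableSet (G p) := fun p => by
    have : G p = {ω | 0 < W p ω} ∩ ⋂ q, ⋂ (_ : q ≠ p), {ω | W q ω ≤ c * W p ω} := by
      ext ω
      simp [G]
    rw [this]
    exact (measurableSet_lt measurable_const (hWm p)).inter (MeasurableSet.iInter fun q =>
      MeasurableSet.iInter fun _ => measurableSet_le (hWm q) ((hWm p).const_mul c))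
  have hGd : ∀ p q, p ≠ q → Disjoint (G p) (G q) := fun p q hpq => by
    rw [Set.disjoint_left]
    rintro ω ⟨h1, h2⟩ ⟨h3, h4⟩
    have h5 := h2 q hpq.symm
    have h6 := h4 p hpq
    nlinarith
  have hGP : ∀ p, 0 < t p → ENNReal.ofReal (c ^ α * t p / T) ≤ P (G p) := fun p hp => by
    let S : Finset ι := Finset.univ.erase p
    have hS : T = t p + ∑ i ∈ S, t i := (Finset.add_sum_erase _ t (Finset.mem_univ p)).symm
    have hS0 : 0 ≤ ∑ i ∈ S, t i := Finset.sum_nonneg fun i _ => ht0 i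
    have hind : IndepFun (W p) (fun ω (i : S) => W i ω) P := by
      have h := hWind.indepFun_finset {p} S
        (Finset.disjoint_singleton_left.2 (Finset.notMem_erase _ _)) hWm
      exact h.comp (φ := fun v : ({p} : Finset ι) → ℝ => v ⟨p, Finset.mem_singleton_self p⟩)
        (measurable_pi_apply _) measurable_id
    have hDm : MeasurableSet {x : ℝ × (S → ℝ) | ∀ i, x.2 i ≤ x.1} := by
      have : {x : ℝ × (S → ℝ) | ∀ i, x.2 i ≤ x.1} = ⋂ i, {x : ℝ × (S → ℝ) | x.2 i ≤ x.1} := by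
        ext x
        simp
      rw [this]
      exact MeasurableSet.iInter fun i => measurableSet_le
        ((measurable_pi_apply i).comp measurable_snd) measurable_fst
    -- By independence the maximum of the other radii has a Fréchet tail with parameter `∑ i ∈ S, t
    -- i`, so the exact probability of `G p` is `c ^ α * t p / (c ^ α * t p + ∑ i ∈ S, t i)`.
    have key := HasFrechetTail.measure_dominates hα (hWm p)
      (measurable_pi_iff.2 fun i : S => hWm i) hind hp hS0 hc (htail p) hDm fun x hx => by
        have h1 := hWind.measure_inter_preimage_eq_mul S (sets := fun _ => Set.Iic x)
          fun i _ => measurableSet_Iic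
        have h2 : {ω | (x, fun i : S => W i ω) ∈ {x : ℝ × (S → ℝ) | ∀ i, x.2 i ≤ x.1}} =
            ⋂ i ∈ S, W i ⁻¹' Set.Iic x := by
          ext ω
          simp
        have h3 : ∀ i ∈ S, P (W i ⁻¹' Set.Iic x) =
            ENNReal.ofReal (Real.exp (-(t i * x ^ (-α)))) := fun i _ => htail i x hx
        rw [h2, h1, Finset.prod_congr rfl h3, ← ENNReal.ofReal_prod_of_nonneg
          fun i _ => (Real.exp_pos _).le, ← Real.exp_sum, Finset.sum_neg_distrib, Finset.sum_mul]
    have h3 : P (G p) = P {ω | (c * W p ω, fun i : S => W i ω) ∈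
        {x : ℝ × (S → ℝ) | ∀ i, x.2 i ≤ x.1}} := by
      refine measure_congr ?_
      filter_upwards [(htail p).ae_pos hα hp] with ω hω
      refine propext ?_
      change (0 < W p ω ∧ ∀ q, q ≠ p → W q ω ≤ c * W p ω) ↔ ∀ i : S, W i ω ≤ c * W p ω
      refine ⟨fun h i => h.2 i (Finset.ne_of_mem_erase i.2), fun h => ⟨hω, fun q hq =>
        h ⟨q, Finset.mem_erase.2 ⟨hq, Finset.mem_univ q⟩⟩⟩⟩
    rw [h3, key]
    -- Enlarging the denominator to `T` makes it independent of `p`, ready for summation.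
    refine ENNReal.ofReal_le_ofReal ?_
    refine div_le_div_of_nonneg_left (by positivity) (by positivity) ?_
    rw [hS]
    nlinarith
  -- Terms with `t p = 0` contribute nothing to the sum and are not covered by `hGP`.
  let B' : Finset ι := B.filter fun p => 0 < t p
  calc ENNReal.ofReal (c ^ α * (∑ i ∈ B, t i) / T)
      = ∑ p ∈ B', ENNReal.ofReal (c ^ α * t p / T) := by
        rw [← ENNReal.ofReal_sum_of_nonneg fun p _ => by have := ht0 p; positivity,
          ← Finset.sum_div, ← Finset.mul_sum]
        congr 3
        refine (Finset.sum_subset (Finset.filter_subset _ _) fun p hp hp' => ?_).symm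
        by_contra h
        exact hp' (Finset.mem_filter.2 ⟨hp, lt_of_le_of_ne (ht0 p) (Ne.symm h)⟩)
    _ ≤ ∑ p ∈ B', P (G p) :=
        Finset.sum_le_sum fun p hp => hGP p (Finset.mem_filter.1 hp).2
    _ = P (⋃ p ∈ B', G p) :=
        (measure_biUnion_finset (fun p _ q _ hpq => hGd p q hpq) fun p _ => hGm p).symm
    _ ≤ _ := by
        refine measure_mono fun ω hω => ?_
        simp only [Set.mem_iUnion] at hω
        obtain ⟨p, hp, h⟩ := hω
        exact ⟨p, (Finset.mem_filter.1 hp).1, h⟩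

end Gap

/-! ### Continuity in probability of the integral of simple functions -/

namespace SimpleRep

variable {Ω E : Type*} [MeasurableSpace Ω] [MeasurableSpace E] {P : Measure Ω} {m : Measure E}
  {d : ℕ} {f : EuclideanSpace ℝ (Fin d) → ℝ} {α : ℝ} {κ : Measure (levelOne f)}
  {M : Set E → Ω → EuclideanSpace ℝ (Fin d)}

/-- The integrals of two simple functions are close with high probability as soon as the two
functions are close in `L^α`. The bound is in terms of the common refinement, of `γ = max a b` and
of a ratio `c` close to `1`. -/
theorem measure_dist_integral_le [IsProbabilityMeasure P] [IsProbabilityMeasure κ]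
    (r r' : SimpleRep m) (hM : IsFrechetSupMeasure P m f α κ M) (hf : IsLossFunction f)
    (hα : 0 < α) {c ε : ℝ} (hc : 0 < c) (hc1 : c < 1)
    (hT : 0 < ∫ s, max (r.toFun s) (r'.toFun s) ^ α ∂m) :
    P {ω | ε ≤ dist (r.integral f M ω) (r'.integral f M ω)} ≤
      ENNReal.ofReal (1 - c ^ α + (∫ s, |(|r.toFun s| ^ α - |r'.toFun s| ^ α)| ∂m) /
          ((1 - c ^ α) * ∫ s, max (r.toFun s) (r'.toFun s) ^ α ∂m)) +
        P {ω | ε * c / (1 - c) ≤ ‖r.integral f M ω‖} := by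
  classical
  have hcα : 0 < c ^ α := Real.rpow_pos_of_pos hc _
  have hcα1 : c ^ α < 1 := Real.rpow_lt_one hc.le hc1 hα
  set C := meet r r'
  have e1 := (integral_meet r r' (φ := fun x y => max x y ^ α)
    (by simp [Real.zero_rpow hα.ne'])).2
  have e2 := (integral_meet r r' (φ := fun x y => |(|x| ^ α - |y| ^ α)|) (by simp)).2
  beta_reduce at e1 e2
  set D := ∫ s, |(|r.toFun s| ^ α - |r'.toFun s| ^ α)| ∂m
  set T := ∫ s, max (r.toFun s) (r'.toFun s) ^ α ∂m
  let γ : Option (Fin (r.k + 1)) × Option (Fin (r'.k + 1)) → ℝ := fun p =>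
    max (r.value p.1) (r'.value p.2)
  have ha : ∀ p : Option (Fin (r.k + 1)) × Option (Fin (r'.k + 1)), 0 ≤ r.value p.1 := fun p =>
    r.value_nonneg _
  have hb : ∀ p : Option (Fin (r.k + 1)) × Option (Fin (r'.k + 1)), 0 ≤ r'.value p.2 := fun p =>
    r'.value_nonneg _
  have hγ : ∀ p, 0 ≤ γ p := fun p => (ha p).trans (le_max_left _ _)
  let B : Finset (Option (Fin (r.k + 1)) × Option (Fin (r'.k + 1))) :=
    Finset.univ.filter fun p => c * γ p < r.value p.1 ∧ c * γ p < r'.value p.2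
  have hTsum : T = ∑ p, γ p ^ α * m.real (C p) := e1
  have hgap := le_measure_gap hM hf hα (measurableSet_meet r r') (measure_meet_lt_top r r')
    (pairwise_disjoint_meet r r') hγ hc hc1 (hTsum ▸ hT) B
  rw [← hTsum] at hgap
  -- Outside `B` the smaller value is at most `c * γ p`, so the `α`-th powers differ by at least `(1
  -- - c ^ α) * γ p ^ α`; a small `L^α` difference leaves little mass there.
  have hbad : (1 - c ^ α) * ∑ p ∈ Bᶜ, γ p ^ α * m.real (C p) ≤ D := by
    rw [e2, Finset.mul_sum]
    refine (Finset.sum_le_sum (g := fun p : Option (Fin (r.k + 1)) × Option (Fin (r'.k + 1)) =>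
      |(|r.value p.1| ^ α - |r'.value p.2| ^ α)| * m.real (C p)) fun p hp => ?_).trans
      (Finset.sum_le_univ_sum_of_nonneg fun p => mul_nonneg (abs_nonneg _) measureReal_nonneg)
    rw [← mul_assoc]
    refine mul_le_mul_of_nonneg_right ?_ measureReal_nonneg
    have hp' : ¬ (c * γ p < r.value p.1 ∧ c * γ p < r'.value p.2) := fun h =>
      Finset.mem_compl.1 hp (Finset.mem_filter.2 ⟨Finset.mem_univ _, h⟩)
    have key : ∀ x y : ℝ, 0 ≤ x → 0 ≤ y → x ≤ y → ¬ (c * y < x ∧ c * y < y) →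
        (1 - c ^ α) * y ^ α ≤ y ^ α - x ^ α := fun x y hx hy hxy h => by
      have h1 : x ≤ c * y := by
        by_contra h2
        push Not at h2
        exact h ⟨h2, by
          have : 0 < y := lt_of_le_of_ne hy fun h0 => by
            rw [← h0] at hxy h2
            linarith
          nlinarith⟩
      have h2 := Real.rpow_le_rpow hx h1 hα.le
      rw [Real.mul_rpow hc.le hy] at h2
      linarith
    rw [abs_of_nonneg (ha p), abs_of_nonneg (hb p)]
    rcases le_total (r.value p.1) (r'.value p.2) with h | h
    · have hγp : γ p = r'.value p.2 := max_eq_right h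
      rw [hγp] at hp' ⊢
      refine (key _ _ (ha p) (hb p) h hp').trans ?_
      rw [abs_sub_comm]
      exact le_abs_self _
    · have hγp : γ p = r.value p.1 := max_eq_left h
      rw [hγp] at hp' ⊢
      exact (key _ _ (hb p) (ha p) h fun h => hp' h.symm).trans (le_abs_self _)
  have hreal : 1 - (1 - c ^ α + D / ((1 - c ^ α) * T)) ≤
      c ^ α * (∑ p ∈ B, γ p ^ α * m.real (C p)) / T := by
    have hsplit : T = ∑ p ∈ B, γ p ^ α * m.real (C p) + ∑ p ∈ Bᶜ, γ p ^ α * m.real (C p) := by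
      rw [hTsum, Finset.sum_add_sum_compl]
    have hS0 : 0 ≤ ∑ p ∈ Bᶜ, γ p ^ α * m.real (C p) :=
      Finset.sum_nonneg fun p _ => mul_nonneg (Real.rpow_nonneg (hγ p) _) measureReal_nonneg
    set S := ∑ p ∈ Bᶜ, γ p ^ α * m.real (C p)
    have h1 : ∑ p ∈ B, γ p ^ α * m.real (C p) = T - S := by linarith
    have hpos : 0 < 1 - c ^ α := sub_pos.2 hcα1
    have h2 : S / T ≤ D / ((1 - c ^ α) * T) := by
      rw [div_le_div_iff₀ hT (by positivity)]
      nlinarith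
    have h3 : c ^ α * (T - S) / T = c ^ α - c ^ α * (S / T) := by
      field_simp
    have h4 : 0 ≤ S / T := by positivity
    rw [h1, h3]
    nlinarith
  set G : Set Ω := {ω | ∃ p ∈ B, 0 < f (γ p • M (C p) ω) ∧
        ∀ q, q ≠ p → f (γ q • M (C q) ω) ≤ c * f (γ p • M (C p) ω)}
  have hGm : MeasurableSet G := by
    have hφ : ∀ p, Measurable fun ω => f (γ p • M (C p) ω) := fun p => hf.measurable.comp
      ((hM.measurable _ (measurableSet_meet r r' p) (measure_meet_lt_top r r' p)).const_smul (γ p))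
    have : G = ⋃ p ∈ B, ({ω | 0 < f (γ p • M (C p) ω)} ∩
        ⋂ q, ⋂ (_ : q ≠ p), {ω | f (γ q • M (C q) ω) ≤ c * f (γ p • M (C p) ω)}) := by
      ext ω
      simp only [G, Set.mem_iUnion, Set.mem_inter_iff, Set.mem_iInter, Set.mem_ofPred_eq,
        exists_prop]
    rw [this]
    exact B.measurableSet_biUnion fun p _ => (measurableSet_lt measurable_const (hφ p)).inter
      (MeasurableSet.iInter fun q => MeasurableSet.iInter fun _ =>
        measurableSet_le (hφ q) ((hφ p).const_mul c))
  have hsub : ∀ᵐ ω ∂P, ω ∈ {ω | ε ≤ dist (r.integral f M ω) (r'.integral f M ω)} →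
      ω ∈ Gᶜ ∪ {ω | ε * c / (1 - c) ≤ ‖r.integral f M ω‖} := by
    filter_upwards [isFMax_meet_left r r' hM hf hα, isFMax_meet_right r r' hM hf hα]
      with ω h1 h2 hdist
    by_cases hω : ω ∈ G
    swap
    · exact Or.inl hω
    refine Or.inr ?_
    obtain ⟨p, hpB, hpos, hother⟩ := hω
    obtain ⟨-, hpa, hpb⟩ := Finset.mem_filter.1 hpB
    simp only [hf.homogeneous _ (hγ _)] at hpos hother
    have hv : 0 < f (M (C p) ω) := pos_of_mul_pos_right hpos (hγ p)
    -- Both integrals are attained on the same cell `p`, so they are multiples of the single vector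
    -- `M (C p) ω`.
    have ea := h1.eq_of_gap (γ := γ) (c := c) hf ha (fun q => le_max_left _ _) hpa hv hother
    have eb := h2.eq_of_gap (γ := γ) (c := c) hf hb (fun q => le_max_right _ _) hpb hv hother
    change ε ≤ dist _ _ at hdist
    change ε * c / (1 - c) ≤ ‖r.integral f M ω‖
    rw [ea, eb, dist_eq_norm, ← sub_smul, norm_smul, Real.norm_eq_abs] at hdist
    rw [ea, norm_smul, Real.norm_of_nonneg (ha p), div_le_iff₀ (sub_pos.2 hc1)]
    have haγ : r.value p.1 ≤ γ p := le_max_left _ _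
    have hbγ : r'.value p.2 ≤ γ p := le_max_right _ _
    -- Both values lie between `c * γ p` and `γ p`. A distance of at least `ε` then forces the first
    -- integral itself to have norm at least `ε * c / (1 - c)`.
    have hab : |r.value p.1 - r'.value p.2| * c ≤ r.value p.1 * (1 - c) := by
      have : |r.value p.1 - r'.value p.2| ≤ (1 - c) * γ p := by
        rw [abs_le]
        constructor <;> linarith
      nlinarith
    have := norm_nonneg (M (C p) ω)
    nlinarith
  calc P {ω | ε ≤ dist (r.integral f M ω) (r'.integral f M ω)}
      ≤ P (Gᶜ ∪ {ω | ε * c / (1 - c) ≤ ‖r.integral f M ω‖}) := measure_mono_ae hsub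
    _ ≤ P Gᶜ + P {ω | ε * c / (1 - c) ≤ ‖r.integral f M ω‖} := measure_union_le _ _
    _ ≤ _ := by
        gcongr
        rw [prob_compl_eq_one_sub hGm]
        rw [tsub_le_iff_right]
        refine le_trans ?_ (add_le_add_right hgap _)
        rw [← ENNReal.ofReal_one]
        refine le_trans (ENNReal.ofReal_le_ofReal ?_) ENNReal.ofReal_add_le
        linarith

/-- The bound `L` makes the tail of the first integral uniform, so a ratio `c` close to `1` can be
fixed before the functions. What remains is a bound with the total mass of the maximum in the
denominator, harmless unless that mass is small, in which case both integrals are small. -/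
theorem exists_measure_dist_integral_le [IsProbabilityMeasure P] [IsProbabilityMeasure κ]
    (hM : IsFrechetSupMeasure P m f α κ M) (hf : IsLossFunction f)
    (hα : 0 < α) {ε L : ℝ} (hε : 0 < ε) (hL : 0 < L) :
    ∃ δ > 0, ∀ r r' : SimpleRep m, ∫ s, |r.toFun s| ^ α ∂m ≤ L →
      ∫ s, |(|r.toFun s| ^ α - |r'.toFun s| ^ α)| ∂m ≤ δ →
      P {ω | ε ≤ dist (r.integral f M ω) (r'.integral f M ω)} ≤ ENNReal.ofReal ε := by
  -- The empty set serves only to produce a standard Fréchet law.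
  obtain ⟨ν, hν, -⟩ := hM.law ∅ MeasurableSet.empty (by simp)
  have := hν.1
  have htail := tendsto_polarTail ν κ
  have hLα : 0 < L ^ (1 / α) := Real.rpow_pos_of_pos hL _
  -- the ratio `c`
  obtain ⟨c, hc, hc1, hcε, hctail⟩ : ∃ c : ℝ, 0 < c ∧ c < 1 ∧ 1 - c ^ α ≤ ε / 3 ∧
      polarTail ν κ (ε * c / (1 - c) / L ^ (1 / α)) ≤ ENNReal.ofReal (ε / 3) := by
    have t1 : Tendsto (fun c : ℝ => 1 - c ^ α) (𝓝[<] 1) (𝓝 0) := by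
      have : ContinuousAt (fun c : ℝ => 1 - c ^ α) 1 :=
        continuousAt_const.sub (Real.continuousAt_rpow_const _ _ (Or.inl one_ne_zero))
      have h := this.tendsto
      rw [Real.one_rpow, sub_self] at h
      exact h.mono_left nhdsWithin_le_nhds
    have t2 : Tendsto (fun c : ℝ => ε * c / (1 - c) / L ^ (1 / α)) (𝓝[<] 1) atTop := by
      refine Tendsto.atTop_div_const hLα ?_
      have h1 : Tendsto (fun c : ℝ => ε * c) (𝓝[<] 1) (𝓝 ε) := by
        have : Continuous fun c : ℝ => ε * c := by fun_prop
        simpa using (this.tendsto 1).mono_left nhdsWithin_le_nhds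
      have h2 : Tendsto (fun c : ℝ => (1 - c)⁻¹) (𝓝[<] 1) atTop := by
        refine tendsto_inv_nhdsGT_zero.comp (tendsto_nhdsWithin_iff.2 ⟨?_, ?_⟩)
        · have : Continuous fun c : ℝ => 1 - c := by fun_prop
          simpa using (this.tendsto 1).mono_left nhdsWithin_le_nhds
        · filter_upwards [self_mem_nhdsWithin] with c hc
          exact Set.mem_Ioi.2 (sub_pos.2 (Set.mem_Iio.1 hc))
      exact h1.pos_mul_atTop hε h2
    have ev := ((t1.eventually_le_const (by positivity : (0 : ℝ) < ε / 3)).and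
      ((htail.comp t2).eventually_le_const
        (ENNReal.ofReal_pos.2 (by positivity : (0 : ℝ) < ε / 3)))).and
      ((Ioo_mem_nhdsLT (zero_lt_one (α := ℝ))))
    obtain ⟨c, ⟨h1, h2⟩, h3⟩ := ev.exists
    exact ⟨c, h3.1, h3.2, h1, h2⟩
  -- the threshold `η` below which both integrals are small
  obtain ⟨s, hs, hstail⟩ : ∃ s : ℝ, 0 < s ∧
      polarTail ν κ (ε / 2 / s) ≤ ENNReal.ofReal (ε / 2) := by
    have t : Tendsto (fun s : ℝ => ε / 2 / s) (𝓝[>] 0) atTop :=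
      Tendsto.const_mul_atTop (by positivity : (0 : ℝ) < ε / 2) tendsto_inv_nhdsGT_zero
    have ev := ((htail.comp t).eventually_le_const
      (ENNReal.ofReal_pos.2 (by positivity : (0 : ℝ) < ε / 2))).and self_mem_nhdsWithin
    obtain ⟨s, h1, h2⟩ := ev.exists
    exact ⟨s, h2, h1⟩
  have hη : 0 < s ^ α := Real.rpow_pos_of_pos hs _
  have hcα1 : 0 < 1 - c ^ α := sub_pos.2 (Real.rpow_lt_one hc.le hc1 hα)
  -- With this `δ` the quotient in `measure_dist_integral_le` is at most `ε / 3` once the mass of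
  -- the maximum exceeds `s ^ α`; the other two thirds are `1 - c ^ α` and the tail.
  refine ⟨(1 - c ^ α) * s ^ α * (ε / 3), by positivity, fun r r' hr hD => ?_⟩
  have hnn : ∀ q : SimpleRep m, 0 ≤ ∫ s, |q.toFun s| ^ α ∂m := fun q =>
    integral_nonneg fun s => Real.rpow_nonneg (abs_nonneg _) _
  have h_int := (integral_meet r r' (φ := fun x y => max x y ^ α)
    (by simp [Real.zero_rpow hα.ne'])).1
  have h_int₁ := (integral_meet r r' (φ := fun x y => |x| ^ α) (by simp [Real.zero_rpow hα.ne'])).1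
  have h_int₂ := (integral_meet r r' (φ := fun x y => |y| ^ α) (by simp [Real.zero_rpow hα.ne'])).1
  rcases le_or_gt (∫ s, max (r.toFun s) (r'.toFun s) ^ α ∂m) (s ^ α) with hT | hT
  · have hr1 : ∫ s, |r.toFun s| ^ α ∂m ≤ s ^ α := by
      refine (integral_mono h_int₁ h_int fun s => ?_).trans hT
      rw [abs_of_nonneg (r.toFun_nonneg s)]
      exact Real.rpow_le_rpow (r.toFun_nonneg s) (le_max_left _ _) hα.le
    have hr2 : ∫ s, |r'.toFun s| ^ α ∂m ≤ s ^ α := by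
      refine (integral_mono h_int₂ h_int fun s => ?_).trans hT
      rw [abs_of_nonneg (r'.toFun_nonneg s)]
      exact Real.rpow_le_rpow (r'.toFun_nonneg s) (le_max_right _ _) hα.le
    have hsmall : ∀ q : SimpleRep m, ∫ s, |q.toFun s| ^ α ∂m ≤ s ^ α →
        P {ω | ε / 2 ≤ ‖q.integral f M ω‖} ≤ ENNReal.ofReal (ε / 2) := fun q hq => by
      refine ((q.isImplicitFrechet_integral hM hf hα).measure_le_norm
        (Real.rpow_nonneg (hnn q) _) ?_ hs hν).trans hstail
      refine (Real.rpow_le_rpow (hnn q) hq (by positivity)).trans_eq ?_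
      rw [← Real.rpow_mul hs.le, mul_one_div, div_self hα.ne', Real.rpow_one]
    calc P {ω | ε ≤ dist (r.integral f M ω) (r'.integral f M ω)}
        ≤ P ({ω | ε / 2 ≤ ‖r.integral f M ω‖} ∪ {ω | ε / 2 ≤ ‖r'.integral f M ω‖}) := by
          refine measure_mono fun ω hω => ?_
          change ε ≤ dist _ _ at hω
          rw [dist_eq_norm] at hω
          have := hω.trans (norm_sub_le _ _)
          by_contra h
          simp only [Set.mem_union, not_or] at h
          have h1 : ‖r.integral f M ω‖ < ε / 2 := not_le.1 h.1
          have h2 : ‖r'.integral f M ω‖ < ε / 2 := not_le.1 h.2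
          linarith
      _ ≤ _ := measure_union_le _ _
      _ ≤ ENNReal.ofReal (ε / 2) + ENNReal.ofReal (ε / 2) :=
          add_le_add (hsmall r hr1) (hsmall r' hr2)
      _ = ENNReal.ofReal ε := by
          rw [← ENNReal.ofReal_add (by positivity) (by positivity), add_halves]
  · have hT0 := hη.trans hT
    refine (measure_dist_integral_le r r' hM hf hα hc hc1 hT0).trans ?_
    have h1 : P {ω | ε * c / (1 - c) ≤ ‖r.integral f M ω‖} ≤ ENNReal.ofReal (ε / 3) :=
      ((r.isImplicitFrechet_integral hM hf hα).measure_le_norm (Real.rpow_nonneg (hnn r) _)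
        (Real.rpow_le_rpow (hnn r) hr (by positivity)) hLα hν).trans hctail
    refine (add_le_add_right h1 _).trans ?_
    have h2 : (∫ s, |(|r.toFun s| ^ α - |r'.toFun s| ^ α)| ∂m) /
        ((1 - c ^ α) * ∫ s, max (r.toFun s) (r'.toFun s) ^ α ∂m) ≤ ε / 3 := by
      rw [div_le_iff₀ (by positivity)]
      refine hD.trans ?_
      have := mul_le_mul_of_nonneg_left hT.le (by positivity : 0 ≤ ε / 3 * (1 - c ^ α))
      linarith
    calc _ ≤ ENNReal.ofReal (ε / 3 + ε / 3) + ENNReal.ofReal (ε / 3) := by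
          refine add_le_add_left (ENNReal.ofReal_le_ofReal ?_) _
          linarith
      _ = ENNReal.ofReal ε := by
          rw [← ENNReal.ofReal_add (by positivity) (by positivity)]
          congr 1
          ring

end SimpleRep

/-! ### Convergence in probability -/

theorem tendsto_zero_of_forall_le_ofReal {ι : Type*} {l : Filter ι} {u : ι → ENNReal}
    (h : ∀ ε : ℝ, 0 < ε → ∀ᶠ i in l, u i ≤ ENNReal.ofReal ε) : Tendsto u l (𝓝 0) := by
  rw [ENNReal.tendsto_nhds_zero]
  intro δ hδ
  obtain ⟨e, he, heδ⟩ := ENNReal.lt_iff_exists_nnreal_btwn.1 hδ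
  filter_upwards [h e (by exact_mod_cast he)] with i hi
  rw [ENNReal.ofReal_coe_nnreal] at hi
  exact hi.trans heδ.le

section InMeasure

variable {Ω V : Type*} [MeasurableSpace Ω] {P : Measure Ω} [NormedAddCommGroup V]

/-- If the sequences `X` and `Y` approach each other in probability, then `X` converges to any
limit of a subsequence of `Y`. -/
theorem tendstoInMeasure_of_dist {X Y : ℕ → Ω → V} {Z : Ω → V}
    (h : ∀ ε : ℝ, 0 < ε → ∃ N, ∀ n ≥ N, ∀ k ≥ N,
      P {ω | ε ≤ dist (X n ω) (Y k ω)} ≤ ENNReal.ofReal ε)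
    {ns : ℕ → ℕ} (hns : Tendsto ns atTop atTop)
    (hY : TendstoInMeasure P (fun j => Y (ns j)) atTop Z) : TendstoInMeasure P X atTop Z := by
  rw [tendstoInMeasure_iff_dist] at hY ⊢
  intro ε hε
  refine tendsto_zero_of_forall_le_ofReal fun δ hδ => ?_
  -- The hypothesis uses one number for both distance and probability, hence the minimum.
  obtain ⟨N, hN⟩ := h (min (ε / 2) (δ / 2)) (by positivity)
  have h1 := ENNReal.tendsto_nhds_zero.1 (hY (ε / 2) (by positivity)) (ENNReal.ofReal (δ / 2))
    (ENNReal.ofReal_pos.2 (by positivity))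
  obtain ⟨j, hj1, hj2⟩ := (h1.and (hns.eventually_ge_atTop N)).exists
  filter_upwards [eventually_ge_atTop N] with n hn
  calc P {ω | ε ≤ dist (X n ω) (Z ω)}
      ≤ P ({ω | min (ε / 2) (δ / 2) ≤ dist (X n ω) (Y (ns j) ω)} ∪
          {ω | ε / 2 ≤ dist (Y (ns j) ω) (Z ω)}) := by
        refine measure_mono fun ω hω => ?_
        change ε ≤ dist _ _ at hω
        by_contra hcon
        simp only [Set.mem_union, not_or] at hcon
        have h2 : dist (X n ω) (Y (ns j) ω) < min (ε / 2) (δ / 2) := not_le.1 hcon.1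
        have h3 : dist (Y (ns j) ω) (Z ω) < ε / 2 := not_le.1 hcon.2
        have := dist_triangle (X n ω) (Y (ns j) ω) (Z ω)
        have := min_le_left (ε / 2) (δ / 2)
        linarith
    _ ≤ ENNReal.ofReal (δ / 2) + ENNReal.ofReal (δ / 2) :=
        (measure_union_le _ _).trans (add_le_add ((hN n hn _ hj2).trans
          (ENNReal.ofReal_le_ofReal (min_le_right _ _))) hj1)
    _ = ENNReal.ofReal δ := by
        rw [← ENNReal.ofReal_add (by positivity) (by positivity), add_halves]

/-- A sequence that is Cauchy in probability converges in probability. -/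
theorem exists_tendstoInMeasure_of_cauchy [IsProbabilityMeasure P] [MeasurableSpace V]
    [BorelSpace V] [CompleteSpace V] [SecondCountableTopology V] {X : ℕ → Ω → V}
    (hX : ∀ n, Measurable (X n))
    (h : ∀ ε : ℝ, 0 < ε → ∃ N, ∀ n ≥ N, ∀ k ≥ N,
      P {ω | ε ≤ dist (X n ω) (X k ω)} ≤ ENNReal.ofReal ε) :
    ∃ Z, Measurable Z ∧ TendstoInMeasure P X atTop Z := by
  have hhalf : ∀ j : ℕ, (0 : ℝ) < (1 / 2) ^ j := fun j => by positivity
  choose N hN using fun j : ℕ => h ((1 / 2) ^ j) (hhalf j)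
  obtain ⟨ns, hns, hge⟩ : ∃ ns : ℕ → ℕ, StrictMono ns ∧ ∀ j, N j ≤ ns j :=
    extraction_forall_of_eventually (fun j => eventually_ge_atTop (N j))
  -- Borel–Cantelli then makes the subsequence almost surely Cauchy.
  have hsum : ∑' j, P {ω | (1 / 2 : ℝ) ^ j ≤ dist (X (ns j) ω) (X (ns (j + 1)) ω)} ≠ ⊤ := by
    have hle : ∀ j, P {ω | (1 / 2 : ℝ) ^ j ≤ dist (X (ns j) ω) (X (ns (j + 1)) ω)} ≤
        ENNReal.ofReal ((1 / 2) ^ j) := fun j =>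
      hN j _ (hge j) _ ((hge j).trans (hns.monotone j.le_succ))
    refine ((ENNReal.tsum_le_tsum hle).trans_lt ?_).ne
    rw [← ENNReal.ofReal_tsum_of_nonneg (fun j => (hhalf j).le) summable_geometric_two]
    exact ENNReal.ofReal_lt_top
  have hae : ∀ᵐ ω ∂P, ∃ z, Tendsto (fun j => X (ns j) ω) atTop (𝓝 z) := by
    filter_upwards [ae_eventually_notMem hsum] with ω hω
    refine cauchySeq_tendsto_of_complete ?_
    obtain ⟨j₀, hj₀⟩ := eventually_atTop.1 hω
    have hC : CauchySeq fun j => X (ns (j + j₀)) ω := by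
      refine cauchySeq_of_le_geometric (1 / 2) 1 (by norm_num) fun j => ?_
      have h1 : dist (X (ns (j + j₀)) ω) (X (ns (j + j₀ + 1)) ω) < (1 / 2) ^ (j + j₀) :=
        not_le.1 (hj₀ (j + j₀) (Nat.le_add_left _ _))
      rw [one_mul, show j + 1 + j₀ = j + j₀ + 1 by ring]
      exact h1.le.trans (pow_le_pow_of_le_one (by norm_num) (by norm_num) (Nat.le_add_right _ _))
    exact (cauchySeq_shift j₀).1 hC
  obtain ⟨Z, hZ, hlim⟩ := measurable_limit_of_tendsto_metrizable_ae
    (fun j => (hX (ns j)).aemeasurable) hae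
  exact ⟨Z, hZ, tendstoInMeasure_of_dist h hns.tendsto_atTop
    (tendstoInMeasure_of_tendsto_ae (fun j => (hX (ns j)).aestronglyMeasurable) hlim)⟩

end InMeasure

/-! ### The space `L^α_+` -/

namespace MemLPlus

variable {E : Type*} [MeasurableSpace E] {m : Measure E} {α : ℝ} {g h : E → ℝ}

theorem integrable_rpow (hα : 0 < α) (hg : MemLPlus α m g) :
    Integrable (fun s => |g s| ^ α) m := by
  have := hg.memLp.integrable_norm_rpow (by simpa using hα) ENNReal.ofReal_ne_top
  simpa [ENNReal.toReal_ofReal hα.le] using this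

theorem indicator (hg : MemLPlus α m g) {B : Set E} (hB : MeasurableSet B) :
    MemLPlus α m (B.indicator g) :=
  ⟨hg.measurable.indicator hB, fun s => Set.indicator_nonneg (fun s _ => hg.nonneg s) s,
    hg.memLp.indicator hB⟩

theorem const_mul (hg : MemLPlus α m g) {a : ℝ} (ha : 0 ≤ a) : MemLPlus α m fun s => a * g s :=
  ⟨hg.measurable.const_mul a, fun s => mul_nonneg ha (hg.nonneg s), hg.memLp.const_mul a⟩

theorem max (hg : MemLPlus α m g) (hh : MemLPlus α m h) : MemLPlus α m fun s => max (g s) (h s) :=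
  ⟨hg.measurable.max hh.measurable, fun s => le_max_of_le_left (hg.nonneg s),
    hg.memLp.sup hh.memLp⟩

end MemLPlus

/-! ### Approximation by simple functions -/

section Approximation

variable {E : Type*} [MeasurableSpace E] {m : Measure E}

/-- The dyadic approximation of a function from below, as a representation. -/
noncomputable def dyadicRep (m : Measure E) [SigmaFinite m] {g : E → ℝ} (hg : Measurable g)
    (n : ℕ) : SimpleRep m where
  k := n * 2 ^ n
  coef j := j / 2 ^ n
  -- The spanning set keeps the measure finite; the cap collects all values of `g` above `n` in the
  -- top level.
  sets j := spanningSets m n ∩ {s | min ⌊g s * 2 ^ n⌋₊ (n * 2 ^ n) = j}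
  coef_nonneg j _ := by positivity
  sets_measurable j _ := (measurableSet_spanningSets m n).inter
    (((Nat.measurable_floor.comp (hg.mul_const _)).min measurable_const)
      (measurableSet_singleton j))
  sets_finite j _ := (measure_mono Set.inter_subset_left).trans_lt (measure_spanningSets_lt_top m n)
  sets_disjoint i _ j _ hij := Set.disjoint_left.2 fun s hi hj => hij (hi.2.symm.trans hj.2)

theorem dyadicRep_toFun_of_mem [SigmaFinite m] {g : E → ℝ} (hg : Measurable g) {n : ℕ} {s : E}
    (hs : s ∈ spanningSets m n) :
    (dyadicRep m hg n).toFun s = (min ⌊g s * 2 ^ n⌋₊ (n * 2 ^ n) : ℕ) / 2 ^ n :=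
  (dyadicRep m hg n).toFun_of_mem (j := min ⌊g s * 2 ^ n⌋₊ (n * 2 ^ n)) (min_le_right _ _)
    ⟨hs, rfl⟩

theorem dyadicRep_toFun_of_notMem [SigmaFinite m] {g : E → ℝ} (hg : Measurable g) {n : ℕ} {s : E}
    (hs : s ∉ spanningSets m n) : (dyadicRep m hg n).toFun s = 0 :=
  (dyadicRep m hg n).toFun_of_notMem fun _ _ h => hs h.1

/-- The same increasing formula is applied to both functions, so ordered functions have
approximations ordered at every level; `map_extremalIntegral_mono` rests on this. -/
theorem dyadicRep_mono [SigmaFinite m] {g h : E → ℝ} (hg : Measurable g) (hh : Measurable h)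
    (hgh : ∀ s, g s ≤ h s) (n : ℕ) (s : E) :
    (dyadicRep m hg n).toFun s ≤ (dyadicRep m hh n).toFun s := by
  by_cases hs : s ∈ spanningSets m n
  · rw [dyadicRep_toFun_of_mem hg hs, dyadicRep_toFun_of_mem hh hs]
    have := hgh s
    gcongr
  · rw [dyadicRep_toFun_of_notMem hg hs, dyadicRep_toFun_of_notMem hh hs]

theorem dyadicRep_increasesTo [SigmaFinite m] {g : E → ℝ} (hg : Measurable g)
    (hg0 : ∀ s, 0 ≤ g s) : IncreasesTo (dyadicRep m hg) g := by
  refine ⟨fun n s => ?_, fun s => ?_⟩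
  · by_cases hs : s ∈ spanningSets m n
    · have hs' : s ∈ spanningSets m (n + 1) := monotone_spanningSets m n.le_succ hs
      rw [dyadicRep_toFun_of_mem hg hs, dyadicRep_toFun_of_mem hg hs',
        div_le_div_iff₀ (by positivity) (by positivity)]
      have key : min ⌊g s * 2 ^ n⌋₊ (n * 2 ^ n) * 2 ≤
          min ⌊g s * 2 ^ (n + 1)⌋₊ ((n + 1) * 2 ^ (n + 1)) := by
        refine le_min ?_ ?_
        · refine Nat.le_floor ?_
          have h1 : ((min ⌊g s * 2 ^ n⌋₊ (n * 2 ^ n) : ℕ) : ℝ) ≤ g s * 2 ^ n :=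
            (Nat.cast_le.2 (min_le_left _ _)).trans
              (Nat.floor_le (mul_nonneg (hg0 s) (by positivity)))
          push_cast at h1 ⊢
          rw [pow_succ]
          linarith
        · calc min ⌊g s * 2 ^ n⌋₊ (n * 2 ^ n) * 2 ≤ n * 2 ^ n * 2 :=
                Nat.mul_le_mul_right 2 (min_le_right _ _)
            _ = n * 2 ^ (n + 1) := by ring
            _ ≤ (n + 1) * 2 ^ (n + 1) := Nat.mul_le_mul_right _ n.le_succ
      have key' : ((min ⌊g s * 2 ^ n⌋₊ (n * 2 ^ n) : ℕ) : ℝ) * 2 ≤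
          (min ⌊g s * 2 ^ (n + 1)⌋₊ ((n + 1) * 2 ^ (n + 1)) : ℕ) := by exact_mod_cast key
      have hpow : (0 : ℝ) < 2 ^ n := by positivity
      calc _ = ((min ⌊g s * 2 ^ n⌋₊ (n * 2 ^ n) : ℕ) : ℝ) * 2 * 2 ^ n := by ring
        _ ≤ _ := mul_le_mul_of_nonneg_right key' hpow.le
    · rw [dyadicRep_toFun_of_notMem hg hs]
      exact SimpleRep.toFun_nonneg _ _
  · have hmem : ∀ᶠ n in atTop, s ∈ spanningSets m n := by
      have hs : s ∈ ⋃ n, spanningSets m n := by rw [iUnion_spanningSets]; trivial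
      obtain ⟨n₀, hn₀⟩ := Set.mem_iUnion.1 hs
      filter_upwards [eventually_ge_atTop n₀] with n hn
      exact monotone_spanningSets m hn hn₀
    have hpow : Tendsto (fun n : ℕ => (2 : ℝ) ^ n) atTop atTop :=
      tendsto_pow_atTop_atTop_of_one_lt (by norm_num)
    refine ((tendsto_nat_floor_mul_div_atTop (hg0 s)).comp hpow).congr' ?_
    filter_upwards [hmem, eventually_ge_atTop ⌈g s⌉₊] with n hn hgn
    rw [dyadicRep_toFun_of_mem hg hn, min_eq_left]
    · rfl
    · refine Nat.floor_le_of_le ?_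
      push_cast
      exact mul_le_mul_of_nonneg_right ((Nat.le_ceil _).trans (Nat.cast_le.2 hgn)) (by positivity)

theorem IncreasesTo.toFun_le {r : ℕ → SimpleRep m} {g : E → ℝ} (h : IncreasesTo r g) (n : ℕ)
    (s : E) : (r n).toFun s ≤ g s :=
  (monotone_nat_of_le_succ (f := fun n => (r n).toFun s) (fun n => h.1 n s)).ge_of_tendsto (h.2 s) n

theorem SimpleRep.integrable_rpow (r : SimpleRep m) {α : ℝ} (hα : 0 < α) :
    Integrable (fun s => |r.toFun s| ^ α) m :=
  (SimpleRep.integral_meet r r (φ := fun x _ => |x| ^ α) (by simp [Real.zero_rpow hα.ne'])).1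

theorem IncreasesTo.tendsto_rpow {r : ℕ → SimpleRep m} {g : E → ℝ} (h : IncreasesTo r g) {α : ℝ}
    (hα : 0 < α) (s : E) : Tendsto (fun n => |(r n).toFun s| ^ α) atTop (𝓝 (|g s| ^ α)) :=
  ((h.2 s).abs).rpow_const (Or.inr hα.le)

theorem IncreasesTo.rpow_le {r : ℕ → SimpleRep m} {g : E → ℝ} (h : IncreasesTo r g) {α : ℝ}
    (hα : 0 < α) (n : ℕ) (s : E) : |(r n).toFun s| ^ α ≤ |g s| ^ α := by
  refine Real.rpow_le_rpow (abs_nonneg _) ?_ hα.le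
  rw [abs_of_nonneg ((r n).toFun_nonneg s)]
  exact (h.toFun_le n s).trans (le_abs_self _)

theorem IncreasesTo.tendsto_integral_rpow {r : ℕ → SimpleRep m} {g : E → ℝ} (h : IncreasesTo r g)
    {α : ℝ} (hα : 0 < α) (hg : MemLPlus α m g) :
    Tendsto (fun n => ∫ s, |(r n).toFun s| ^ α ∂m) atTop (𝓝 (∫ s, |g s| ^ α ∂m)) :=
  tendsto_integral_of_dominated_convergence (fun s => |g s| ^ α)
    (fun n => ((r n).integrable_rpow hα).aestronglyMeasurable) (hg.integrable_rpow hα)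
    (fun n => ae_of_all _ fun s => by
      rw [Real.norm_of_nonneg (Real.rpow_nonneg (abs_nonneg _) _)]
      exact h.rpow_le hα n s)
    (ae_of_all _ fun s => h.tendsto_rpow hα s)

theorem IncreasesTo.tendsto_integral_abs_sub {r : ℕ → SimpleRep m} {g : E → ℝ}
    (h : IncreasesTo r g) {α : ℝ} (hα : 0 < α) (hg : MemLPlus α m g) :
    Tendsto (fun n => ∫ s, |(|(r n).toFun s| ^ α - |g s| ^ α)| ∂m) atTop (𝓝 0) := by
  have key := (tendsto_const_nhds (x := ∫ s, |g s| ^ α ∂m)).sub (h.tendsto_integral_rpow hα hg)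
  rw [sub_self] at key
  refine key.congr fun n => ?_
  rw [← integral_sub (hg.integrable_rpow hα) ((r n).integrable_rpow hα)]
  refine integral_congr_ae (ae_of_all _ fun s => ?_)
  beta_reduce
  rw [abs_sub_comm, abs_of_nonneg (sub_nonneg.2 (h.rpow_le hα n s))]

end Approximation

/-! ### The extremal integral -/

section ExtremalIntegral

variable {Ω E : Type*} [MeasurableSpace Ω] [MeasurableSpace E] {P : Measure Ω} {m : Measure E}
  {d : ℕ} {f : EuclideanSpace ℝ (Fin d) → ℝ} {α : ℝ} {κ : Measure (levelOne f)}
  {M : Set E → Ω → EuclideanSpace ℝ (Fin d)}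

/-- Serves twice: with `r' = r` it is the Cauchy property that gives existence, and with different
sequences it shows that the limit does not depend on the approximation or its representations. -/
theorem exists_forall_measure_dist_integral_le [IsProbabilityMeasure P] [IsProbabilityMeasure κ]
    (hM : IsFrechetSupMeasure P m f α κ M) (hf : IsLossFunction f) (hα : 0 < α) {g : E → ℝ}
    (hg : MemLPlus α m g) {r r' : ℕ → SimpleRep m} (hr : IncreasesTo r g) (hr' : IncreasesTo r' g)
    (ε : ℝ) (hε : 0 < ε) :
    ∃ N, ∀ n ≥ N, ∀ k ≥ N,
      P {ω | ε ≤ dist ((r n).integral f M ω) ((r' k).integral f M ω)} ≤ ENNReal.ofReal ε := by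
  have hJ : 0 ≤ ∫ s, |g s| ^ α ∂m := integral_nonneg fun s => Real.rpow_nonneg (abs_nonneg _) _
  obtain ⟨δ, hδ, key⟩ := SimpleRep.exists_measure_dist_integral_le hM hf hα hε
    (by linarith : 0 < ∫ s, |g s| ^ α ∂m + 1)
  have e1 := (hr.tendsto_integral_abs_sub hα hg).eventually_le_const (by positivity : 0 < δ / 2)
  have e2 := (hr'.tendsto_integral_abs_sub hα hg).eventually_le_const (by positivity : 0 < δ / 2)
  obtain ⟨N, hN⟩ := eventually_atTop.1 (e1.and e2)
  refine ⟨N, fun n hn k hk => key _ _ ?_ ?_⟩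
  · have := integral_mono ((r n).integrable_rpow hα) (hg.integrable_rpow hα)
      fun s => hr.rpow_le hα n s
    linarith
  · have i1 := (((r n).integrable_rpow hα).sub (hg.integrable_rpow hα)).abs
    have i2 := (((r' k).integrable_rpow hα).sub (hg.integrable_rpow hα)).abs
    have i3 := (((r n).integrable_rpow hα).sub ((r' k).integrable_rpow hα)).abs
    have h1 := (hN n hn).1
    have h2 := (hN k hk).2
    refine (integral_mono i3 (i1.add i2) fun s => ?_).trans ?_
    · simp only [Pi.add_apply, Pi.sub_apply]
      rw [abs_sub_comm (|(r' k).toFun s| ^ α)]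
      exact abs_sub_le _ _ _
    · rw [integral_add' i1 i2]
      simp only [Pi.sub_apply]
      linarith

variable [IsProbabilityMeasure P] [IsProbabilityMeasure κ] [SigmaFinite m]

theorem isExtremalIntegral_extremalIntegral (hM : IsFrechetSupMeasure P m f α κ M)
    (hf : IsLossFunction f) (hα : 0 < α) {g : E → ℝ} (hg : MemLPlus α m g) :
    IsExtremalIntegral P m f M g (extremalIntegral P m f M g) := by
  have hr := dyadicRep_increasesTo (m := m) hg.measurable hg.nonneg
  obtain ⟨X, hX, hlim⟩ := exists_tendstoInMeasure_of_cauchy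
    (fun n => (dyadicRep m hg.measurable n).measurable_integral hM hf)
    (exists_forall_measure_dist_integral_le hM hf hα hg hr hr)
  have hex : ∃ X, IsExtremalIntegral P m f M g X := ⟨X, hX, _, hr, hlim⟩
  unfold extremalIntegral
  rw [dif_pos hex]
  exact hex.choose_spec

theorem measurable_extremalIntegral (hM : IsFrechetSupMeasure P m f α κ M)
    (hf : IsLossFunction f) (hα : 0 < α) {g : E → ℝ} (hg : MemLPlus α m g) :
    Measurable (extremalIntegral P m f M g) :=
  (isExtremalIntegral_extremalIntegral hM hf hα hg).1

/-- Every increasing approximation by simple functions yields the extremal integral. -/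
theorem IncreasesTo.tendsto_extremalIntegral (hM : IsFrechetSupMeasure P m f α κ M)
    (hf : IsLossFunction f) (hα : 0 < α) {g : E → ℝ} (hg : MemLPlus α m g) {r : ℕ → SimpleRep m}
    (hr : IncreasesTo r g) :
    TendstoInMeasure P (fun n => (r n).integral f M) atTop (extremalIntegral P m f M g) := by
  obtain ⟨-, r', hr', hlim⟩ := isExtremalIntegral_extremalIntegral hM hf hα hg
  exact tendstoInMeasure_of_dist (exists_forall_measure_dist_integral_le hM hf hα hg hr hr')
    tendsto_id hlim

theorem isImplicitFrechet_extremalIntegral (hM : IsFrechetSupMeasure P m f α κ M)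
    (hf : IsLossFunction f) (hα : 0 < α) {g : E → ℝ} (hg : MemLPlus α m g) :
    IsImplicitFrechet P f α κ (alphaNorm α m g) (extremalIntegral P m f M g) := by
  have hr := dyadicRep_increasesTo (m := m) hg.measurable hg.nonneg
  exact IsImplicitFrechet.of_tendstoInMeasure
    ((hr.tendsto_integral_rpow hα hg).rpow_const (Or.inr (by positivity)))
    (fun n => (dyadicRep m hg.measurable n).measurable_integral hM hf)
    (measurable_extremalIntegral hM hf hα hg)
    (fun n => (dyadicRep m hg.measurable n).isImplicitFrechet_integral hM hf hα)
    (hr.tendsto_extremalIntegral hM hf hα hg)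

end ExtremalIntegral

/-! ### Operations on representations -/

namespace SimpleRep

variable {Ω E : Type*} [MeasurableSpace Ω] [MeasurableSpace E] {P : Measure Ω} {m : Measure E}
  {d : ℕ} {f : EuclideanSpace ℝ (Fin d) → ℝ} {α : ℝ} {κ : Measure (levelOne f)}
  {M : Set E → Ω → EuclideanSpace ℝ (Fin d)}

/-- Multiplication of a simple function by a nonnegative constant. -/
def scale (r : SimpleRep m) (a : ℝ) (ha : 0 ≤ a) : SimpleRep m where
  k := r.k
  coef j := a * r.coef j
  sets := r.sets
  coef_nonneg j hj := mul_nonneg ha (r.coef_nonneg j hj)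
  sets_measurable := r.sets_measurable
  sets_finite := r.sets_finite
  sets_disjoint := r.sets_disjoint

theorem scale_toFun (r : SimpleRep m) (a : ℝ) (ha : 0 ≤ a) (s : E) :
    (r.scale a ha).toFun s = a * r.toFun s := by
  unfold toFun
  rw [Finset.mul_sum]
  exact Finset.sum_congr rfl fun j _ => mul_assoc _ _ _

theorem scale_integral {Ω : Type*} {M : Set E → Ω → EuclideanSpace ℝ (Fin d)} (r : SimpleRep m)
    (a : ℝ) (ha : 0 ≤ a) (hf : IsLossFunction f) (ω : Ω) :
    (r.scale a ha).integral f M ω = a • r.integral f M ω := by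
  unfold integral
  rw [← hf.fVeeUpTo_smul ha]
  exact fVeeUpTo_congr fun j _ => mul_smul _ _ _

/-- Restriction of a simple function to a set. -/
def restrict (r : SimpleRep m) (B : Set E) (hB : MeasurableSet B) : SimpleRep m where
  k := r.k
  coef := r.coef
  sets j := r.sets j ∩ B
  coef_nonneg := r.coef_nonneg
  sets_measurable j hj := (r.sets_measurable j hj).inter hB
  sets_finite j hj := (measure_mono Set.inter_subset_left).trans_lt (r.sets_finite j hj)
  sets_disjoint i hi j hj hij := (r.sets_disjoint i hi j hj hij).mono Set.inter_subset_left
    Set.inter_subset_left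

theorem restrict_toFun (r : SimpleRep m) (B : Set E) (hB : MeasurableSet B) (s : E) :
    (r.restrict B hB).toFun s = B.indicator r.toFun s := by
  by_cases h : ∃ j ≤ r.k, s ∈ r.sets j
  · obtain ⟨j, hj, hs⟩ := h
    by_cases hsB : s ∈ B
    · rw [(r.restrict B hB).toFun_of_mem (j := j) hj ⟨hs, hsB⟩, Set.indicator_of_mem hsB,
        r.toFun_of_mem hj hs]
      rfl
    · rw [(r.restrict B hB).toFun_of_notMem fun j _ h => hsB h.2, Set.indicator_of_notMem hsB]
  · push Not at h
    rw [(r.restrict B hB).toFun_of_notMem fun j hj h' => h j hj h'.1]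
    by_cases hsB : s ∈ B
    · rw [Set.indicator_of_mem hsB, r.toFun_of_notMem h]
    · rw [Set.indicator_of_notMem hsB]

theorem indepFun_restrict (r : SimpleRep m) {B : Set E} (hB : MeasurableSet B)
    (hM : IsFrechetSupMeasure P m f α κ M) (hf : IsLossFunction f) :
    IndepFun ((r.restrict B hB).integral f M) ((r.restrict Bᶜ hB.compl).integral f M) P :=
  indepFun_integral _ _ hM hf fun _ _ _ _ =>
    disjoint_compl_right.mono Set.inter_subset_right Set.inter_subset_right

/-- Both sides maximise `f` over the same weighted pieces `r.sets j ∩ B` and `r.sets j ∩ Bᶜ`, and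
absence of ties makes the maximiser unique. -/
theorem integral_eq_fVee_restrict [IsProbabilityMeasure P] [IsProbabilityMeasure κ]
    (r : SimpleRep m) {B : Set E} (hB : MeasurableSet B) (hM : IsFrechetSupMeasure P m f α κ M)
    (hf : IsLossFunction f) (hα : 0 < α) :
    ∀ᵐ ω ∂P, r.integral f M ω = fVee f ((r.restrict B hB).integral f M ω)
      ((r.restrict Bᶜ hB.compl).integral f M ω) := by
  let side : Bool → Set E := fun b => if b then B else Bᶜ
  have hside : ∀ b, MeasurableSet (side b) := by
    rintro (_ | _)
    · exact hB.compl
    · exact hB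
  have hsided : ∀ b b', b ≠ b' → Disjoint (side b) (side b') := by
    rintro (_ | _) (_ | _) h
    · exact absurd rfl h
    · exact disjoint_compl_left
    · exact disjoint_compl_right
    · exact absurd rfl h
  have hk : ∀ j : Fin (r.k + 1), (j : ℕ) ≤ r.k := fun j => Nat.lt_succ_iff.1 j.2
  let A : Fin (r.k + 1) × Bool → Set E := fun p => r.sets p.1 ∩ side p.2
  have hA : ∀ p, MeasurableSet (A p) := fun p =>
    (r.sets_measurable _ (hk p.1)).inter (hside p.2)
  have hA' : ∀ p, m (A p) < ⊤ := fun p =>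
    (measure_mono Set.inter_subset_left).trans_lt (r.sets_finite _ (hk p.1))
  have hd : Pairwise fun p q => Disjoint (A p) (A q) := fun p q hpq => by
    by_cases h : p.1 = q.1
    · exact (hsided _ _ fun h' => hpq (Prod.ext h h')).mono Set.inter_subset_right
        Set.inter_subset_right
    · exact (r.sets_disjoint _ (hk _) _ (hk _) fun h' => h (Fin.ext h')).mono
        Set.inter_subset_left Set.inter_subset_left
  have hU : ∀ j : Fin (r.k + 1), ⋃ b, A (j, b) = r.sets j := fun j => by
    ext s
    simp only [A, Set.mem_iUnion, Set.mem_inter_iff, Bool.exists_bool, side]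
    by_cases hs : s ∈ B <;> simp [hs]
  have hmax : ∀ j : Fin (r.k + 1), ∀ᵐ ω ∂P,
      IsFMax f (fun b => M (A (j, b)) ω) (M (r.sets j) ω) := fun j => by
    have := hM.isFMax_iUnion hf hα (A := fun b => A (j, b)) (fun b => hA _) (fun b => hA' _)
      fun b b' hb => hd fun h => hb (Prod.mk.inj h).2
    rwa [hU] at this
  have hties := hM.ae_no_ties hf hα hA hA' hd (c := fun p => r.coef p.1)
    fun p => r.coef_nonneg _ (hk p.1)
  filter_upwards [ae_all_iff.2 hmax, hties] with ω h1 h2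
  have m0 : IsFMax f (fun j : Fin (r.k + 1) => r.coef j • M (r.sets j) ω) (r.integral f M ω) :=
    isFMax_fVeeUpTo (fun j => r.coef j • M (r.sets j) ω) r.k
  have m1 : IsFMax f (fun j : Fin (r.k + 1) => r.coef j • M (A (j, true)) ω)
      ((r.restrict B hB).integral f M ω) :=
    isFMax_fVeeUpTo (fun j => r.coef j • M (r.sets j ∩ B) ω) r.k
  have m2 : IsFMax f (fun j : Fin (r.k + 1) => r.coef j • M (A (j, false)) ω)
      ((r.restrict Bᶜ hB.compl).integral f M ω) :=
    isFMax_fVeeUpTo (fun j => r.coef j • M (r.sets j ∩ Bᶜ) ω) r.k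
  refine IsFMax.eq (v := fun p : Fin (r.k + 1) × Bool => r.coef p.1 • M (A p) ω) hf
    ⟨?_, ?_⟩ ⟨?_, ?_⟩ h2
  · obtain ⟨j, hj⟩ := m0.1
    obtain ⟨b, hb⟩ := (h1 j).1
    exact ⟨(j, b), hj.trans (congrArg (r.coef j • ·) hb)⟩
  · rintro ⟨j, b⟩
    refine le_trans ?_ (m0.2 j)
    have hc := r.coef_nonneg _ (hk j)
    beta_reduce
    rw [hf.homogeneous _ hc, hf.homogeneous _ hc]
    exact mul_le_mul_of_nonneg_left ((h1 j).2 b) hc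
  · rcases fVee_eq_or (f := f) ((r.restrict B hB).integral f M ω)
      ((r.restrict Bᶜ hB.compl).integral f M ω) with h | h
    · obtain ⟨j, hj⟩ := m1.1
      exact ⟨(j, true), h.trans hj⟩
    · obtain ⟨j, hj⟩ := m2.1
      exact ⟨(j, false), h.trans hj⟩
  · rintro ⟨j, _ | _⟩
    · rw [map_fVee (f := f)]
      exact (m2.2 j).trans (le_max_right _ _)
    · rw [map_fVee (f := f)]
      exact (m1.2 j).trans (le_max_left _ _)

end SimpleRep

section Increasing

variable {E : Type*} [MeasurableSpace E] {m : Measure E} {r : ℕ → SimpleRep m} {g : E → ℝ}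

theorem IncreasesTo.scale (h : IncreasesTo r g) {a : ℝ} (ha : 0 ≤ a) :
    IncreasesTo (fun n => (r n).scale a ha) fun s => a * g s := by
  refine ⟨fun n s => ?_, fun s => ?_⟩
  · rw [SimpleRep.scale_toFun, SimpleRep.scale_toFun]
    exact mul_le_mul_of_nonneg_left (h.1 n s) ha
  · simp only [SimpleRep.scale_toFun]
    exact (h.2 s).const_mul a

theorem IncreasesTo.restrict (h : IncreasesTo r g) {B : Set E} (hB : MeasurableSet B) :
    IncreasesTo (fun n => (r n).restrict B hB) (B.indicator g) := by
  refine ⟨fun n s => ?_, fun s => ?_⟩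
  · rw [SimpleRep.restrict_toFun, SimpleRep.restrict_toFun]
    exact Set.indicator_le_indicator (h.1 n s)
  · simp only [SimpleRep.restrict_toFun]
    by_cases hs : s ∈ B
    · simpa only [Set.indicator_of_mem hs] using h.2 s
    · simp only [Set.indicator_of_notMem hs]
      exact tendsto_const_nhds

end Increasing

/-! ### Properties of the extremal integral -/

section Properties

variable {Ω E : Type*} [MeasurableSpace Ω] [MeasurableSpace E] {P : Measure Ω} {m : Measure E}
  {d : ℕ} {f : EuclideanSpace ℝ (Fin d) → ℝ} {α : ℝ} {κ : Measure (levelOne f)}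
  {M : Set E → Ω → EuclideanSpace ℝ (Fin d)} {g h u : E → ℝ}

theorem integral_rpow_indicator_add_compl (hα : 0 < α) (hu : MemLPlus α m u) {B : Set E}
    (hB : MeasurableSet B) :
    ∫ s, |B.indicator u s| ^ α ∂m + ∫ s, |Bᶜ.indicator u s| ^ α ∂m = ∫ s, |u s| ^ α ∂m := by
  have key : ∀ C : Set E, MeasurableSet C →
      ∫ s, |C.indicator u s| ^ α ∂m = ∫ s in C, |u s| ^ α ∂m := fun C hC => by
    rw [← integral_indicator hC]
    refine integral_congr_ae (ae_of_all _ fun s => ?_)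
    by_cases hs : s ∈ C
    · simp [hs]
    · simp [hs, Real.zero_rpow hα.ne']
  rw [key B hB, key _ hB.compl, integral_add_compl hB (hu.integrable_rpow hα)]

theorem integral_rpow_nonneg (g : E → ℝ) : 0 ≤ ∫ s, |g s| ^ α ∂m :=
  integral_nonneg fun _ => Real.rpow_nonneg (abs_nonneg _) _

theorem fVee_zero_left (hf : IsLossFunction f) (y : EuclideanSpace ℝ (Fin d)) :
    fVee f 0 y = y := by
  rcases (hf.nonneg y).eq_or_lt with h | h
  · rw [(hf.eq_zero_iff y).1 h.symm]
    exact fVee_of_le le_rfl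
  · exact fVee_of_lt (by rwa [hf.map_zero])

variable [IsProbabilityMeasure P] [IsProbabilityMeasure κ] [SigmaFinite m]

theorem hasFrechetTail_extremalIntegral (hM : IsFrechetSupMeasure P m f α κ M)
    (hf : IsLossFunction f) (hα : 0 < α) (hg : MemLPlus α m g) :
    HasFrechetTail P α (∫ s, |g s| ^ α ∂m) fun ω => f (extremalIntegral P m f M g ω) := by
  have hJ := integral_rpow_nonneg (α := α) (m := m) g
  have := (isImplicitFrechet_extremalIntegral hM hf hα hg).hasFrechetTail hf hα
    (Real.rpow_nonneg hJ _)
  rwa [← Real.rpow_mul hJ, one_div, inv_mul_cancel₀ hα.ne', Real.rpow_one] at this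

theorem measurable_map_extremalIntegral (hM : IsFrechetSupMeasure P m f α κ M)
    (hf : IsLossFunction f) (hα : 0 < α) (hg : MemLPlus α m g) :
    Measurable fun ω => f (extremalIntegral P m f M g ω) :=
  hf.measurable.comp (measurable_extremalIntegral hM hf hα hg)

theorem extremalIntegral_eq_zero (hM : IsFrechetSupMeasure P m f α κ M)
    (hf : IsLossFunction f) (hα : 0 < α) (hg : MemLPlus α m g) (h0 : ∫ s, |g s| ^ α ∂m = 0) :
    ∀ᵐ ω ∂P, extremalIntegral P m f M g ω = 0 := by
  have h1 := hasFrechetTail_extremalIntegral hM hf hα hg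
  rw [h0] at h1
  filter_upwards [h1.ae_nonpos (measurable_map_extremalIntegral hM hf hα hg)] with ω hω
  exact hf.eq_zero_of_nonpos hω

theorem extremalIntegral_const_mul (hM : IsFrechetSupMeasure P m f α κ M)
    (hf : IsLossFunction f) (hα : 0 < α) (hg : MemLPlus α m g) {a : ℝ} (ha : 0 ≤ a) :
    ∀ᵐ ω ∂P, extremalIntegral P m f M (fun s => a * g s) ω = a • extremalIntegral P m f M g ω := by
  have hr := dyadicRep_increasesTo (m := m) hg.measurable hg.nonneg
  obtain ⟨ns, hns, h1⟩ := (hr.tendsto_extremalIntegral hM hf hα hg).exists_seq_tendsto_ae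
  obtain ⟨ms, hms, h2⟩ := (((hr.scale ha).tendsto_extremalIntegral hM hf hα
    (hg.const_mul ha)).comp hns.tendsto_atTop).exists_seq_tendsto_ae
  filter_upwards [h1, h2] with ω h1 h2
  refine tendsto_nhds_unique h2 ?_
  simp only [Function.comp_apply, SimpleRep.scale_integral _ _ _ hf]
  exact (h1.comp hms.tendsto_atTop).const_smul a

/-- Only this weak form survives the limit: strict inequalities between values of `f` may become
equalities between different vectors. -/
theorem map_extremalIntegral_mono (hM : IsFrechetSupMeasure P m f α κ M)
    (hf : IsLossFunction f) (hα : 0 < α) (hg : MemLPlus α m g) (hh : MemLPlus α m h)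
    (hgh : ∀ s, g s ≤ h s) :
    ∀ᵐ ω ∂P, f (extremalIntegral P m f M g ω) ≤ f (extremalIntegral P m f M h ω) := by
  have hr := dyadicRep_increasesTo (m := m) hg.measurable hg.nonneg
  have hr' := dyadicRep_increasesTo (m := m) hh.measurable hh.nonneg
  obtain ⟨ns, hns, h1⟩ := (hr.tendsto_extremalIntegral hM hf hα hg).exists_seq_tendsto_ae
  obtain ⟨ms, hms, h2⟩ := ((hr'.tendsto_extremalIntegral hM hf hα hh).comp
    hns.tendsto_atTop).exists_seq_tendsto_ae
  have h3 : ∀ n, ∀ᵐ ω ∂P, f ((dyadicRep m hg.measurable n).integral f M ω) ≤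
      f ((dyadicRep m hh.measurable n).integral f M ω) := fun n =>
    SimpleRep.map_integral_mono _ _ hM hf hα (dyadicRep_mono hg.measurable hh.measurable hgh n)
  filter_upwards [h1, h2, ae_all_iff.2 h3] with ω h1 h2 h3
  exact le_of_tendsto_of_tendsto' ((hf.continuous.tendsto _).comp (h1.comp hms.tendsto_atTop))
    ((hf.continuous.tendsto _).comp h2) fun n => h3 _

theorem indepFun_extremalIntegral_indicator (hM : IsFrechetSupMeasure P m f α κ M)
    (hf : IsLossFunction f) (hα : 0 < α) (hu : MemLPlus α m u) {B : Set E}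
    (hB : MeasurableSet B) :
    IndepFun (extremalIntegral P m f M (B.indicator u)) (extremalIntegral P m f M (Bᶜ.indicator u))
      P := by
  have hr := dyadicRep_increasesTo (m := m) hu.measurable hu.nonneg
  exact indepFun_of_tendstoInMeasure (fun n => SimpleRep.measurable_integral _ hM hf)
    (fun n => SimpleRep.measurable_integral _ hM hf)
    (measurable_extremalIntegral hM hf hα (hu.indicator hB))
    (measurable_extremalIntegral hM hf hα (hu.indicator hB.compl))
    (fun n => (dyadicRep m hu.measurable n).indepFun_restrict hB hM hf)
    ((hr.restrict hB).tendsto_extremalIntegral hM hf hα (hu.indicator hB))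
    ((hr.restrict hB.compl).tendsto_extremalIntegral hM hf hα (hu.indicator hB.compl))

theorem map_extremalIntegral_indicator_ne (hM : IsFrechetSupMeasure P m f α κ M)
    (hf : IsLossFunction f) (hα : 0 < α) (hu : MemLPlus α m u) {B : Set E}
    (hB : MeasurableSet B) :
    ∀ᵐ ω ∂P, f (extremalIntegral P m f M (B.indicator u) ω) =
      f (extremalIntegral P m f M (Bᶜ.indicator u) ω) →
        f (extremalIntegral P m f M (B.indicator u) ω) = 0 :=
  HasFrechetTail.ae_eq_imp_eq_zero hα
    (measurable_map_extremalIntegral hM hf hα (hu.indicator hB))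
    (measurable_map_extremalIntegral hM hf hα (hu.indicator hB.compl))
    ((indepFun_extremalIntegral_indicator hM hf hα hu hB).comp hf.measurable hf.measurable)
    (integral_rpow_nonneg _) (integral_rpow_nonneg _)
    (hasFrechetTail_extremalIntegral hM hf hα (hu.indicator hB))
    (hasFrechetTail_extremalIntegral hM hf hα (hu.indicator hB.compl))
    (fun _ => hf.nonneg _) (fun _ => hf.nonneg _)

/-- The integral is the `∨_f`-maximum of the integrals over a set and its complement. -/
theorem extremalIntegral_eq_fVee_indicator (hM : IsFrechetSupMeasure P m f α κ M)
    (hf : IsLossFunction f) (hα : 0 < α) (hu : MemLPlus α m u) {B : Set E}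
    (hB : MeasurableSet B) :
    ∀ᵐ ω ∂P, extremalIntegral P m f M u ω = fVee f (extremalIntegral P m f M (B.indicator u) ω)
      (extremalIntegral P m f M (Bᶜ.indicator u) ω) := by
  have hr := dyadicRep_increasesTo (m := m) hu.measurable hu.nonneg
  obtain ⟨ns, hns, h1⟩ := (hr.tendsto_extremalIntegral hM hf hα hu).exists_seq_tendsto_ae
  obtain ⟨ms, hms, h2⟩ := (((hr.restrict hB).tendsto_extremalIntegral hM hf hα
    (hu.indicator hB)).comp hns.tendsto_atTop).exists_seq_tendsto_ae
  obtain ⟨ls, hls, h3⟩ := (((hr.restrict hB.compl).tendsto_extremalIntegral hM hf hα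
    (hu.indicator hB.compl)).comp (hns.comp hms).tendsto_atTop).exists_seq_tendsto_ae
  have h4 : ∀ n, ∀ᵐ ω ∂P, (dyadicRep m hu.measurable n).integral f M ω =
      fVee f (((dyadicRep m hu.measurable n).restrict B hB).integral f M ω)
        (((dyadicRep m hu.measurable n).restrict Bᶜ hB.compl).integral f M ω) := fun n =>
    SimpleRep.integral_eq_fVee_restrict _ hB hM hf hα
  filter_upwards [h1, h2, h3, ae_all_iff.2 h4,
    map_extremalIntegral_indicator_ne hM hf hα hu hB] with ω h1 h2 h3 h4 h5
  refine tendsto_nhds_unique (h1.comp (hms.comp hls).tendsto_atTop) ?_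
  -- `∨_f` may be discontinuous at ties; the two limits are independent, so a tie has probability
  -- zero unless both are `0`.
  refine (tendsto_fVee hf (h2.comp hls.tendsto_atTop) h3 fun he => ?_).congr fun n => (h4 _).symm
  exact ((hf.eq_zero_iff _).1 (h5 he)).trans ((hf.eq_zero_iff _).1 (he.symm.trans (h5 he))).symm

/-- Changing the integrand on a null set does not change the integral. -/
theorem extremalIntegral_ae_eq_indicator_compl (hM : IsFrechetSupMeasure P m f α κ M)
    (hf : IsLossFunction f) (hα : 0 < α) (hu : MemLPlus α m u) {N : Set E}
    (hN : MeasurableSet N) (hN0 : m N = 0) :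
    ∀ᵐ ω ∂P, extremalIntegral P m f M u ω = extremalIntegral P m f M (Nᶜ.indicator u) ω := by
  have h0 : ∫ s, |N.indicator u s| ^ α ∂m = 0 := by
    rw [integral_congr_ae (g := fun _ => (0 : ℝ)), integral_zero]
    filter_upwards [measure_eq_zero_iff_ae_notMem.1 hN0] with s hs
    rw [Set.indicator_of_notMem hs, abs_zero, Real.zero_rpow hα.ne']
  filter_upwards [extremalIntegral_eq_fVee_indicator hM hf hα hu hN,
    extremalIntegral_eq_zero hM hf hα (hu.indicator hN) h0] with ω h1 h2
  rw [h1, h2, fVee_zero_left hf]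

end Properties

/-! ### Monotonicity and max-linearity -/

section Monotone

variable {d : ℕ} {f : EuclideanSpace ℝ (Fin d) → ℝ}

/-- If `y` beats the common vector `x`, then `f y > 0` and the factor `c < 1` makes the inequality
strict; otherwise both maxima equal `x`, a tie being resolved in favour of the first argument. -/
theorem fLe_fVee_fVee_of_gap (hf : IsLossFunction f) {x y y' : EuclideanSpace ℝ (Fin d)} {c : ℝ}
    (hc1 : c < 1) (hy : f y' ≤ c * f y) :
    fLe f (fVee f x y') (fVee f x y) := by
  have hy0 := hf.nonneg y
  have hle : f y' ≤ f y := by nlinarith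
  rcases lt_trichotomy (f x) (f y) with h | h | h
  · refine Or.inl ?_
    rw [map_fVee (f := f), map_fVee (f := f), max_eq_right h.le, max_lt_iff]
    have := hf.nonneg x
    exact ⟨h, by nlinarith⟩
  · refine Or.inr ?_
    rw [fVee_of_le h.ge, fVee_of_le (hle.trans h.ge)]
  · refine Or.inr ?_
    rw [fVee_of_le h.le, fVee_of_le (hle.trans h.le)]

theorem fLe_fVee_fVee_of_lt {x x' y y' : EuclideanSpace ℝ (Fin d)} (hx : f x' ≤ f x)
    (hy : fLe f y' y) (hxy : f x < f y) : fLe f (fVee f x' y') (fVee f x y) := by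
  rw [fVee_of_lt hxy]
  rcases fVee_eq_or (f := f) x' y' with h | h <;> rw [h]
  · exact Or.inl (hx.trans_lt hxy)
  · exact hy

/-- The algebra of max-linearity: the primed vectors are the parts of the integrals where the
integrand is the smaller one. Comparison in `f` alone would not suffice, since a different `y'` with
`f y' = f y` could displace `y`. -/
theorem fVee_fVee_eq (hf : IsLossFunction f) {x x' y y' : EuclideanSpace ℝ (Fin d)}
    (hx : fLe f x' x) (hy : fLe f y' y) (hxy : f x = f y → f x = 0) :
    fVee f x y = fVee f (fVee f x y') (fVee f x' y) := by
  rcases lt_trichotomy (f x) (f y) with h | h | h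
  · rw [fVee_of_lt h, fVee_of_lt (hx.map_le.trans_lt h)]
    rcases fVee_eq_or (f := f) x y' with h' | h' <;> rw [h']
    · exact (fVee_of_lt h).symm
    · rcases hy with hy | hy
      · exact (fVee_of_lt hy).symm
      · rw [hy, fVee_of_le le_rfl]
  · have hx0 := hxy h
    have hy0 : f y = 0 := h.symm.trans hx0
    rw [hf.eq_zero_of_nonpos hx0.le, hf.eq_zero_of_nonpos hy0.le,
      hf.eq_zero_of_nonpos (hx.map_le.trans hx0.le), hf.eq_zero_of_nonpos (hy.map_le.trans hy0.le)]
    simp only [fVee_zero_left hf]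
  · rw [fVee_of_le h.le, fVee_of_le (hy.map_le.trans h.le)]
    rcases fVee_eq_or (f := f) x' y with h' | h' <;> rw [h']
    · exact (fVee_of_le hx.map_le).symm
    · exact (fVee_of_le h.le).symm

end Monotone

section Integral

variable {Ω E : Type*} [MeasurableSpace Ω] [MeasurableSpace E] {P : Measure Ω} {m : Measure E}
  {d : ℕ} {f : EuclideanSpace ℝ (Fin d) → ℝ} {α : ℝ} {κ : Measure (levelOne f)}
  {M : Set E → Ω → EuclideanSpace ℝ (Fin d)} {g h : E → ℝ}
  [IsProbabilityMeasure P] [IsProbabilityMeasure κ] [SigmaFinite m]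

/-- On `{g = h}` the integrals share the same vector. Elsewhere homogeneity turns the weak
monotonicity of `f (I ·)`, applied to `g ≤ c * h`, into a genuine factor `c`. -/
theorem fLe_extremalIntegral_of_gap (hM : IsFrechetSupMeasure P m f α κ M)
    (hf : IsLossFunction f) (hα : 0 < α) (hg : MemLPlus α m g) (hh : MemLPlus α m h) {c : ℝ}
    (hc : 0 ≤ c) (hc1 : c < 1) (hgh : ∀ s, g s = h s ∨ g s ≤ c * h s) :
    ∀ᵐ ω ∂P, fLe f (extremalIntegral P m f M g ω) (extremalIntegral P m f M h ω) := by
  have hB : MeasurableSet {s | g s = h s} := measurableSet_eq_fun hg.measurable hh.measurable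
  set B := {s | g s = h s} with hBdef
  have e1 : B.indicator g = B.indicator h := Set.indicator_congr fun s hs => hs
  have hle : ∀ s, Bᶜ.indicator g s ≤ c * Bᶜ.indicator h s := fun s => by
    by_cases hs : s ∈ B
    · simp [hs]
    · have hs' : s ∈ Bᶜ := hs
      rw [Set.indicator_of_mem hs', Set.indicator_of_mem hs']
      exact (hgh s).resolve_left hs
  have hhB := hh.indicator hB.compl
  filter_upwards [extremalIntegral_eq_fVee_indicator hM hf hα hg hB,
    extremalIntegral_eq_fVee_indicator hM hf hα hh hB,
    map_extremalIntegral_mono hM hf hα (hg.indicator hB.compl) (hhB.const_mul hc) hle,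
    extremalIntegral_const_mul hM hf hα hhB hc] with ω h1 h2 h4 h5
  rw [h5, hf.homogeneous c hc] at h4
  rw [h1, h2, e1]
  exact fLe_fVee_fVee_of_gap hf hc1 h4

/-- Away from `D n` the gap lemma applies, so the order can fail only if `D n` carries the maximum
of `I(h)`. By the formula for two independent Fréchet variables that probability is the share of `D
n` in `∫ h ^ α`, which tends to `0`. -/
theorem fLe_extremalIntegral_of_le (hM : IsFrechetSupMeasure P m f α κ M)
    (hf : IsLossFunction f) (hα : 0 < α) (hg : MemLPlus α m g) (hh : MemLPlus α m h)
    (hgh : ∀ s, g s ≤ h s) :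
    ∀ᵐ ω ∂P, fLe f (extremalIntegral P m f M g ω) (extremalIntegral P m f M h ω) := by
  have hmono : ∀ {g h : E → ℝ} (B : Set E), (∀ s, g s ≤ h s) →
      ∀ s, B.indicator g s ≤ B.indicator h s := fun B hgh s => Set.indicator_le_indicator (hgh s)
  -- The share is a quotient by `∫ |h| ^ α`, so vanishing `h` is treated first.
  rcases (integral_rpow_nonneg (α := α) (m := m) h).eq_or_lt with hJ | hJ
  · filter_upwards [map_extremalIntegral_mono hM hf hα hg hh hgh,
      extremalIntegral_eq_zero hM hf hα hh hJ.symm] with ω h1 h2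
    rw [h2, hf.map_zero] at h1
    exact Or.inr ((hf.eq_zero_of_nonpos h1).trans h2.symm)
  let c : ℕ → ℝ := fun n => 1 - 1 / ((n : ℝ) + 1)
  have hc0 : ∀ n, 0 ≤ c n := fun n => by
    have : 1 / ((n : ℝ) + 1) ≤ 1 := by
      rw [div_le_one (by positivity)]
      linarith [(Nat.cast_nonneg n : (0 : ℝ) ≤ n)]
    exact sub_nonneg.2 this
  have hc1 : ∀ n, c n < 1 := fun n => sub_lt_self _ (by positivity)
  have hclim : Tendsto c atTop (𝓝 1) := by
    simpa [c] using (tendsto_const_nhds (x := (1 : ℝ))).sub tendsto_one_div_add_atTop_nhds_zero_nat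
  -- the set on which the ratio of `g` and `h` is close to `1` but not `1`
  let D : ℕ → Set E := fun n => {s | c n * h s < g s} ∩ {s | g s < h s}
  have hD : ∀ n, MeasurableSet (D n) := fun n =>
    (measurableSet_lt (hh.measurable.const_mul _) hg.measurable).inter
      (measurableSet_lt hg.measurable hh.measurable)
  have hDlim : Tendsto (fun n => ∫ s, |(D n).indicator h s| ^ α ∂m) atTop (𝓝 0) := by
    have := tendsto_integral_of_dominated_convergence (μ := m)
      (F := fun n s => |(D n).indicator h s| ^ α) (f := fun _ => 0) (fun s => |h s| ^ α)
      (fun n => ((hh.indicator (hD n)).integrable_rpow hα).aestronglyMeasurable)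
      (hh.integrable_rpow hα) (fun n => ae_of_all _ fun s => by
        rw [Real.norm_of_nonneg (Real.rpow_nonneg (abs_nonneg _) _)]
        refine Real.rpow_le_rpow (abs_nonneg _) ?_ hα.le
        by_cases hs : s ∈ D n
        · rw [Set.indicator_of_mem hs]
        · rw [Set.indicator_of_notMem hs, abs_zero]
          exact abs_nonneg _)
      (ae_of_all _ fun s => by
        refine tendsto_const_nhds.congr' ?_
        by_cases hs : g s < h s
        · have h1 : Tendsto (fun n => c n * h s) atTop (𝓝 (h s)) := by
            simpa using hclim.mul_const (h s)
          filter_upwards [h1.eventually_const_lt hs] with n hn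
          rw [Set.indicator_of_notMem fun h' => lt_asymm hn h'.1, abs_zero,
            Real.zero_rpow hα.ne']
        · refine Eventually.of_forall fun n => ?_
          have hsD : s ∉ D n := fun h' => hs h'.2
          beta_reduce
          rw [Set.indicator_of_notMem hsD, abs_zero, Real.zero_rpow hα.ne'])
    simpa using this
  have hbound : ∀ n, P {ω | ¬ fLe f (extremalIntegral P m f M g ω)
      (extremalIntegral P m f M h ω)} ≤
      ENNReal.ofReal ((∫ s, |(D n).indicator h s| ^ α ∂m) / ∫ s, |h s| ^ α ∂m) := fun n => by
    have hhD := hh.indicator (hD n)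
    have hhDc := hh.indicator (hD n).compl
    -- The nonvanishing clause is needed when `D n` contributes scale `0`: there it excludes the
    -- failure outright, as the two-variable formula requires a positive scale.
    have hsub : ∀ᵐ ω ∂P, ¬ fLe f (extremalIntegral P m f M g ω)
        (extremalIntegral P m f M h ω) →
        f (extremalIntegral P m f M ((D n)ᶜ.indicator h) ω) ≤
          f (extremalIntegral P m f M ((D n).indicator h) ω) ∧
        f (extremalIntegral P m f M ((D n).indicator h) ω) ≠ 0 := by
      have hgap : ∀ s, (D n)ᶜ.indicator g s = (D n)ᶜ.indicator h s ∨
          (D n)ᶜ.indicator g s ≤ c n * (D n)ᶜ.indicator h s := fun s => by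
        by_cases hs : s ∈ D n
        · simp [hs]
        · have hs' : s ∈ (D n)ᶜ := hs
          rw [Set.indicator_of_mem hs', Set.indicator_of_mem hs']
          by_contra hcon
          push Not at hcon
          exact hs ⟨hcon.2, lt_of_le_of_ne (hgh s) hcon.1⟩
      filter_upwards [extremalIntegral_eq_fVee_indicator hM hf hα hg (hD n),
        extremalIntegral_eq_fVee_indicator hM hf hα hh (hD n),
        map_extremalIntegral_mono hM hf hα (hg.indicator (hD n)) hhD (hmono _ hgh),
        map_extremalIntegral_mono hM hf hα hg hh hgh,
        fLe_extremalIntegral_of_gap hM hf hα (hg.indicator (hD n).compl) hhDc (hc0 n) (hc1 n) hgap]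
        with ω h1 h2 h3 h4 h5 hbad
      have hle : f (extremalIntegral P m f M ((D n)ᶜ.indicator h) ω) ≤
          f (extremalIntegral P m f M ((D n).indicator h) ω) := by
        by_contra hlt
        refine hbad ?_
        rw [h1, h2]
        exact fLe_fVee_fVee_of_lt h3 h5 (not_le.1 hlt)
      refine ⟨hle, fun h0 => hbad (Or.inr ?_)⟩
      have hz : f (extremalIntegral P m f M h ω) ≤ 0 := by
        rw [h2, map_fVee (f := f), max_eq_left hle, h0]
      exact (hf.eq_zero_of_nonpos (h4.trans hz)).trans (hf.eq_zero_of_nonpos hz).symm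
    rcases (integral_rpow_nonneg (α := α) (m := m) ((D n).indicator h)).eq_or_lt with hJD | hJD
    · refine le_of_eq_of_le (b := 0) ?_ bot_le
      refine measure_eq_zero_iff_ae_notMem.2 ?_
      filter_upwards [hsub, extremalIntegral_eq_zero hM hf hα hhD hJD.symm] with ω h1 h2 h3
      exact (h1 h3).2 (by rw [h2, hf.map_zero])
    · have key := HasFrechetTail.measure_le hα (measurable_map_extremalIntegral hM hf hα hhD)
        (measurable_map_extremalIntegral hM hf hα hhDc)
        ((indepFun_extremalIntegral_indicator hM hf hα hh (hD n)).comp hf.measurable hf.measurable)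
        hJD (integral_rpow_nonneg _) (hasFrechetTail_extremalIntegral hM hf hα hhD)
        (hasFrechetTail_extremalIntegral hM hf hα hhDc)
      rw [integral_rpow_indicator_add_compl hα hh (hD n)] at key
      rw [← key]
      refine measure_mono_ae ?_
      filter_upwards [hsub] with ω h1 h2
      exact (h1 h2).1
  have hlim := ENNReal.tendsto_ofReal (hDlim.div_const (∫ s, |h s| ^ α ∂m))
  rw [zero_div, ENNReal.ofReal_zero] at hlim
  exact le_antisymm (ge_of_tendsto' hlim hbound) bot_le

theorem fLe_extremalIntegral_of_ae_le (hM : IsFrechetSupMeasure P m f α κ M)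
    (hf : IsLossFunction f) (hα : 0 < α) (hg : MemLPlus α m g) (hh : MemLPlus α m h)
    (hgh : ∀ᵐ s ∂m, g s ≤ h s) :
    ∀ᵐ ω ∂P, fLe f (extremalIntegral P m f M g ω) (extremalIntegral P m f M h ω) := by
  have hN : MeasurableSet {s | ¬ g s ≤ h s} := (measurableSet_le hg.measurable hh.measurable).compl
  have hle : ∀ s, {s | ¬ g s ≤ h s}ᶜ.indicator g s ≤ {s | ¬ g s ≤ h s}ᶜ.indicator h s := fun s => by
    by_cases hs : g s ≤ h s
    · have hs' : s ∈ {s | ¬ g s ≤ h s}ᶜ := fun h' => h' hs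
      rwa [Set.indicator_of_mem hs', Set.indicator_of_mem hs']
    · have hs' : s ∉ {s | ¬ g s ≤ h s}ᶜ := fun h' => h' hs
      rw [Set.indicator_of_notMem hs', Set.indicator_of_notMem hs']
  filter_upwards [extremalIntegral_ae_eq_indicator_compl hM hf hα hg hN (ae_iff.1 hgh),
    extremalIntegral_ae_eq_indicator_compl hM hf hα hh hN (ae_iff.1 hgh),
    fLe_extremalIntegral_of_le hM hf hα (hg.indicator hN.compl) (hh.indicator hN.compl) hle]
    with ω h1 h2 h3
  rwa [h1, h2]

/-- The relation `≤_f` is antisymmetric on vectors, not merely on their values under `f`, so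
two-sided monotonicity identifies the integrals. -/
theorem extremalIntegral_congr_ae (hM : IsFrechetSupMeasure P m f α κ M)
    (hf : IsLossFunction f) (hα : 0 < α) (hg : MemLPlus α m g) (hh : MemLPlus α m h)
    (hgh : ∀ᵐ s ∂m, g s = h s) :
    ∀ᵐ ω ∂P, extremalIntegral P m f M g ω = extremalIntegral P m f M h ω := by
  filter_upwards [fLe_extremalIntegral_of_ae_le hM hf hα hg hh (hgh.mono fun s hs => hs.le),
    fLe_extremalIntegral_of_ae_le hM hf hα hh hg (hgh.mono fun s hs => hs.ge)] with ω h1 h2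
  exact h1.antisymm h2

/-- Split along `{h ≤ g}`: the maximum equals `g` on one side and `h` on the other, and on each side
the smaller integrand has the `≤_f`-smaller integral. The two winning parts are independent, hence
without nonzero ties. -/
theorem extremalIntegral_max (hM : IsFrechetSupMeasure P m f α κ M)
    (hf : IsLossFunction f) (hα : 0 < α) (hg : MemLPlus α m g) (hh : MemLPlus α m h) :
    ∀ᵐ ω ∂P, extremalIntegral P m f M (fun s => max (g s) (h s)) ω =
      fVee f (extremalIntegral P m f M g ω) (extremalIntegral P m f M h ω) := by
  have hB : MeasurableSet {s | h s ≤ g s} := measurableSet_le hh.measurable hg.measurable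
  set B := {s | h s ≤ g s} with hBdef
  have hu := hg.max hh
  have e1 : B.indicator (fun s => max (g s) (h s)) = B.indicator g :=
    Set.indicator_congr fun s hs => max_eq_left hs
  have e2 : Bᶜ.indicator (fun s => max (g s) (h s)) = Bᶜ.indicator h :=
    Set.indicator_congr fun s hs => max_eq_right (not_le.1 (show ¬ h s ≤ g s from hs)).le
  have l1 : ∀ s, B.indicator h s ≤ B.indicator g s := fun s => by
    by_cases hs : s ∈ B
    · rw [Set.indicator_of_mem hs, Set.indicator_of_mem hs]
      exact hs
    · rw [Set.indicator_of_notMem hs, Set.indicator_of_notMem hs]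
  have l2 : ∀ s, Bᶜ.indicator g s ≤ Bᶜ.indicator h s := fun s => by
    by_cases hs : s ∈ Bᶜ
    · rw [Set.indicator_of_mem hs, Set.indicator_of_mem hs]
      exact (not_le.1 (show ¬ h s ≤ g s from hs)).le
    · rw [Set.indicator_of_notMem hs, Set.indicator_of_notMem hs]
  have h1 := extremalIntegral_eq_fVee_indicator hM hf hα hu hB
  have h2 := map_extremalIntegral_indicator_ne hM hf hα hu hB
  rw [e1, e2] at h1 h2
  filter_upwards [h1, h2, extremalIntegral_eq_fVee_indicator hM hf hα hg hB,
    extremalIntegral_eq_fVee_indicator hM hf hα hh hB,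
    fLe_extremalIntegral_of_le hM hf hα (hh.indicator hB) (hg.indicator hB) l1,
    fLe_extremalIntegral_of_le hM hf hα (hg.indicator hB.compl) (hh.indicator hB.compl) l2]
    with ω h1 h2 h3 h4 h5 h6
  rw [h1, h3, h4]
  exact fVee_fVee_eq hf h5 h6 h2

/-! ### From the integrals back to the integrands; independence -/

theorem measure_map_extremalIntegral_le_one (hM : IsFrechetSupMeasure P m f α κ M)
    (hf : IsLossFunction f) (hα : 0 < α) (hg : MemLPlus α m g) :
    P {ω | f (extremalIntegral P m f M g ω) ≤ 1} =
      ENNReal.ofReal (Real.exp (-∫ s, |g s| ^ α ∂m)) := by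
  have := hasFrechetTail_extremalIntegral hM hf hα hg 1 one_pos
  rwa [Real.one_rpow, mul_one] at this

/-- By max-linearity `f (I (g ∨ h)) = f (I h)` almost surely, so the scales agree: `∫ (g ∨ h)^α = ∫
h^α`. The integrands are ordered, hence equal almost everywhere. -/
theorem ae_le_of_map_extremalIntegral_le (hM : IsFrechetSupMeasure P m f α κ M)
    (hf : IsLossFunction f) (hα : 0 < α) (hg : MemLPlus α m g) (hh : MemLPlus α m h)
    (hgh : ∀ᵐ ω ∂P, f (extremalIntegral P m f M g ω) ≤ f (extremalIntegral P m f M h ω)) :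
    ∀ᵐ s ∂m, g s ≤ h s := by
  have hu := hg.max hh
  have h1 : P {ω | f (extremalIntegral P m f M (fun s => max (g s) (h s)) ω) ≤ 1} =
      P {ω | f (extremalIntegral P m f M h ω) ≤ 1} := by
    refine measure_congr ?_
    filter_upwards [hgh, extremalIntegral_max hM hf hα hg hh] with ω h1 h2
    refine propext ?_
    change f (extremalIntegral P m f M (fun s => max (g s) (h s)) ω) ≤ 1 ↔
      f (extremalIntegral P m f M h ω) ≤ 1
    rw [h2, map_fVee (f := f), max_eq_right h1]
  rw [measure_map_extremalIntegral_le_one hM hf hα hu,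
    measure_map_extremalIntegral_le_one hM hf hα hh,
    ENNReal.ofReal_eq_ofReal_iff (Real.exp_pos _).le (Real.exp_pos _).le,
    Real.exp_eq_exp, neg_inj] at h1
  have hle : ∀ s, |h s| ^ α ≤ |max (g s) (h s)| ^ α := fun s => by
    refine Real.rpow_le_rpow (abs_nonneg _) ?_ hα.le
    rw [abs_of_nonneg (hh.nonneg s), abs_of_nonneg (hu.nonneg s)]
    exact le_max_right _ _
  have h2 := (integral_eq_iff_of_ae_le (hh.integrable_rpow hα) (hu.integrable_rpow hα)
    (ae_of_all _ hle)).1 h1.symm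
  filter_upwards [h2] with s hs
  rw [Real.rpow_left_inj (abs_nonneg _) (abs_nonneg _) hα.ne', abs_of_nonneg (hh.nonneg s),
    abs_of_nonneg (hu.nonneg s)] at hs
  rw [hs]
  exact le_max_left _ _

/-- Independence at the single level `1` already gives `∫ (g ∨ h)^α = ∫ g^α + ∫ h^α`, which forces
one of the two to vanish almost everywhere. Conversely, `g` and `h` are the parts of `g ∨ h` on `{g
> 0}` and on its complement, up to null sets. -/
theorem indepFun_extremalIntegral_iff (hM : IsFrechetSupMeasure P m f α κ M)
    (hf : IsLossFunction f) (hα : 0 < α) (hg : MemLPlus α m g) (hh : MemLPlus α m h) :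
    IndepFun (extremalIntegral P m f M g) (extremalIntegral P m f M h) P ↔
      ∀ᵐ s ∂m, g s * h s = 0 := by
  have hu := hg.max hh
  constructor
  · intro hind
    have hm1 : MeasurableSet {x : EuclideanSpace ℝ (Fin d) | f x ≤ 1} :=
      measurableSet_le hf.measurable measurable_const
    have h1 := hind.measure_inter_preimage_eq_mul _ _ hm1 hm1
    have h2 : P (extremalIntegral P m f M g ⁻¹' {x | f x ≤ 1} ∩
        extremalIntegral P m f M h ⁻¹' {x | f x ≤ 1}) =
        P {ω | f (extremalIntegral P m f M (fun s => max (g s) (h s)) ω) ≤ 1} := by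
      refine measure_congr ?_
      filter_upwards [extremalIntegral_max hM hf hα hg hh] with ω hω
      refine propext ?_
      change (f _ ≤ 1 ∧ f _ ≤ 1) ↔ f _ ≤ 1
      rw [hω, map_fVee (f := f), max_le_iff]
    rw [h2, measure_map_extremalIntegral_le_one hM hf hα hu] at h1
    have h3 : ENNReal.ofReal (Real.exp (-∫ s, |max (g s) (h s)| ^ α ∂m)) =
        ENNReal.ofReal (Real.exp (-∫ s, |g s| ^ α ∂m)) *
          ENNReal.ofReal (Real.exp (-∫ s, |h s| ^ α ∂m)) := by
      rw [h1, ← measure_map_extremalIntegral_le_one hM hf hα hg,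
        ← measure_map_extremalIntegral_le_one hM hf hα hh]
      rfl
    rw [← ENNReal.ofReal_mul (Real.exp_pos _).le, ← Real.exp_add,
      ENNReal.ofReal_eq_ofReal_iff (Real.exp_pos _).le (Real.exp_pos _).le, Real.exp_eq_exp,
      ← neg_add, neg_inj, ← integral_add (hg.integrable_rpow hα) (hh.integrable_rpow hα)] at h3
    have hpt : ∀ s, |max (g s) (h s)| ^ α = max (|g s| ^ α) (|h s| ^ α) := fun s => by
      rw [abs_of_nonneg (hu.nonneg s), abs_of_nonneg (hg.nonneg s), abs_of_nonneg (hh.nonneg s)]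
      exact (Real.monotoneOn_rpow_Ici_of_exponent_nonneg hα.le).map_max (hg.nonneg s) (hh.nonneg s)
    have hle : ∀ s, |max (g s) (h s)| ^ α ≤ |g s| ^ α + |h s| ^ α := fun s => by
      rw [hpt]
      have := Real.rpow_nonneg (abs_nonneg (g s)) α
      have := Real.rpow_nonneg (abs_nonneg (h s)) α
      exact max_le (by linarith) (by linarith)
    have h4 := (integral_eq_iff_of_ae_le (hu.integrable_rpow hα)
      ((hg.integrable_rpow hα).add (hh.integrable_rpow hα)) (ae_of_all _ hle)).1 h3
    filter_upwards [h4] with s hs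
    rw [hpt] at hs
    have hs' : max (|g s| ^ α) (|h s| ^ α) = |g s| ^ α + |h s| ^ α := hs
    have hz : |g s| ^ α = 0 ∨ |h s| ^ α = 0 := by
      rcases max_choice (|g s| ^ α) (|h s| ^ α) with h' | h' <;> rw [h'] at hs'
      · exact Or.inr (by linarith)
      · exact Or.inl (by linarith)
    rcases hz with hz | hz
    · rw [abs_eq_zero.1 ((Real.rpow_eq_zero (abs_nonneg _) hα.ne').1 hz), zero_mul]
    · rw [abs_eq_zero.1 ((Real.rpow_eq_zero (abs_nonneg _) hα.ne').1 hz), mul_zero]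
  · intro h0
    have hB : MeasurableSet {s | 0 < g s} := measurableSet_lt measurable_const hg.measurable
    have hind := indepFun_extremalIntegral_indicator hM hf hα hu hB
    refine hind.congr ?_ ?_
    · refine extremalIntegral_congr_ae hM hf hα (hu.indicator hB) hg ?_
      filter_upwards [h0] with s hs
      by_cases hgs : 0 < g s
      · rw [Set.indicator_of_mem (show s ∈ {s | 0 < g s} from hgs),
          (mul_eq_zero.1 hs).resolve_left hgs.ne', max_eq_left hgs.le]
      · rw [Set.indicator_of_notMem (show s ∉ {s | 0 < g s} from hgs)]
        exact le_antisymm (hg.nonneg s) (not_lt.1 hgs)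
    · refine extremalIntegral_congr_ae hM hf hα (hu.indicator hB.compl) hh ?_
      filter_upwards [h0] with s hs
      by_cases hgs : 0 < g s
      · rw [Set.indicator_of_notMem (show s ∉ {s | 0 < g s}ᶜ from fun h' => h' hgs),
          (mul_eq_zero.1 hs).resolve_left hgs.ne']
      · rw [Set.indicator_of_mem (show s ∈ {s | 0 < g s}ᶜ from hgs),
          max_eq_right ((not_lt.1 hgs).trans (hh.nonneg s))]

end Integral

theorem mainTheorem2 {Ω E : Type*} [MeasurableSpace Ω] [MeasurableSpace E]
    (P : Measure Ω) [IsProbabilityMeasure P] (m : Measure E) [SigmaFinite m]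
    {d : ℕ} (f : EuclideanSpace ℝ (Fin d) → ℝ) (hf : IsLossFunction f)
    (α : ℝ) (hα : 0 < α) (κ : Measure (levelOne f)) [IsProbabilityMeasure κ]
    (M : Set E → Ω → EuclideanSpace ℝ (Fin d)) (hM : IsFrechetSupMeasure P m f α κ M)
    (g₁ g₂ : E → ℝ) (hg₁ : MemLPlus α m g₁) (hg₂ : MemLPlus α m g₂) :
    -- the integral is well defined, whatever the approximating simple functions
    (IsExtremalIntegral P m f M g₁ (extremalIntegral P m f M g₁) ∧
      ∀ r : ℕ → SimpleRep m, IncreasesTo r g₁ →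
        TendstoInMeasure P (fun n => (r n).integral f M) atTop (extremalIntegral P m f M g₁)) ∧
    -- (i) distribution
    IsImplicitFrechet P f α κ (alphaNorm α m g₁) (extremalIntegral P m f M g₁) ∧
    -- (ii) max-linearity and commutation
    (∀ a b : ℝ, 0 ≤ a → 0 ≤ b →
      ∀ᵐ ω ∂P, extremalIntegral P m f M (fun s => max (a * g₁ s) (b * g₂ s)) ω =
        fVee f (a • extremalIntegral P m f M g₁ ω) (b • extremalIntegral P m f M g₂ ω)) ∧
    (∀ᵐ ω ∂P,
      fVee f (extremalIntegral P m f M g₁ ω) (extremalIntegral P m f M g₂ ω) =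
        fVee f (extremalIntegral P m f M g₂ ω) (extremalIntegral P m f M g₁ ω)) ∧
    -- (iii) independence
    (IndepFun (extremalIntegral P m f M g₁) (extremalIntegral P m f M g₂) P ↔
      ∀ᵐ s ∂m, g₁ s * g₂ s = 0) ∧
    -- (iv) monotonicity
    ((∀ᵐ s ∂m, g₁ s ≤ g₂ s) ↔
      ∀ᵐ ω ∂P, fLe f (extremalIntegral P m f M g₁ ω) (extremalIntegral P m f M g₂ ω)) ∧
    ((∀ᵐ s ∂m, g₁ s = g₂ s) ↔
      ∀ᵐ ω ∂P, extremalIntegral P m f M g₁ ω = extremalIntegral P m f M g₂ ω) := by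
  have hmax := fun {a b : ℝ} (ha : 0 ≤ a) (hb : 0 ≤ b) =>
    extremalIntegral_max hM hf hα (hg₁.const_mul ha) (hg₂.const_mul hb)
  have hle : ∀ {g h : E → ℝ}, MemLPlus α m g → MemLPlus α m h → ((∀ᵐ s ∂m, g s ≤ h s) ↔
      ∀ᵐ ω ∂P, fLe f (extremalIntegral P m f M g ω) (extremalIntegral P m f M h ω)) :=
    fun hg hh => ⟨fLe_extremalIntegral_of_ae_le hM hf hα hg hh, fun hI =>
      ae_le_of_map_extremalIntegral_le hM hf hα hg hh (hI.mono fun ω hω => hω.map_le)⟩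
  refine ⟨⟨isExtremalIntegral_extremalIntegral hM hf hα hg₁, fun r hr =>
    hr.tendsto_extremalIntegral hM hf hα hg₁⟩, isImplicitFrechet_extremalIntegral hM hf hα hg₁,
    fun a b ha hb => ?_, ?_, indepFun_extremalIntegral_iff hM hf hα hg₁ hg₂, hle hg₁ hg₂,
    extremalIntegral_congr_ae hM hf hα hg₁ hg₂, fun hI => ?_⟩
  · filter_upwards [hmax ha hb, extremalIntegral_const_mul hM hf hα hg₁ ha,
      extremalIntegral_const_mul hM hf hα hg₂ hb] with ω h1 h2 h3
    rw [h1, h2, h3]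
  · have h1 := extremalIntegral_max hM hf hα hg₁ hg₂
    have h2 := extremalIntegral_max hM hf hα hg₂ hg₁
    simp only [max_comm (g₂ _)] at h2
    filter_upwards [h1, h2] with ω h1 h2
    rw [← h1, ← h2]
  · filter_upwards [(hle hg₁ hg₂).2 (hI.mono fun ω hω => Or.inr hω),
      (hle hg₂ hg₁).2 (hI.mono fun ω hω => Or.inr hω.symm)] with s h1 h2
    exact le_antisymm h1 h2
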